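/- **Conventions.** All theories are first order, $T$ is complete. $\mathrm{tp}_{qf}(\bar t,\bar s,J)$ is the quantifier-free type of $\bar t$ over $\bar s$ in $J$ (equality of types includes equality of lengths). Vocabularies of index models contain a symbol $<$, and function symbols may be interpreted by partial functions (with a predicate for the domain); $\mathrm{cl}$ is closure under these functions. *Templates.* Let $\mathcal K$ be a class of index models. A template $\Phi$ consists of a vocabulary $\tau_\Phi$ and a map sending the quantifier-free type of a finite sequence $t_0,\dots,t_{n-1}$ of an index model to a quantifier-free $\tau_\Phi$-type. $N=\mathrm{GEM}(I,\Phi)$ with skeleton $\langle \bar a_t:t\in I\rangle$ means: $N$ is a $\tau_\Phi$-structure generated by the finite sequences $\bar a_t$, and $\Phi$ sends the quantifier-free type of $t_0,\dots,t_{n-1}$ in $I$ to that of $\bar a_{t_0}{}^\frown\cdots{}^\frown\bar a_{t_{n-1}}$ in $N$. $\Phi$ is proper for $\mathcal K$ if $\mathrm{GEM}(I,\Phi)$ exists for all $I\in\mathcal K$; $T_\Phi$ is the set of sentences true in all of these. $\Upsilon_{\mathcal K}$ is the class of templates $\Phi$ proper for $\mathcal K$ such that skeletons consist of nonempty sequences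 and are without repetition; $T_\Phi$ is complete and has Skolem functions; skeletons are fully (not only quantifier-free) indiscernible; for $I\subseteq J$ in $\mathcal K$, $\mathrm{GEM}(I,\Phi)\preceq\mathrm{GEM}(J,\Phi)$ (as witnessed by the map that extends the inclusion of skeletons); and $\mathrm{GEM}(I,\Phi)$ depends up to isomorphism only on $\Phi$ and the isomorphism type of $I$. $\Phi\le\Psi$ means that $\tau_\Phi\subseteq\tau_\Psi$ and for every $I\in\mathcal K$, $\mathrm{GEM}(I,\Phi)$ is, with the same skeleton, an elementary submodel of the $\tau_\Phi$-reduct of $\mathrm{GEM}(I,\Psi)$. $\Upsilon_{\mathcal K}[T]$ is the class of $\Phi\in\Upsilon_{\mathcal K}$ with $\tau_\Phi\supseteq\tau(T)$, $T_\Phi\supseteq T$, and $T_\Phi$ having Skolem functions for $T$. $\mathrm{GEM}_{\tau(T)}(I,\Phi)$ is the $\tau(T)$-reduct. *Contexts.* $J\in\mathcal K$ is $\aleph_0$-saturated if it is countably homogeneous for quantifier-free types of finite sequences and countably universal for $\mathcal K$. $\mathcal K$ is an index model class if it is closed under isomorphism, each member is (nonempty and) linearly ordered by $<$, a model is in $\mathcal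 K$ iff all its finitely generated submodels are, each member embeds in an $\aleph_0$-saturated member, and $\mathcal K$ is Ramsey: for each $\aleph_0$-saturated $J\in\mathcal K$, each model $M$ and each family $\langle\bar b_t:t\in J\rangle$ of finite sequences of $M$ with $\mathrm{lgn}(\bar b_t)$ determined by $\mathrm{tp}_{qf}(t,\emptyset,J)$, there is a template $\Psi$ proper for $\mathcal K$ with $\tau(M)\subseteq\tau_\Psi$, with skeletons of the same lengths, such that for all $\tau(M)$-formulas $\varphi$, $\tau(M)$-terms $\bar\sigma$ and $\bar s$ from $J$: if $M\models\varphi[\bar\sigma(\bar b_{\bar t})]$ for all $\bar t$ with $\mathrm{tp}_{qf}(\bar t,\emptyset,J)=\mathrm{tp}_{qf}(\bar s,\emptyset,J)$, then $\mathrm{GEM}(J,\Psi)\models\varphi[\bar\sigma(\bar a_{\bar s})]$. A countable context is a pair $\mathbf c=(I,\mathcal K)$ with $\mathcal K$ an index model class and $I\in\mathcal K$ countable such that: $I\ne\mathrm{cl}(\bar t)$ for every finite $\bar t$ from $I$; and whenever $I\subseteq J\in\mathcal K$ with $J$ $\aleph_0$-saturated, $\bar t$ is a finite sequence from $I$ and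 $s\in J$: if $s$ is the only realization in $J$ of $\mathrm{tp}_{qf}(s,\bar t,J)$ then $s\in\mathrm{cl}_I(\bar t)$, and if $s\notin\mathrm{cl}(\bar t)$ then this type has infinitely many realizations in $J$. Write $\Upsilon_{\mathbf c}=\Upsilon_{\mathcal K}$ and $\Upsilon_{\mathbf c}[T]=\Upsilon_{\mathcal K}[T]$. *Shearing.* Let $M\models T$ and $A\subseteq M$, and let $I_0\subseteq I_1$ be finite subsets of $I$. A formula $\varphi(\bar x,\bar c)$ with parameters in $M$ shears over $A$ for $(I_0,I_1)$ if there are $N\succeq M$, an $\aleph_0$-saturated $J\supseteq I$ in $\mathcal K$, enumerations $\bar s_0$ of $I_0$ and $\bar t$ of $I_1$, and finite sequences $\bar b_{\bar s}$ of $N$ for $\bar s\in{}^{\omega>}J$ with $\bar b_{\bar t}=\bar c$ such that (i) whenever $\mathrm{lgn}(\bar t_\ell)=\mathrm{lgn}(\bar t'_\ell)$ for all $\ell<k$ and $\bar t_0{}^\frown\cdots{}^\frown\bar t_{k-1}$, $\bar t'_0{}^\frown\cdots{}^\frown\bar t'_{k-1}$ have the same quantifier-free type over $\bar s_0$ in $J$,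 then $\bar b_{\bar t_0}{}^\frown\cdots{}^\frown\bar b_{\bar t_{k-1}}$ and $\bar b_{\bar t'_0}{}^\frown\cdots{}^\frown\bar b_{\bar t'_{k-1}}$ have the same type over $A$ in $N$; (ii) $\{\varphi(\bar x,\bar b_{\bar t'}):\mathrm{tp}_{qf}(\bar t',\bar s_0,J)=\mathrm{tp}_{qf}(\bar t,\bar s_0,J)\}$ is contradictory. A partial type over $C$ shears if finitely many of its formulas imply a formula over $C$ (for instance, one of its members) which shears. $T$ is $\mathbf c$-unsuperstable if there are an increasing sequence of nonempty finite sets $I_n$ with union $I$ (with enumerations $\bar s_n$ of $I_n$, $\bar s_n$ an initial segment of $\bar s_{n+1}$), an increasing sequence of nonempty sets $B_n$ in a model of $T$, and a partial type $p$ in finitely many variables over $\bigcup_nB_n$ such that for every $n$, $p\restriction B_{n+1}$ shears over $B_n$ for $(I_n,I_{n+1})$. For a set $\Delta$ of formulas $\varphi(\bar x;\bar y)$ of $T$, a $\Delta$-type is a partial type consisting of instances $\varphi(\bar x,\bar c)$ of members of $\Delta$; $(T,\Delta)$ is $\mathbf c$-unsuperstable if $p$ can be taken to be a $\Delta$-type.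 **Theorem.** Let $\mathbf c=(I,\mathcal K)$ be a countable context, $T$ a complete theory and $\Phi\in\Upsilon_{\mathbf c}[T]$. (1) If $T$ is $\mathbf c$-unsuperstable, then there is $\Phi_*\in\Upsilon_{\mathbf c}[T]$ with $\Phi_*\ge\Phi$ and $|\tau(\Phi_*)|\le|T|+|\tau_\Phi|+\aleph_0$ such that for every $\Psi\in\Upsilon_{\mathbf c}$ with $\Psi\ge\Phi_*$, the model $\mathrm{GEM}_{\tau(T)}(I,\Psi)$ is not $\aleph_1$-saturated. (2) Let $\Delta$ be a set of formulas of $T$. If $(T,\Delta)$ is $\mathbf c$-unsuperstable, then there is $\Phi_*\in\Upsilon_{\mathbf c}[T]$ with $\Phi_*\ge\Phi$ and $|\tau(\Phi_*)|\le|T|+|\tau_\Phi|+\aleph_0$ such that for every $\Psi\in\Upsilon_{\mathbf c}$ with $\Psi\ge\Phi_*$, the model $\mathrm{GEM}_{\tau(T)}(I,\Psi)$ is not $\aleph_1$-saturated and, in particular, omits a $\Delta$-type over a countable set. -/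

import Mathlib

open FirstOrder FirstOrder.Language Cardinal

universe u

/-! ### Index models: structures whose function symbols may be interpreted by partial functions -/

namespace GemModels

/-- A structure for the vocabulary `τ` in which function symbols are interpreted by partial
functions. The domain predicate of a function symbol `F` is not carried separately: it is the
atomic formula `F x = F x`, which holds exactly where `F` is defined (see `IndexModel.Holds`). -/
structure IndexModel (τ : FirstOrder.Language.{u, u}) where
  carrier : Type u
  fn : ∀ {n : ℕ}, τ.Functions n → (Fin n → carrier) → Part carrier
  rel : ∀ {n : ℕ}, τ.Relations n → (Fin n → carrier) → Prop

instance (τ : FirstOrder.Language.{u, u}) : CoeSort (IndexModel τ) (Type u) := ⟨IndexModel.carrier⟩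

namespace IndexModel

variable {τ : FirstOrder.Language.{u, u}}

/-- `I.TermVal v t y`: the term `t` is defined at the assignment `v` and its value is `y`. -/
def TermVal (I : IndexModel τ) {α : Type} (v : α → I) : τ.Term α → I → Prop
  | .var a, y => y = v a
  | .func f ts, y => ∃ x, (∀ i, TermVal I v (ts i) (x i)) ∧ y ∈ I.fn f x

/-- Satisfaction in an index model. An atomic formula holds when all its terms are defined and the
stated relation (or equality) holds between the values. -/
def Holds (I : IndexModel τ) {α : Type} (v : α → I) :
    ∀ {n : ℕ}, τ.BoundedFormula α n → (Fin n → I) → Prop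
  | _, .falsum, _ => False
  | _, .equal t₁ t₂, x => ∃ y, I.TermVal (Sum.elim v x) t₁ y ∧ I.TermVal (Sum.elim v x) t₂ y
  | _, .rel R ts, x => ∃ y, (∀ i, I.TermVal (Sum.elim v x) (ts i) (y i)) ∧ I.rel R y
  | _, .imp φ ψ, x => Holds I v φ x → Holds I v ψ x
  | _, .all φ, x => ∀ a, Holds I v φ (Fin.snoc x a)

end IndexModel

/-- Possible quantifier-free types (over the empty set) of finite sequences: a length `n` and a set
of formulas in `n` variables. -/
abbrev QFType (L : FirstOrder.Language.{u, u}) : Type u := Σ n : ℕ, Set (L.Formula (Fin n))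

namespace IndexModel

variable {τ : FirstOrder.Language.{u, u}}

/-- The quantifier-free type over the empty set of a finite sequence in an index model. -/
def qftp (I : IndexModel τ) (t : List I) : QFType τ :=
  ⟨t.length, {φ | BoundedFormula.IsQF φ ∧ I.Holds t.get φ Fin.elim0}⟩

/-- `J.SameQF s t t'`: the sequences `t`, `t'` have the same quantifier-free type over the
sequence `s` in `J` (in particular they have the same length). -/
def SameQF (J : IndexModel τ) (s t t' : List J) : Prop :=
  J.qftp (s ++ t) = J.qftp (s ++ t')

/-- The closure of a set under the (partial) functions. -/
inductive Cl (I : IndexModel τ) (A : Set I) : I → Prop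
  | base (x : I) : x ∈ A → Cl I A x
  | app {n : ℕ} (f : τ.Functions n) (x : Fin n → I) (y : I) :
      (∀ i, Cl I A (x i)) → y ∈ I.fn f x → Cl I A y

/-- The closure of a set, as a set. -/
def cl (I : IndexModel τ) (A : Set I) : Set I := {x | I.Cl A x}

/-- The submodel generated by a set. -/
def generated (I : IndexModel τ) (A : Set I) : IndexModel τ where
  carrier := {x : I // I.Cl A x}
  fn f x := ⟨(I.fn f fun i => (x i).1).Dom, fun h =>
    ⟨(I.fn f fun i => (x i).1).get h,
      Cl.app f (fun i => (x i).1) _ (fun i => (x i).2) (Part.get_mem h)⟩⟩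
  rel R x := I.rel R fun i => (x i).1

/-- Embeddings of index models; function symbols have corresponding domains. -/
structure Embedding (I J : IndexModel τ) where
  toFun : I → J
  injective : Function.Injective toFun
  map_fn : ∀ {n : ℕ} (f : τ.Functions n) (x : Fin n → I),
    J.fn f (toFun ∘ x) = (I.fn f x).map toFun
  map_rel : ∀ {n : ℕ} (R : τ.Relations n) (x : Fin n → I), J.rel R (toFun ∘ x) ↔ I.rel R x

/-- Isomorphism of index models. -/
def Isomorphic (I J : IndexModel τ) : Prop :=
  ∃ e : Embedding I J, Function.Surjective e.toFun

/-- `J` is an `ℵ₀`-saturated member of `K`: countably homogeneous (for finite sequences and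
quantifier-free types) and countably universal for `K`. -/
structure IsSat (K : Set (IndexModel τ)) (J : IndexModel τ) : Prop where
  mem : J ∈ K
  homogeneous : ∀ (s t : List J) (x : J), J.qftp s = J.qftp t →
    ∃ y, J.qftp (s ++ [x]) = J.qftp (t ++ [y])
  universal : ∀ A ∈ K, (∃ S : Set A, S.Countable ∧ A.cl S = Set.univ) → Nonempty (Embedding A J)

end IndexModel

/-! ### Types, saturation -/

section Types

variable {L : FirstOrder.Language.{u, u}} {M : Type u}

/-- A formula `φ(x, c)` of `L` in the variables `x = (x_0, …, x_{m-1})` with parameters `c`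
from `M`. -/
structure ParamFormula (L : FirstOrder.Language.{u, u}) (m : ℕ) (M : Type u) where
  len : ℕ
  formula : L.Formula (Fin m ⊕ Fin len)
  param : Fin len → M

/-- `x` satisfies `φ(x, c)`. -/
def ParamFormula.Sat [L.Structure M] {m : ℕ} (f : ParamFormula L m M) (x : Fin m → M) : Prop :=
  f.formula.Realize (Sum.elim x f.param)

/-- The parameters come from `A`. -/
def ParamFormula.Over {m : ℕ} (f : ParamFormula L m M) (A : Set M) : Prop :=
  ∀ i, f.param i ∈ A

/-- A set of formulas with parameters in `M` is consistent (with the elementary diagram of `M`):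
each finite subset is satisfied in `M`. -/
def Consistent [L.Structure M] {m : ℕ} (p : Set (ParamFormula L m M)) : Prop :=
  ∀ p₀ ⊆ p, p₀.Finite → ∃ x, ∀ f ∈ p₀, f.Sat x

/-- `p` is a partial type over `A` in `M`. -/
def IsPartialType [L.Structure M] {m : ℕ} (A : Set M) (p : Set (ParamFormula L m M)) : Prop :=
  (∀ f ∈ p, f.Over A) ∧ Consistent p

/-- `p` is realized in `M`. -/
def Realized [L.Structure M] {m : ℕ} (p : Set (ParamFormula L m M)) : Prop :=
  ∃ x, ∀ f ∈ p, f.Sat x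

/-- A set of partitioned formulas `φ(x; y)`. -/
abbrev FormulaSet (L : FirstOrder.Language.{u, u}) : Type u := Set (Σ (m : ℕ) (k : ℕ), L.Formula (Fin m ⊕ Fin k))

/-- Every member of `p` is an instance `φ(x, c)` of a formula `φ(x; y) ∈ Δ`. (Negations are only
allowed when they belong to `Δ`.) -/
def IsDeltaType {m : ℕ} (Δ : FormulaSet L) (p : Set (ParamFormula L m M)) : Prop :=
  ∀ f ∈ p, (⟨m, f.len, f.formula⟩ : Σ m k : ℕ, L.Formula (Fin m ⊕ Fin k)) ∈ Δ

/-- `M` is `κ`-saturated. -/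
def IsSaturated (L : FirstOrder.Language.{u, u}) (M : Type u) [L.Structure M] (κ : Cardinal.{u}) : Prop :=
  ∀ A : Set M, #A < κ → ∀ (m : ℕ) (p : Set (ParamFormula L m M)), IsPartialType A p → Realized p

/-- `M` omits a `Δ`-type over a countable set. -/
def OmitsDeltaType (L : FirstOrder.Language.{u, u}) (M : Type u) [L.Structure M] (Δ : FormulaSet L) : Prop :=
  ∃ A : Set M, A.Countable ∧ ∃ (m : ℕ) (p : Set (ParamFormula L m M)),
    IsPartialType A p ∧ IsDeltaType Δ p ∧ ¬ Realized p

/-- The type over `A` of a finite sequence in `M`: its length and the formulas with parameters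
from `A` that it satisfies. -/
def tpOver (L : FirstOrder.Language.{u, u}) [L.Structure M] (A : Set M) (l : List M) :
    Σ n : ℕ, Set (ParamFormula L n M) :=
  ⟨l.length, {f | f.Over A ∧ f.Sat l.get}⟩

/-- The quantifier-free type over the empty set of a finite sequence in `M`. -/
def qfType (L : FirstOrder.Language.{u, u}) [L.Structure M] (l : List M) : QFType L :=
  ⟨l.length, {φ | BoundedFormula.IsQF φ ∧ φ.Realize l.get}⟩

end Types

/-! ### Templates and generalized Ehrenfeucht–Mostowski models -/

/-- A template: a vocabulary, and a map from quantifier-free types of sequences in index models to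
quantifier-free types in that vocabulary. -/
structure Template (τ : FirstOrder.Language.{u, u}) where
  lang : FirstOrder.Language.{u, u}
  tp : QFType τ → QFType lang

namespace Template

variable {τ : FirstOrder.Language.{u, u}}

/-- `N` is `GEM(I, Φ)` with skeleton `a`: the finite sequences `a t`, for `t` in `I`, generate `N`,
and `Φ` maps the quantifier-free type of `t_0, …, t_{n-1}` in `I` to the quantifier-free type of the
concatenation of `a t_0, …, a t_{n-1}` in `N`. (So the skeleton is quantifier-free
indiscernible.) -/
structure IsGEM (Φ : Template τ) (I : IndexModel τ) (N : Type u) [Φ.lang.Structure N]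
    (a : I → List N) : Prop where
  generates : Substructure.closure Φ.lang {x : N | ∃ t, x ∈ a t} = ⊤
  qfType_eq : ∀ t : List I, qfType Φ.lang (t.flatMap a) = Φ.tp (I.qftp t)

/-- `Φ` is proper for the class `K`. -/
def Proper (K : Set (IndexModel τ)) (Φ : Template τ) : Prop :=
  ∀ I ∈ K, ∃ (N : Type u) (_ : Φ.lang.Structure N) (a : I → List N), Φ.IsGEM I N a

/-- The theory `T_Φ`: the sentences true in `GEM(I, Φ)` for every `I` in `K`. -/
def theory (K : Set (IndexModel τ)) (Φ : Template τ) : Φ.lang.Theory :=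
  {φ | ∀ I ∈ K, ∀ (N : Type u) [Φ.lang.Structure N] (a : I → List N), Φ.IsGEM I N a → N ⊨ φ}

/-- `T_Φ` has Skolem functions for the formulas of `L`, where `ι` includes `L` in the vocabulary
of `Φ`. -/
def HasSkolem (K : Set (IndexModel τ)) (Φ : Template τ) {L : FirstOrder.Language.{u, u}}
    (ι : L →ᴸ Φ.lang) : Prop :=
  ∀ (n : ℕ) (φ : L.Formula (Fin n ⊕ Fin 1)), ∃ σ : Φ.lang.Term (Fin n),
    ∀ I ∈ K, ∀ (N : Type u) [Φ.lang.Structure N] (a : I → List N), Φ.IsGEM I N a →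
      ∀ (v : Fin n → N) (x : N), (ι.onFormula φ).Realize (Sum.elim v fun _ => x) →
        (ι.onFormula φ).Realize (Sum.elim v fun _ => σ.realize v)

/-- Membership in `Υ_K`: `Φ` is proper for `K`, the skeletons are nontrivial and without repetition,
and `T_Φ` is well defined and has Skolem functions. -/
structure InUpsilon (K : Set (IndexModel τ)) (Φ : Template τ) : Prop where
  proper : Φ.Proper K
  nontrivial : ∀ I ∈ K, ∀ (N : Type u) [Φ.lang.Structure N] (a : I → List N), Φ.IsGEM I N a →
    (∀ t, 1 ≤ (a t).length) ∧ Function.Injective a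
  complete : (Φ.theory K).IsComplete
  indiscernible : ∀ I ∈ K, ∀ (N : Type u) [Φ.lang.Structure N] (a : I → List N), Φ.IsGEM I N a →
    ∀ s t : List I, I.qftp s = I.qftp t →
      tpOver Φ.lang (∅ : Set N) (s.flatMap a) = tpOver Φ.lang (∅ : Set N) (t.flatMap a)
  elementary : ∀ I ∈ K, ∀ J ∈ K, ∀ e : IndexModel.Embedding I J,
    ∀ (N : Type u) [Φ.lang.Structure N] (a : I → List N), Φ.IsGEM I N a →
    ∀ (N' : Type u) [Φ.lang.Structure N'] (a' : J → List N'), Φ.IsGEM J N' a' →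
      ∃ g : N ↪ₑ[Φ.lang] N', ∀ t, (a t).map g = a' (e.toFun t)
  unique : ∀ I ∈ K, ∀ J ∈ K, I.Isomorphic J →
    ∀ (N : Type u) [Φ.lang.Structure N] (a : I → List N), Φ.IsGEM I N a →
    ∀ (N' : Type u) [Φ.lang.Structure N'] (a' : J → List N'), Φ.IsGEM J N' a' →
      Nonempty (N ≃[Φ.lang] N')
  skolem : Φ.HasSkolem K (LHom.id Φ.lang)

/-- Membership in `Υ_K[T]`, where the vocabulary of `T` is included in that of `Φ` by `ι`. -/
structure InUpsilonOf (K : Set (IndexModel τ)) (Φ : Template τ) {L : FirstOrder.Language.{u, u}}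
    (ι : L →ᴸ Φ.lang) (T : L.Theory) : Prop where
  inUpsilon : Φ.InUpsilon K
  injective : ι.Injective
  theory_le : ∀ φ ∈ T, ι.onSentence φ ∈ Φ.theory K
  skolem : Φ.HasSkolem K ι

/-- `Φ ≤ Ψ`, where the vocabulary of `Φ` is included in that of `Ψ` by `ι`: for each `I` in `K`,
the model `GEM(I, Φ)` is, with the same skeleton, an elementary submodel of the reduct of
`GEM(I, Ψ)` to the vocabulary of `Φ`. -/
structure Le (K : Set (IndexModel τ)) (Φ Ψ : Template τ) (ι : Φ.lang →ᴸ Ψ.lang) : Prop where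
  injective : ι.Injective
  elementary : ∀ I ∈ K,
    ∀ (N : Type u) [Φ.lang.Structure N] (a : I → List N), Φ.IsGEM I N a →
    ∀ (N' : Type u) [Ψ.lang.Structure N'] (a' : I → List N'), Ψ.IsGEM I N' a' →
      ∃ g : N → N', (∀ t, (a t).map g = a' t) ∧
        ∀ (n : ℕ) (φ : Φ.lang.Formula (Fin n)) (v : Fin n → N),
          (ι.onFormula φ).Realize (g ∘ v) ↔ φ.Realize v

end Template

/-! ### Index model classes and contexts -/

/-- `Ψ` reflects `b` (a family of finite sequences of the `L`-structure `M` indexed by `J`): what is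
true in `M` of the values of given terms at all sequences from `J` of a given quantifier-free type
is true in `GEM(J, Ψ)` at the sequences of that type, with the skeleton in place of `b`. -/
def Reflects {τ : FirstOrder.Language.{u, u}} (J : IndexModel τ) {L : FirstOrder.Language.{u, u}} {M : Type u}
    [L.Structure M] (b : J → List M) (Ψ : Template τ) (ι : L →ᴸ Ψ.lang) : Prop :=
  ∀ (N : Type u) [Ψ.lang.Structure N] (a : J → List N), Ψ.IsGEM J N a →
    (∀ t, (a t).length = (b t).length) ∧
    ∀ (s : List J) (n m : ℕ) (φ : L.Formula (Fin m)) (σ : Fin m → L.Term (Fin n)),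
      (∀ t : List J, J.qftp t = J.qftp s → ∃ v : Fin n → M,
        t.flatMap b = List.ofFn v ∧ φ.Realize fun l => (σ l).realize v) →
      ∃ w : Fin n → N, s.flatMap a = List.ofFn w ∧
        (ι.onFormula φ).Realize fun l => (ι.onTerm (σ l)).realize w

/-- The class `K` is Ramsey. -/
def IsRamsey {τ : FirstOrder.Language.{u, u}} (K : Set (IndexModel τ)) : Prop :=
  ∀ J, IndexModel.IsSat K J →
    ∀ (L : FirstOrder.Language.{u, u}) (M : Type u) [L.Structure M] [Nonempty M] (b : J → List M),
      (∀ s t : J, J.qftp [s] = J.qftp [t] → (b s).length = (b t).length) →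
      ∃ (Ψ : Template τ) (ι : L →ᴸ Ψ.lang), Ψ.Proper K ∧ ι.Injective ∧ Reflects J b Ψ ι

/-- `K` is an index model class for the vocabulary `τ` with the distinguished symbol `lt`
for the ordering. -/
structure IsIndexModelClass {τ : FirstOrder.Language.{u, u}} (lt : τ.Relations 2)
    (K : Set (IndexModel τ)) : Prop where
  nonempty : ∀ I ∈ K, Nonempty I
  iso_closed : ∀ I ∈ K, ∀ J : IndexModel τ, I.Isomorphic J → J ∈ K
  lt_irrefl : ∀ I ∈ K, ∀ x : I, ¬ I.rel lt ![x, x]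
  lt_trans : ∀ I ∈ K, ∀ x y z : I, I.rel lt ![x, y] → I.rel lt ![y, z] → I.rel lt ![x, z]
  lt_total : ∀ I ∈ K, ∀ x y : I, I.rel lt ![x, y] ∨ x = y ∨ I.rel lt ![y, x]
  universal : ∀ I : IndexModel τ, Nonempty I →
    (I ∈ K ↔ ∀ A : Set I, A.Finite → A.Nonempty → I.generated A ∈ K)
  exists_sat : ∀ I ∈ K, ∃ J, IndexModel.IsSat K J ∧ Nonempty (IndexModel.Embedding I J)
  ramsey : IsRamsey K

/-- A context: an index model class `K` and a nontrivial, reasonable and non-1-trivial `I` in `K`.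
(`I` is closed under its functions since it is itself a model.) -/
structure Context where
  τ : FirstOrder.Language.{u, u}
  lt : τ.Relations 2
  K : Set (IndexModel τ)
  isIndexModelClass : IsIndexModelClass lt K
  I : IndexModel τ
  mem : I ∈ K
  nontrivial : ∀ t : List I, I.cl {x | x ∈ t} ≠ Set.univ
  reasonable : ∀ J, IndexModel.IsSat K J → ∀ (e : IndexModel.Embedding I J) (t : List I) (s : J),
    (∀ r : J, J.SameQF (t.map e.toFun) [r] [s] → r = s) → s ∈ e.toFun '' I.cl {x | x ∈ t}
  nonOneTrivial : ∀ J, IndexModel.IsSat K J →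
    ∀ (e : IndexModel.Embedding I J) (t : List I) (s : J),
      s ∉ J.cl {x | x ∈ t.map e.toFun} → {r : J | J.SameQF (t.map e.toFun) [r] [s]}.Infinite

/-! ### Shearing and unsuperstability -/

/-- The family `b` of finite sequences of `N`, indexed by the finite sequences of `J[s]` (that is,
`J` with constants for the elements of `s`), is indiscernible over `A`. -/
def Indiscernible {τ : FirstOrder.Language.{u, u}} (J : IndexModel τ) (s : List J) (L : FirstOrder.Language.{u, u})
    {N : Type u} [L.Structure N] (A : Set N) (b : List J → List N) : Prop :=
  ∀ t t' : List (List J), t.map List.length = t'.map List.length →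
    J.SameQF s t.flatten t'.flatten →
      tpOver L A (t.flatMap b) = tpOver L A (t'.flatMap b)

/-- The formula `f = φ(x, c)` shears over `A` in `M` for `(I₀, I₁, c)`. -/
def Shears (c : Context.{u}) {L : FirstOrder.Language.{u, u}} {M : Type u} [L.Structure M] (A : Set M) {m : ℕ}
    (f : ParamFormula L m M) (I₀ I₁ : Set c.I) : Prop :=
  I₀ ⊆ I₁ ∧ I₁.Finite ∧
  ∃ (N : Type u) (_ : L.Structure N) (g : M ↪ₑ[L] N) (s t : List c.I) (J : IndexModel c.τ)
    (e : IndexModel.Embedding c.I J) (b : List J → List N),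
    {x | x ∈ s} = I₀ ∧ {x | x ∈ t} = I₁ ∧ IndexModel.IsSat c.K J ∧
    Indiscernible J (s.map e.toFun) L (g '' A) b ∧
    b (t.map e.toFun) = List.ofFn (g ∘ f.param) ∧
    ¬ Consistent {h : ParamFormula L m N | ∃ (t' : List J) (c' : Fin f.len → N),
      J.SameQF (s.map e.toFun) t' (t.map e.toFun) ∧ b t' = List.ofFn c' ∧
        h = ⟨f.len, f.formula, c'⟩}

/-- The set of formulas `p` with parameters in `M`, restricted to parameters from `C`, shears over
`A` for `(I₀, I₁, c)`: some formula over `C` which is implied by finitely many members of the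
restriction (for example, a member) shears. -/
def TypeShears (c : Context.{u}) {L : FirstOrder.Language.{u, u}} {M : Type u} [L.Structure M] (A C : Set M)
    {m : ℕ} (p : Set (ParamFormula L m M)) (I₀ I₁ : Set c.I) : Prop :=
  ∃ f : ParamFormula L m M, f.Over C ∧
    (∃ p₀ ⊆ {h ∈ p | h.Over C}, p₀.Finite ∧ ∀ x, (∀ h ∈ p₀, h.Sat x) → f.Sat x) ∧
    Shears c A f I₀ I₁

/-- The partial type `p` (over the union of the `B n`) witnesses unsuperstability for the
context `c`. The model `M` stands for any part of the monster model containing all the `B n`. -/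
def WitnessesUnsuperstable (c : Context.{u}) {L : FirstOrder.Language.{u, u}} (M : Type u) [L.Structure M]
    {m : ℕ} (p : Set (ParamFormula L m M)) : Prop :=
  ∃ (In : ℕ → Set c.I) (s : ℕ → List c.I) (B : ℕ → Set M),
    (∀ n, (In n).Finite ∧ (In n).Nonempty) ∧ Monotone In ∧ (⋃ n, In n) = Set.univ ∧
    (∀ n, {x | x ∈ s n} = In n) ∧ (∀ n, s n <+: s (n + 1)) ∧
    (∀ n, (B n).Nonempty) ∧ Monotone B ∧
    IsPartialType (⋃ n, B n) p ∧
    ∀ n, TypeShears c (B n) (B (n + 1)) p (In n) (In (n + 1))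

/-- `T` is unsuperstable for the (countable) context `c`. -/
def Unsuperstable (c : Context.{u}) {L : FirstOrder.Language.{u, u}} (T : L.Theory) : Prop :=
  ∃ (M : Theory.ModelType.{u, u, u} T) (m : ℕ) (p : Set (ParamFormula L m M)),
    WitnessesUnsuperstable c M p

/-- `(T, Δ)` is unsuperstable for the (countable) context `c`. -/
def UnsuperstableFor (c : Context.{u}) {L : FirstOrder.Language.{u, u}} (T : L.Theory)
    (Δ : FormulaSet L) : Prop :=
  ∃ (M : Theory.ModelType.{u, u, u} T) (m : ℕ) (p : Set (ParamFormula L m M)),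
    IsDeltaType Δ p ∧ WitnessesUnsuperstable c M p

end GemModels

/-!
The theorem rests on a tree of parameters, made definable from the skeleton.

Let `J` be an `ℵ₀`-saturated extension of `I`, let `S n` enumerate the finite sets exhausting `I`, and let
`f n` be the formula, implied by `p`, which shears over the parameters of the levels below `n`.
Shearing is first transported to `J` (`Shears.exists_configuration`): there is a finite configuration
`W n` of sequences of the quantifier-free type of `S (n + 1)` over `S n` such that, over any `t` of the
type of `S n`, parameters of the right type can be attached to finitely many sequences above `t` so that every
copy of the configuration makes `f n` inconsistent. By compactness, one level at a time, some
elementary extension `N` of `GEM(J, Φ)` contains for all sequences `t` of the type of `S (n + 1)` copies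
of the parameters of level `n`, in such a way that along every branch of the tree they have the type of
the given parameters, and all copies of all configurations are inconsistent
(`ShearingSequence.exists_tree`).

Now expand `N` by countably many functions which send the skeleton of such a sequence `t` to the
parameters attached to `t`. The Ramsey property, applied to a Skolemization of this expansion with the
skeleton of `GEM(J, Φ)`, gives the required template (`Template.InUpsilon.exists_le`,
`ShearingSequence.exists_carried`): since Skolem terms eliminate quantifiers, it is a member of `Υ_K`
above `Φ`, and the properties of the tree, being true at all sequences of a given quantifier-free type,
pass to its models. They also pass to all larger templates `Ψ` (`ShearingSequence.Carried.of_le`).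

In `GEM(I, Ψ)` the values of the new functions along `I` form a countable set of parameters of the type
of the given ones, so `p` has a copy `q` over them. If `x` realized `q`, then `x` would be given by terms
`σ` in the skeleton of some `S n`, and `f n` would hold of `x` and the parameters of level `n` over
`S (n + 1)`. In `GEM(J, Ψ)`, indiscernibility over the skeleton of `S n` moves `S (n + 1)` to each member
of the configuration `W n` while it fixes `x`; so `x` would be a common solution of an inconsistent
set (`ShearingSequence.Carried.exists_not_realize`). Hence `q` is omitted.
-/

/-! ### Quantifier-free types in index models -/

namespace GemModels

namespace IndexModel

variable {τ : FirstOrder.Language.{u, u}} {I J : IndexModel τ} {α β : Type}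

/-- The assignments `v` in `I` and `w` in `J` satisfy the same atomic formulas. -/
def SameAtomic (v : α → I) (w : α → J) : Prop :=
  (∀ t₁ t₂ : τ.Term α, (∃ y, I.TermVal v t₁ y ∧ I.TermVal v t₂ y) ↔
    ∃ y, J.TermVal w t₁ y ∧ J.TermVal w t₂ y) ∧
  ∀ (k : ℕ) (R : τ.Relations k) (ts : Fin k → τ.Term α),
    (∃ y, (∀ i, I.TermVal v (ts i) (y i)) ∧ I.rel R y) ↔
      ∃ y, (∀ i, J.TermVal w (ts i) (y i)) ∧ J.rel R y

theorem termVal_relabel (f : α → β) (v : β → I) (t : τ.Term α) (y : I) :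
    I.TermVal v (t.relabel f) y ↔ I.TermVal (v ∘ f) t y := by
  induction t generalizing y with
  | var a => simp [Term.relabel, TermVal]
  | func g ts ih => simp only [Term.relabel, TermVal, ih]

theorem SameAtomic.comp {v : β → I} {w : β → J} (h : SameAtomic v w) (f : α → β) :
    SameAtomic (v ∘ f) (w ∘ f) := by
  constructor
  · intro t₁ t₂
    simpa only [termVal_relabel] using h.1 (t₁.relabel f) (t₂.relabel f)
  · intro k R ts
    simpa only [termVal_relabel] using h.2 k R fun i => (ts i).relabel f

theorem SameAtomic.holds_iff {n : ℕ} {v : α → I} {w : α → J} {x : Fin n → I} {x' : Fin n → J}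
    (h : SameAtomic (Sum.elim v x) (Sum.elim w x')) {φ : τ.BoundedFormula α n} (hφ : φ.IsQF) :
    I.Holds v φ x ↔ J.Holds w φ x' := by
  induction hφ with
  | falsum => exact Iff.rfl
  | of_isAtomic hA =>
    cases hA with
    | equal t₁ t₂ => exact h.1 t₁ t₂
    | rel R ts => exact h.2 _ R ts
  | imp _ _ ih₁ ih₂ => exact imp_congr ih₁ ih₂

theorem SameAtomic.eq_iff {v : α → I} {w : α → J} (h : SameAtomic v w) (i j : α) :
    v i = v j ↔ w i = w j := by
  have := h.1 (.var i) (.var j)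
  simpa [TermVal] using this

theorem qftp_eq_mk {n : ℕ} (l : List I) (hl : l.length = n) (v : Fin n → I)
    (hv : ∀ i, v i = l.get (Fin.cast hl.symm i)) :
    I.qftp l = ⟨n, {φ | BoundedFormula.IsQF φ ∧ I.Holds v φ Fin.elim0}⟩ := by
  subst hl
  obtain rfl : v = l.get := funext hv
  rfl

theorem qftp_ofFn {n : ℕ} (v : Fin n → I) :
    I.qftp (List.ofFn v) = ⟨n, {φ | BoundedFormula.IsQF φ ∧ I.Holds v φ Fin.elim0}⟩ :=
  qftp_eq_mk _ List.length_ofFn v (by simp)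

theorem qftp_ofFn_eq_iff {n : ℕ} (v : Fin n → I) (w : Fin n → J) :
    I.qftp (List.ofFn v) = J.qftp (List.ofFn w) ↔ SameAtomic v w := by
  rw [qftp_ofFn, qftp_ofFn]
  constructor
  · intro h
    have h' : ∀ φ : τ.Formula (Fin n), φ.IsQF → (I.Holds v φ Fin.elim0 ↔ J.Holds w φ Fin.elim0) := by
      intro φ hφ
      have := congrArg (φ ∈ ·) (eq_of_heq (Sigma.mk.inj_iff.1 h).2)
      simpa [hφ] using this
    have key : SameAtomic (Sum.elim v (Fin.elim0 : Fin 0 → I)) (Sum.elim w (Fin.elim0 : Fin 0 → J)) :=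
      ⟨fun t₁ t₂ => h' (t₁.bdEqual t₂) (BoundedFormula.IsAtomic.equal _ _).isQF,
        fun k R ts => h' (R.boundedFormula ts) (BoundedFormula.IsAtomic.rel _ _).isQF⟩
    exact key.comp (Sum.inl : Fin n → Fin n ⊕ Fin 0)
  · intro h
    congr 1
    ext φ
    refine and_congr_right fun hφ => SameAtomic.holds_iff ?_ hφ
    have := h.comp (Sum.elim id Fin.elim0 : Fin n ⊕ Fin 0 → Fin n)
    convert this using 1
    · ext (i | i)
      · rfl
      · exact i.elim0
    · ext (i | i)
      · rfl
      · exact i.elim0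

theorem length_eq_of_qftp_eq {l : List I} {l' : List J} (h : I.qftp l = J.qftp l') :
    l.length = l'.length :=
  congrArg Sigma.fst h

/-- Equality of quantifier-free types is witnessed by a map which preserves the quantifier-free type
of every sequence of entries. -/
theorem exists_map_of_qftp_eq [Nonempty J] {l : List I} {l' : List J} (h : I.qftp l = J.qftp l') :
    ∃ θ : I → J, l.map θ = l' ∧ ∀ r : List I, (∀ x ∈ r, x ∈ l) → J.qftp (r.map θ) = I.qftp r := by
  classical
  have hlen := length_eq_of_qftp_eq h
  obtain ⟨n, v, rfl⟩ : ∃ n, ∃ v : Fin n → I, l = List.ofFn v := ⟨_, l.get, (List.ofFn_get l).symm⟩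
  obtain ⟨w, rfl⟩ : ∃ w : Fin n → J, l' = List.ofFn w := by
    simp only [List.length_ofFn] at hlen
    subst hlen
    exact ⟨l'.get, (List.ofFn_get l').symm⟩
  rw [qftp_ofFn_eq_iff] at h
  let θ : I → J := fun x => if hx : ∃ i, v i = x then w hx.choose else Classical.arbitrary J
  have hθ : ∀ i, θ (v i) = w i := by
    intro i
    have hx : ∃ j, v j = v i := ⟨i, rfl⟩
    simp only [θ, dif_pos hx]
    exact (h.eq_iff _ _).1 hx.choose_spec
  refine ⟨θ, ?_, fun r hr => ?_⟩
  · rw [List.map_ofFn]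
    congr 1
    exact funext hθ
  · obtain ⟨k, u, rfl⟩ : ∃ k, ∃ u : Fin k → I, r = List.ofFn u := ⟨_, r.get, (List.ofFn_get r).symm⟩
    have hu : ∀ i, ∃ j, v j = u i := fun i => by simpa [List.mem_ofFn] using hr (u i) (by simp)
    choose f hf using hu
    rw [List.map_ofFn, eq_comm, qftp_ofFn_eq_iff]
    have := h.comp f
    convert this using 1
    · ext i; exact (hf i).symm
    · ext i; simp [← hf i, hθ]

theorem qftp_append_left [Nonempty J] {s t : List I} {s' t' : List J}
    (h : I.qftp (s ++ t) = J.qftp (s' ++ t')) (hs : s.length = s'.length) :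
    I.qftp s = J.qftp s' := by
  obtain ⟨θ, h₁, h₂⟩ := exists_map_of_qftp_eq h
  rw [List.map_append] at h₁
  obtain ⟨h₃, -⟩ := List.append_inj h₁ (by simpa using hs)
  rw [← h₃, h₂ s (by simp +contextual)]

theorem qftp_append_right [Nonempty J] {s t : List I} {s' t' : List J}
    (h : I.qftp (s ++ t) = J.qftp (s' ++ t')) (hs : s.length = s'.length) :
    I.qftp t = J.qftp t' := by
  obtain ⟨θ, h₁, h₂⟩ := exists_map_of_qftp_eq h
  rw [List.map_append] at h₁
  obtain ⟨-, h₃⟩ := List.append_inj h₁ (by simpa using hs)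
  rw [← h₃, h₂ t (by simp +contextual)]

theorem Embedding.termVal_iff (e : Embedding I J) (v : α → I) (t : τ.Term α) (y : J) :
    J.TermVal (e.toFun ∘ v) t y ↔ ∃ x, I.TermVal v t x ∧ e.toFun x = y := by
  induction t generalizing y with
  | var a => simp [TermVal, eq_comm]
  | func g ts ih =>
    simp only [TermVal, ih]
    constructor
    · rintro ⟨x, hx, hy⟩
      choose x' hx' hxx using hx
      obtain rfl : e.toFun ∘ x' = x := funext hxx
      rw [e.map_fn, Part.mem_map_iff] at hy
      obtain ⟨z, hz, rfl⟩ := hy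
      exact ⟨z, ⟨x', hx', hz⟩, rfl⟩
    · rintro ⟨z, ⟨x', hx', hz⟩, rfl⟩
      refine ⟨e.toFun ∘ x', fun i => ⟨x' i, hx' i, rfl⟩, ?_⟩
      rw [e.map_fn, Part.mem_map_iff]
      exact ⟨z, hz, rfl⟩

theorem Embedding.sameAtomic (e : Embedding I J) (v : α → I) : SameAtomic v (e.toFun ∘ v) := by
  constructor
  · intro t₁ t₂
    simp only [e.termVal_iff]
    constructor
    · rintro ⟨y, h₁, h₂⟩
      exact ⟨_, ⟨y, h₁, rfl⟩, y, h₂, rfl⟩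
    · rintro ⟨_, ⟨y, h₁, rfl⟩, y', h₂, h⟩
      obtain rfl := e.injective h
      exact ⟨_, h₁, h₂⟩
  · intro k R ts
    simp only [e.termVal_iff]
    constructor
    · rintro ⟨y, h₁, h₂⟩
      exact ⟨e.toFun ∘ y, fun i => ⟨_, h₁ i, rfl⟩, (e.map_rel R y).2 h₂⟩
    · rintro ⟨y, h₁, h₂⟩
      choose y' h₃ h₄ using h₁
      obtain rfl : e.toFun ∘ y' = y := funext h₄
      exact ⟨y', h₃, (e.map_rel R y').1 h₂⟩

theorem Embedding.qftp_map (e : Embedding I J) (l : List I) : J.qftp (l.map e.toFun) = I.qftp l := by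
  rw [eq_comm, ← List.ofFn_get l, List.map_ofFn, qftp_ofFn_eq_iff]
  exact e.sameAtomic _

/-- The inclusion of a generated submodel. -/
def generatedEmbedding (I : IndexModel τ) (A : Set I) : Embedding (I.generated A) I where
  toFun x := x.1
  injective := Subtype.val_injective
  map_fn f x := by
    ext y
    rw [Part.mem_map_iff]
    constructor
    · intro hy
      obtain ⟨h, rfl⟩ := hy
      exact ⟨_, ⟨h, rfl⟩, rfl⟩
    · rintro ⟨_, ⟨h, rfl⟩, rfl⟩
      exact ⟨h, rfl⟩
  map_rel _ _ := Iff.rfl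

theorem exists_generated_lift {A : Set I} (l : List I) (hl : ∀ x ∈ l, x ∈ A) :
    ∃ l' : List (I.generated A), l'.map (I.generatedEmbedding A).toFun = l := by
  induction l with
  | nil => exact ⟨[], rfl⟩
  | cons x l ih =>
    obtain ⟨l', rfl⟩ := ih fun y hy => hl y (List.mem_cons_of_mem _ hy)
    exact ⟨(⟨x, Cl.base x (hl x List.mem_cons_self)⟩ : {x : I // I.Cl A x}) :: l', rfl⟩

theorem cl_generated (A : Set I) :
    (I.generated A).cl {x | x.1 ∈ A} = Set.univ := by
  refine Set.eq_univ_of_forall (?_ : ∀ x : {x : I // I.Cl A x}, _)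
  rintro ⟨x, hx⟩
  induction hx with
  | base x h => exact Cl.base _ h
  | app f x y hx hy ih =>
    refine Cl.app (I := I.generated A) f (fun i => (⟨x i, hx i⟩ : {x : I // I.Cl A x})) _ ih ?_
    obtain ⟨h, rfl⟩ := hy
    exact ⟨h, rfl⟩

end IndexModel

open IndexModel

section IndexModelClass

variable {τ : FirstOrder.Language.{u, u}} {lt : τ.Relations 2} {K : Set (IndexModel τ)}

/-- Every finite sequence of a member of the class lies in a member which embeds into every
`ℵ₀`-saturated member. -/
theorem IsIndexModelClass.exists_small (hK : IsIndexModelClass lt K) {I : IndexModel τ} (hI : I ∈ K)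
    (t : List I) : ∃ A ∈ K, ∃ (e : IndexModel.Embedding A I) (t' : List A), t'.map e.toFun = t ∧
      ∀ J, IsSat K J → Nonempty (IndexModel.Embedding A J) := by
  obtain ⟨x₀⟩ := hK.nonempty I hI
  let A : Set I := {x | x ∈ x₀ :: t}
  have hfin : A.Finite := (x₀ :: t).finite_toSet
  have hA : I.generated A ∈ K :=
    (hK.universal I ⟨x₀⟩).1 hI A hfin ⟨x₀, List.mem_cons_self⟩
  obtain ⟨t', ht'⟩ := exists_generated_lift (A := A) t (fun x hx => List.mem_cons_of_mem _ hx)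
  refine ⟨_, hA, I.generatedEmbedding A, t', ht', fun J hJ => hJ.universal _ hA ⟨_, ?_, cl_generated A⟩⟩
  exact (hfin.countable.preimage Subtype.val_injective)

/-- Every quantifier-free type of the class is realized in every `ℵ₀`-saturated member. -/
theorem IsIndexModelClass.exists_qftp_eq (hK : IsIndexModelClass lt K) {I J : IndexModel τ}
    (hI : I ∈ K) (hJ : IsSat K J) (t : List I) : ∃ s : List J, J.qftp s = I.qftp t := by
  obtain ⟨A, -, e, t', rfl, h⟩ := hK.exists_small hI t
  obtain ⟨e'⟩ := h J hJ
  exact ⟨t'.map e'.toFun, by rw [e'.qftp_map, e.qftp_map]⟩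

theorem IndexModel.IsSat.exists_append_eq {J : IndexModel τ} (hJ : IsSat K J)
    {s t : List J} (h : J.qftp s = J.qftp t) (r : List J) :
    ∃ r', J.qftp (s ++ r) = J.qftp (t ++ r') := by
  induction r generalizing s t with
  | nil => exact ⟨[], by simpa using h⟩
  | cons x r ih =>
    obtain ⟨y, hy⟩ := hJ.homogeneous s t x h
    obtain ⟨r', hr'⟩ := ih hy
    exact ⟨y :: r', by simpa using hr'⟩

/-- Homogeneity across two members of the class, the second of which is `ℵ₀`-saturated. -/
theorem IsIndexModelClass.exists_append_eq (hK : IsIndexModelClass lt K) {I J : IndexModel τ}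
    (hI : I ∈ K) (hJ : IsSat K J) {s : List I} {t : List J} (h : I.qftp s = J.qftp t)
    (r : List I) : ∃ r' : List J, I.qftp (s ++ r) = J.qftp (t ++ r') := by
  have : Nonempty J := hK.nonempty J hJ.mem
  obtain ⟨q, hq⟩ := hK.exists_qftp_eq hI hJ (s ++ r)
  obtain ⟨θ, rfl, -⟩ := exists_map_of_qftp_eq hq.symm
  rw [List.map_append] at hq
  have h₁ : J.qftp (s.map θ) = I.qftp s := qftp_append_left hq.symm (by simp) |>.symm
  obtain ⟨r', hr'⟩ := hJ.exists_append_eq (h₁.trans h) (r.map θ)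
  exact ⟨r', hq.symm.trans hr'⟩

end IndexModelClass

end GemModels

/-! ### Types of finite sequences, finite supports, compactness -/

namespace GemModels

section FirstOrder

variable {L : FirstOrder.Language.{u, u}}

/-- A formula mentions only finitely many of its variables. -/
theorem exists_finite_support {α β : Type*} (φ : L.Formula (α ⊕ β)) :
    ∃ (k : ℕ) (f : Fin k → β) (ψ : L.Formula (α ⊕ Fin k)), Function.Injective f ∧
      ∀ (N : Type u) [L.Structure N] (v : α → N) (c : β → N),
        ψ.Realize (Sum.elim v (c ∘ f)) ↔ φ.Realize (Sum.elim v c) := by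
  classical
  let T : Finset β := φ.freeVarFinset.toRight
  let e := T.equivFin
  let g : φ.freeVarFinset → α ⊕ Fin T.card := fun x =>
    match x with
    | ⟨.inl a, _⟩ => .inl a
    | ⟨.inr b, hb⟩ => .inr (e ⟨b, by simpa [T] using hb⟩)
  refine ⟨T.card, fun i => (e.symm i).1, φ.restrictFreeVar g,
    Subtype.val_injective.comp e.symm.injective, fun N _ v c => ?_⟩
  refine BoundedFormula.realize_restrictFreeVar (Sum.elim v c) ?_
  rintro ⟨a | b, h⟩
  · rfl
  · simp [g]

/-- If the complete type of `u` is contained in that of `u'`, then every finite set of formulas satisfied by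
an extension of `u` is satisfied by an extension of `u'`. -/
theorem exists_extension_of_finite {A V : Type*} {N₁ N₂ : Type u} [L.Structure N₁] [L.Structure N₂]
    [Nonempty N₂] {u : A → N₁} {u' : A → N₂}
    (h : ∀ φ : L.Formula A, φ.Realize u → φ.Realize u') {S : Set (L.Formula (A ⊕ V))}
    (hS : S.Finite) {w : V → N₁} (hw : ∀ φ ∈ S, φ.Realize (Sum.elim u w)) :
    ∃ w' : V → N₂, ∀ φ ∈ S, φ.Realize (Sum.elim u' w') := by
  have := hS.to_subtype
  obtain ⟨k, f, ψ, hf, hψ⟩ := exists_finite_support (Formula.iInf fun φ : S => φ.1)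
  have h₁ : (ψ.iExs (Fin k)).Realize u := by
    rw [Formula.realize_iExs]
    exact ⟨w ∘ f, by rw [hψ, Formula.realize_iInf]; exact fun φ => hw φ.1 φ.2⟩
  have h₂ := h _ h₁
  rw [Formula.realize_iExs] at h₂
  obtain ⟨w₀, hw₀⟩ := h₂
  refine ⟨Function.extend f w₀ fun _ => Classical.arbitrary N₂, fun φ hφ => ?_⟩
  have : Function.extend f w₀ (fun _ => Classical.arbitrary N₂) ∘ f = w₀ :=
    Function.extend_comp hf _ _
  rw [← this, hψ, Formula.realize_iInf] at hw₀
  exact hw₀ ⟨φ, hφ⟩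

/-- Compactness over a structure `M`: a set of formulas with parameters in `M`, in arbitrarily many
variables, is realized in an elementary extension as soon as its finite subsets are. -/
theorem exists_elementary_realization (M : Type u) [L.Structure M] [Nonempty M] {V : Type u}
    (S : Set (L.Formula (M ⊕ V)))
    (h : ∀ S₀ ⊆ S, S₀.Finite → ∃ (N : Type u) (_ : L.Structure N) (g : M ↪ₑ[L] N) (w : V → N),
      ∀ φ ∈ S₀, φ.Realize (Sum.elim g w)) :
    ∃ (N : Type u) (_ : L.Structure N) (g : M ↪ₑ[L] N) (w : V → N),
      ∀ φ ∈ S, φ.Realize (Sum.elim g w) := by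
  classical
  let D : Set (L.Formula (M ⊕ V)) :=
    {φ | ∃ ψ : L.Formula M, ψ.Realize id ∧ φ = ψ.relabel Sum.inl}
  let T : L[[M ⊕ V]].Theory := Formula.equivSentence '' (D ∪ S)
  have hT : T.IsSatisfiable := by
    rw [Theory.isSatisfiable_iff_isFinitelySatisfiable]
    intro T₀ hT₀
    obtain ⟨S₁, hS₁, hS₁fin, hST⟩ : ∃ S₁ ⊆ D ∪ S, S₁.Finite ∧ Formula.equivSentence '' S₁ = (T₀ : Set _) := by
      obtain ⟨t, ht, rfl⟩ := Finset.subset_set_image_iff.1 hT₀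
      exact ⟨t, ht, t.finite_toSet, by simp⟩
    obtain ⟨N, _, g, w, hw⟩ := h (S₁ ∩ S) Set.inter_subset_right (hS₁fin.inter_of_left _)
    have : Nonempty N := ⟨g (Classical.arbitrary M)⟩
    let := constantsOn.structure (Sum.elim g w : M ⊕ V → N)
    have : N ⊨ (T₀ : L[[M ⊕ V]].Theory) := by
      rw [← hST, Theory.model_iff]
      rintro _ ⟨φ, hφ, rfl⟩
      rw [Formula.realize_equivSentence]
      change φ.Realize (Sum.elim g w)
      rcases hS₁ hφ with ⟨ψ, hψ, rfl⟩ | hφS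
      · rw [Formula.realize_relabel, Sum.elim_comp_inl]
        have := (g.map_formula ψ id).2 hψ
        simpa using this
      · exact hw φ ⟨hφ, hφS⟩
    exact Theory.Model.isSatisfiable N
  obtain ⟨N⟩ := hT
  let : L.Structure N := (L.lhomWithConstants (M ⊕ V)).reduct N
  let a : M ⊕ V → N := fun x => (L.con x : N)
  have ha : ∀ φ ∈ D ∪ S, φ.Realize a := by
    intro φ hφ
    have : N ⊨ Formula.equivSentence φ := Theory.realize_sentence_of_mem T ⟨φ, hφ, rfl⟩
    rwa [Formula.realize_equivSentence] at this
  have hM : ∀ ψ : L.Formula M, ψ.Realize id → ψ.Realize (a ∘ Sum.inl) := by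
    intro ψ hψ
    rw [← Formula.realize_relabel]
    exact ha _ (Or.inl ⟨ψ, hψ, rfl⟩)
  refine ⟨N, inferInstance, ⟨a ∘ Sum.inl, fun n φ x => ?_⟩, a ∘ Sum.inr, fun φ hφ => ?_⟩
  · have key : φ.Realize x → φ.Realize ((a ∘ Sum.inl) ∘ x) := by
      intro hx
      rw [← Formula.realize_relabel (g := x)]
      exact hM _ (by rw [Formula.realize_relabel]; exact hx)
    refine ⟨fun hx => ?_, key⟩
    by_contra hn
    have := hM (φ.relabel x).not (by rw [Formula.realize_not, Formula.realize_relabel]; exact hn)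
    rw [Formula.realize_not, Formula.realize_relabel] at this
    exact this hx
  · have := ha φ (Or.inr hφ)
    convert this using 1
    ext (x | x) <;> rfl

theorem isQF_onBoundedFormula {L' : FirstOrder.Language.{u, u}} (ι : L →ᴸ L') {α : Type*} {n : ℕ}
    {φ : L.BoundedFormula α n} (hφ : φ.IsQF) : (ι.onBoundedFormula φ).IsQF := by
  induction hφ with
  | falsum => exact .falsum
  | of_isAtomic h =>
    cases h with
    | equal t₁ t₂ => exact (BoundedFormula.IsAtomic.equal _ _).isQF
    | rel R ts => exact (BoundedFormula.IsAtomic.rel _ _).isQF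
  | imp _ _ h₁ h₂ => exact h₁.imp h₂

variable {M N : Type u} [L.Structure M] [L.Structure N]

theorem qfType_eq_mk {n : ℕ} (l : List M) (hl : l.length = n) (v : Fin n → M)
    (hv : ∀ i, v i = l.get (Fin.cast hl.symm i)) :
    qfType L l = ⟨n, {φ | BoundedFormula.IsQF φ ∧ φ.Realize v}⟩ := by
  subst hl
  obtain rfl : v = l.get := funext hv
  rfl

theorem qfType_ofFn {n : ℕ} (v : Fin n → M) :
    qfType L (List.ofFn v) = ⟨n, {φ | BoundedFormula.IsQF φ ∧ φ.Realize v}⟩ :=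
  qfType_eq_mk _ List.length_ofFn v (by simp)

theorem qfType_ofFn_eq_iff {n : ℕ} (v : Fin n → M) (w : Fin n → N) :
    qfType L (List.ofFn v) = qfType L (List.ofFn w) ↔
      ∀ φ : L.Formula (Fin n), φ.IsQF → (φ.Realize v ↔ φ.Realize w) := by
  rw [qfType_ofFn, qfType_ofFn]
  constructor
  · intro h φ hφ
    have := congrArg (φ ∈ ·) (eq_of_heq (Sigma.mk.inj_iff.1 h).2)
    simpa [hφ] using this
  · intro h
    congr 1
    ext φ
    exact and_congr_right fun hφ => h φ hφ

theorem tpOver_eq_mk (A : Set M) {n : ℕ} (l : List M) (hl : l.length = n) (v : Fin n → M)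
    (hv : ∀ i, v i = l.get (Fin.cast hl.symm i)) :
    tpOver L A l = ⟨n, {f | f.Over A ∧ f.Sat v}⟩ := by
  subst hl
  obtain rfl : v = l.get := funext hv
  rfl

theorem tpOver_ofFn_eq_iff (A : Set M) {n : ℕ} (v w : Fin n → M) :
    tpOver L A (List.ofFn v) = tpOver L A (List.ofFn w) ↔
      ∀ f : ParamFormula L n M, f.Over A → (f.Sat v ↔ f.Sat w) := by
  rw [tpOver_eq_mk A (List.ofFn v) List.length_ofFn v (by simp),
    tpOver_eq_mk A (List.ofFn w) List.length_ofFn w (by simp)]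
  constructor
  · intro h f hf
    have := congrArg (f ∈ ·) (eq_of_heq (Sigma.mk.inj_iff.1 h).2)
    simpa [hf] using this
  · intro h
    congr 1
    ext φ
    exact and_congr_right fun hφ => h φ hφ

theorem tpOver_empty_ofFn_eq_iff {n : ℕ} (v w : Fin n → M) :
    tpOver L (∅ : Set M) (List.ofFn v) = tpOver L (∅ : Set M) (List.ofFn w) ↔
      ∀ φ : L.Formula (Fin n), φ.Realize v ↔ φ.Realize w := by
  rw [tpOver_ofFn_eq_iff]
  constructor
  · intro h φ
    have := h ⟨0, φ.relabel Sum.inl, Fin.elim0⟩ fun i => i.elim0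
    simpa [ParamFormula.Sat, Formula.realize_relabel] using this
  · rintro h ⟨k, φ, c⟩ hc
    cases k with
    | succ k => exact absurd (hc 0) (Set.notMem_empty _)
    | zero =>
      have := h (φ.relabel (Sum.elim id Fin.elim0))
      rw [Formula.realize_relabel, Formula.realize_relabel] at this
      change φ.Realize (Sum.elim v c) ↔ φ.Realize (Sum.elim w c)
      convert this using 2
      · ext (i | i)
        · rfl
        · exact i.elim0
      · ext (i | i)
        · rfl
        · exact i.elim0

theorem realize_iff_of_tpOver_eq {A : Set M} {n : ℕ} {v w : Fin n → M}
    (h : tpOver L A (List.ofFn v) = tpOver L A (List.ofFn w)) {β : Type*}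
    (φ : L.Formula (Fin n ⊕ β)) (c : β → M) (hc : ∀ b, c b ∈ A) :
    φ.Realize (Sum.elim v c) ↔ φ.Realize (Sum.elim w c) := by
  rw [tpOver_ofFn_eq_iff] at h
  obtain ⟨k, f, ψ, -, hψ⟩ := exists_finite_support φ
  rw [← hψ, ← hψ]
  exact h ⟨k, ψ, c ∘ f⟩ fun i => hc _

theorem exists_ofFn {X : Type*} {n : ℕ} {l : List X} (h : l.length = n) :
    ∃ v : Fin n → X, l = List.ofFn v := by
  subst h
  exact ⟨l.get, (List.ofFn_get l).symm⟩

end FirstOrder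

end GemModels

/-! ### Skolem functions -/

namespace GemModels

/-- Operations on `M` of all finite arities. Skolem functions are added as operations on a fixed `M`, used
as their own symbols, so that the expansion of `M` exists by construction. -/
abbrev Operation (M : Type u) : Type u := Σ n : ℕ, (Fin n → M) → M

section Skolem

variable {L : FirstOrder.Language.{u, u}} {M : Type u}

/-- The vocabulary with one function symbol for each operation in `S`. -/
def opLanguage (S : Set (Operation M)) : FirstOrder.Language.{u, u} :=
  ⟨fun n => {f : (Fin n → M) → M // (⟨n, f⟩ : Operation M) ∈ S}, fun _ => PEmpty⟩

instance (S : Set (Operation M)) : (opLanguage S).Structure M where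
  funMap f x := f.1 x
  RelMap R _ := nomatch R

/-- The inclusion of vocabularies of operations. -/
def opInclusion {S S' : Set (Operation M)} (h : S ⊆ S') : opLanguage S →ᴸ opLanguage S' where
  onFunction _ f := ⟨f.1, h f.2⟩
  onRelation _ R := R

instance {S S' : Set (Operation M)} (h : S ⊆ S') : (opInclusion h).IsExpansionOn M :=
  ⟨fun _ _ => rfl, fun R _ => nomatch R⟩

variable (L) in
/-- The inclusion between expansions of `L` by operations. -/
def sumOpInclusion {S S' : Set (Operation M)} (h : S ⊆ S') :
    L.sum (opLanguage S) →ᴸ L.sum (opLanguage S') :=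
  (LHom.id L).sumMap (opInclusion h)

instance [L.Structure M] {S S' : Set (Operation M)} (h : S ⊆ S') :
    (sumOpInclusion L h).IsExpansionOn M :=
  LHom.sumMap_isExpansionOn _ _ M

theorem card_opLanguage (S : Set (Operation M)) : (opLanguage S).card = #S := by
  have e : (opLanguage S).Symbols ≃ S :=
    { toFun := fun x => match x with
        | .inl ⟨n, f⟩ => ⟨⟨n, f.1⟩, f.2⟩
        | .inr ⟨_, R⟩ => nomatch R
      invFun := fun s => .inl ⟨s.1.1, s.1.2, s.2⟩
      left_inv := by rintro (⟨n, f⟩ | ⟨_, R⟩) <;> [rfl; exact nomatch R]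
      right_inv := fun _ => rfl }
  exact Cardinal.mk_congr e

theorem card_sum_opLanguage (S : Set (Operation M)) :
    (L.sum (opLanguage S)).card = L.card + #S := by
  rw [card_sum, card_opLanguage]; simp

section Chain

variable {S : ℕ → Set (Operation M)} (hS : Monotone S)
include hS

/-- A term over the union of an increasing sequence of expansions lives at a finite stage. -/
theorem exists_onTerm_eq {α : Type*} (t : (L.sum (opLanguage (⋃ k, S k))).Term α) :
    ∃ k, ∀ k' ≥ k, ∃ t', (sumOpInclusion L (Set.subset_iUnion S k')).onTerm t' = t := by
  induction t with
  | var a => exact ⟨0, fun k' _ => ⟨.var a, rfl⟩⟩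
  | @func n f ts ih =>
    choose k hk using ih
    obtain ⟨k₀, hk₀⟩ : ∃ k₀, ∀ k' ≥ k₀, ∃ f', (sumOpInclusion L (Set.subset_iUnion S k')).onFunction f' = f := by
      rcases f with f | ⟨f, hf⟩
      · exact ⟨0, fun k' _ => ⟨.inl f, rfl⟩⟩
      · obtain ⟨k₀, hk₀⟩ := Set.mem_iUnion.1 hf
        exact ⟨k₀, fun k' hk' => ⟨.inr ⟨f, hS hk' hk₀⟩, rfl⟩⟩
    refine ⟨max k₀ (Finset.univ.sup k), fun k' hk' => ?_⟩
    obtain ⟨f', hf'⟩ := hk₀ k' (le_of_max_le_left hk')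
    have := fun i => hk i k' ((Finset.le_sup (Finset.mem_univ i)).trans (le_of_max_le_right hk'))
    choose ts' hts' using this
    exact ⟨.func f' ts', by simp only [LHom.onTerm, hf', hts']⟩

theorem exists_onBoundedFormula_eq {α : Type*} {n : ℕ}
    (φ : (L.sum (opLanguage (⋃ k, S k))).BoundedFormula α n) :
    ∃ k, ∀ k' ≥ k, ∃ φ', (sumOpInclusion L (Set.subset_iUnion S k')).onBoundedFormula φ' = φ := by
  induction φ with
  | falsum => exact ⟨0, fun _ _ => ⟨.falsum, rfl⟩⟩
  | equal t₁ t₂ =>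
    obtain ⟨k₁, h₁⟩ := exists_onTerm_eq hS t₁
    obtain ⟨k₂, h₂⟩ := exists_onTerm_eq hS t₂
    refine ⟨max k₁ k₂, fun k' hk' => ?_⟩
    obtain ⟨t₁', rfl⟩ := h₁ k' (le_of_max_le_left hk')
    obtain ⟨t₂', rfl⟩ := h₂ k' (le_of_max_le_right hk')
    exact ⟨.equal t₁' t₂', rfl⟩
  | rel R ts =>
    choose k hk using fun i => exists_onTerm_eq hS (ts i)
    refine ⟨Finset.univ.sup k, fun k' hk' => ?_⟩
    choose ts' hts' using fun i => hk i k' ((Finset.le_sup (Finset.mem_univ i)).trans hk')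
    rcases R with R | R
    · refine ⟨.rel (Sum.inl R) ts', ?_⟩
      rw [← funext hts']
      rfl
    · exact nomatch R
  | imp _ _ ih₁ ih₂ =>
    obtain ⟨k₁, h₁⟩ := ih₁
    obtain ⟨k₂, h₂⟩ := ih₂
    refine ⟨max k₁ k₂, fun k' hk' => ?_⟩
    obtain ⟨φ₁, rfl⟩ := h₁ k' (le_of_max_le_left hk')
    obtain ⟨φ₂, rfl⟩ := h₂ k' (le_of_max_le_right hk')
    exact ⟨.imp φ₁ φ₂, rfl⟩
  | all _ ih =>
    obtain ⟨k, h⟩ := ih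
    refine ⟨k, fun k' hk' => ?_⟩
    obtain ⟨φ', rfl⟩ := h k' hk'
    exact ⟨.all φ', rfl⟩

end Chain

variable (L M) [L.Structure M] [Nonempty M]

/-- The operations obtained by adding, at each step, a Skolem function for each formula that uses only
the operations of the previous step. -/
noncomputable def skolemOps : ℕ → Set (Operation M)
  | 0 => ∅
  | k + 1 => skolemOps k ∪ Set.range
      fun φ : Σ n, (L.sum (opLanguage (skolemOps k))).BoundedFormula Empty (n + 1) =>
        ⟨φ.1, fun xs => Classical.epsilon fun a => φ.2.Realize default (Fin.snoc xs a : _ → M)⟩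

theorem monotone_skolemOps : Monotone (skolemOps L M) :=
  monotone_nat_of_le_succ fun _ => Set.subset_union_left

theorem card_skolemOps_le (k : ℕ) : #(skolemOps L M k) ≤ L.card + ℵ₀ := by
  induction k with
  | zero => simp [skolemOps]
  | succ k ih =>
    have hinf : ℵ₀ ≤ L.card + ℵ₀ := le_add_self
    refine (Cardinal.mk_union_le _ _).trans (Cardinal.add_le_of_le hinf ih ?_)
    refine Cardinal.mk_range_le.trans ?_
    have h₁ : #(Σ n, (L.sum (opLanguage (skolemOps L M k))).BoundedFormula Empty (n + 1)) ≤
        #(Σ n, (L.sum (opLanguage (skolemOps L M k))).BoundedFormula Empty n) :=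
      ⟨⟨Sigma.map Nat.succ fun _ => id,
        Nat.succ_injective.sigma_map fun _ => Function.injective_id⟩⟩
    refine h₁.trans (BoundedFormula.card_le.trans (max_le hinf ?_))
    rw [card_sum_opLanguage]
    simp only [mk_eq_zero, lift_zero, zero_add, lift_uzero]
    exact Cardinal.add_le_of_le hinf le_self_add ih

/-- Every structure has an expansion with Skolem functions, in a vocabulary that is not larger than
necessary. -/
theorem exists_skolemization :
    ∃ (L' : FirstOrder.Language.{u, u}) (κ : L →ᴸ L') (_ : L'.Structure M),
      κ.Injective ∧ κ.IsExpansionOn M ∧ L'.card ≤ L.card + ℵ₀ ∧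
      ∀ (n : ℕ) (φ : L'.BoundedFormula Empty (n + 1)), ∃ σ : L'.Term (Fin n),
        ∀ (xs : Fin n → M) (x : M), φ.Realize default (Fin.snoc xs x : _ → M) →
          φ.Realize default (Fin.snoc xs (σ.realize xs) : _ → M) := by
  refine ⟨L.sum (opLanguage (⋃ k, skolemOps L M k)), LHom.sumInl, inferInstance,
    LHom.sumInl_injective, inferInstance, ?_, fun n φ => ?_⟩
  · have hinf : ℵ₀ ≤ L.card + ℵ₀ := le_add_self
    rw [card_sum_opLanguage]
    refine Cardinal.add_le_of_le hinf le_self_add ?_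
    have := Cardinal.mk_iUnion_le_sum_mk_lift (f := skolemOps L M)
    rw [Cardinal.lift_id'] at this
    refine this.trans ((Cardinal.sum_le_sum _ _ (card_skolemOps_le L M)).trans ?_)
    simp only [sum_const, mk_nat, lift_aleph0, lift_uzero]
    exact (Cardinal.mul_le_max_of_aleph0_le_left le_rfl).trans (max_le hinf le_rfl)
  · obtain ⟨k, hk⟩ := exists_onBoundedFormula_eq (monotone_skolemOps L M) φ
    obtain ⟨φ', rfl⟩ := hk k le_rfl
    let g : (Fin n → M) → M := fun xs =>
      Classical.epsilon fun a => φ'.Realize default (Fin.snoc xs a : _ → M)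
    have hg : (⟨n, g⟩ : Operation M) ∈ ⋃ k, skolemOps L M k :=
      Set.mem_iUnion.2 ⟨k + 1, Or.inr ⟨⟨n, φ'⟩, rfl⟩⟩
    refine ⟨Functions.term (Sum.inr ⟨g, hg⟩), fun xs x hx => ?_⟩
    rw [LHom.realize_onBoundedFormula] at hx ⊢
    exact Classical.epsilon_spec (p := fun a => φ'.Realize default (Fin.snoc xs a : _ → M)) ⟨x, hx⟩

end Skolem

end GemModels

/-! ### Elementary maps between generated structures; elimination of quantifiers -/

namespace GemModels

section Generated

variable {L : FirstOrder.Language.{u, u}}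

/-- Substitution of terms for the variables of a formula. -/
def substTerms {α β : Type*} (φ : L.Formula α) (f : α → L.Term β) : L.Formula β :=
  BoundedFormula.subst φ f

theorem realize_substTerms {α β : Type*} {N : Type u} [L.Structure N] (φ : L.Formula α)
    (f : α → L.Term β) (v : β → N) :
    (substTerms φ f).Realize v ↔ φ.Realize fun a => (f a).realize v :=
  BoundedFormula.realize_subst

variable {M N N' : Type u} [L.Structure M] [L.Structure N]
  [L.Structure N']

theorem realize_iff_of_pairs {Z : Set (N × N')}
    (hZ : ∀ (n : ℕ) (q : Fin n → N × N'), (∀ i, q i ∈ Z) → ∀ φ : L.Formula (Fin n),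
      φ.Realize (fun i => (q i).1) ↔ φ.Realize (fun i => (q i).2))
    (φ : L.Formula Z) : φ.Realize (fun z => z.1.1) ↔ φ.Realize (fun z => z.1.2) := by
  obtain ⟨k, f, ψ, -, hψ⟩ := exists_finite_support (φ.relabel (Sum.inr : Z → Fin 0 ⊕ Z))
  have h₁ := hψ N Fin.elim0 fun z => z.1.1
  have h₂ := hψ N' Fin.elim0 fun z => z.1.2
  rw [Formula.realize_relabel, Sum.elim_comp_inr] at h₁ h₂
  rw [← h₁, ← h₂]
  have := hZ k (fun i => (f i).1) (fun i => (f i).2) (ψ.relabel (Sum.elim Fin.elim0 id))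
  rw [Formula.realize_relabel, Formula.realize_relabel] at this
  convert this using 2
  · ext (i | i)
    · exact i.elim0
    · rfl
  · ext (i | i)
    · exact i.elim0
    · rfl

/-- A finitely elementary partial map whose domain generates the structure extends to an elementary
embedding. -/
theorem exists_elementaryEmbedding_of_pairs {Z : Set (N × N')}
    (hZ : ∀ (n : ℕ) (q : Fin n → N × N'), (∀ i, q i ∈ Z) → ∀ φ : L.Formula (Fin n),
      φ.Realize (fun i => (q i).1) ↔ φ.Realize (fun i => (q i).2))
    (hgen : Substructure.closure L (Prod.fst '' Z) = ⊤) :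
    ∃ g : N ↪ₑ[L] N', ∀ z ∈ Z, g z.1 = z.2 := by
  have key := realize_iff_of_pairs hZ
  have hterm : ∀ x : N, ∃ σ : L.Term Z, σ.realize (fun z => z.1.1) = x := by
    intro x
    have hx : x ∈ Substructure.closure L (Prod.fst '' Z) := by rw [hgen]; trivial
    obtain ⟨σ, rfl⟩ := Substructure.mem_closure_iff_exists_term.1 hx
    choose f hf hfx using fun y : Prod.fst '' Z => y.2
    refine ⟨σ.relabel fun y => ⟨f y, hf y⟩, ?_⟩
    rw [Term.realize_relabel]
    congr 1
    exact funext hfx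
  choose σ hσ using hterm
  refine ⟨⟨fun x => (σ x).realize fun z => z.1.2, fun n φ x => ?_⟩, fun z hz => ?_⟩
  · have := key (substTerms φ fun i => σ (x i))
    rw [realize_substTerms, realize_substTerms] at this
    simp only [hσ] at this
    exact this.symm
  · have := key ((σ z.1).equal (.var ⟨z, hz⟩))
    rw [Formula.realize_equal, Formula.realize_equal] at this
    exact this.1 (hσ _)

/-- If corresponding sequences of two families have the same types, the correspondence extends to an
elementary embedding of the structure generated by the first. -/
theorem exists_elementaryEmbedding_of_skeleton {X : Type*} (a : X → List N) (a' : X → List N')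
    (hgen : Substructure.closure L {x : N | ∃ t, x ∈ a t} = ⊤)
    (hlen : ∀ t, (a t).length = (a' t).length)
    (h : ∀ (t : List X) (n : ℕ) (v : Fin n → N) (w : Fin n → N'), t.flatMap a = List.ofFn v →
      t.flatMap a' = List.ofFn w → ∀ φ : L.Formula (Fin n), φ.Realize v ↔ φ.Realize w) :
    ∃ g : N ↪ₑ[L] N', ∀ t, (a t).map g = a' t := by
  let P : X → List (N × N') := fun t => (a t).zip (a' t)
  have hP₁ : ∀ t, (P t).map Prod.fst = a t := fun t => List.map_fst_zip (hlen t).le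
  have hP₂ : ∀ t, (P t).map Prod.snd = a' t := fun t => List.map_snd_zip (hlen t).ge
  let Z : Set (N × N') := {z | ∃ t, z ∈ P t}
  obtain ⟨g, hg⟩ := exists_elementaryEmbedding_of_pairs (L := L) (Z := Z) (by
    intro n q hq φ
    choose t ht using hq
    obtain ⟨m, r, hr⟩ : ∃ m, ∃ r : Fin m → N × N', (List.ofFn t).flatMap P = List.ofFn r :=
      ⟨_, _, (List.ofFn_get _).symm⟩
    have hidx : ∀ i, ∃ j, r j = q i := fun i => by
      have : q i ∈ (List.ofFn t).flatMap P := List.mem_flatMap.2 ⟨t i, by simp, ht i⟩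
      simpa [hr, List.mem_ofFn] using this
    choose f hf using hidx
    have := h (List.ofFn t) m (fun i => (r i).1) (fun i => (r i).2)
      (by
        have := congrArg (List.map Prod.fst) hr
        rw [List.map_flatMap, List.map_ofFn] at this
        simp only [hP₁] at this
        exact this)
      (by
        have := congrArg (List.map Prod.snd) hr
        rw [List.map_flatMap, List.map_ofFn] at this
        simp only [hP₂] at this
        exact this) (φ.relabel f)
    rw [Formula.realize_relabel, Formula.realize_relabel] at this
    simpa only [Function.comp_def, hf] using this) (by
    rw [← hgen]
    congr 1
    ext x
    constructor
    · rintro ⟨z, ⟨t, ht⟩, rfl⟩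
      exact ⟨t, by rw [← hP₁]; exact List.mem_map_of_mem ht⟩
    · rintro ⟨t, ht⟩
      rw [← hP₁, List.mem_map] at ht
      obtain ⟨z, hz, rfl⟩ := ht
      exact ⟨z, ⟨t, hz⟩, rfl⟩)
  refine ⟨g, fun t => ?_⟩
  rw [← hP₁, ← hP₂, List.map_map]
  exact List.map_congr_left fun z hz => hg z ⟨t, hz⟩

/-- In a generated structure every finite tuple is given by terms in a sufficiently long finite part of
the generating family. -/
theorem exists_terms {X : Type*} (a : X → List N)
    (hgen : Substructure.closure L {x : N | ∃ t, x ∈ a t} = ⊤) {k : ℕ} (x : Fin k → N) :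
    ∃ t₀ : List X, ∀ t : List X, t₀ ⊆ t → ∀ (n : ℕ) (v : Fin n → N), t.flatMap a = List.ofFn v →
      ∃ σ : Fin k → L.Term (Fin n), ∀ i, (σ i).realize v = x i := by
  classical
  have hx : ∀ i, ∃ σ : L.Term {x : N | ∃ t, x ∈ a t}, σ.realize (↑) = x i := fun i =>
    Substructure.mem_closure_iff_exists_term.1 (by rw [hgen]; trivial)
  choose σ hσ using hx
  choose s hs using fun y : {x : N | ∃ t, x ∈ a t} => y.2
  let V : Finset {x : N | ∃ t, x ∈ a t} := Finset.univ.biUnion fun i => (σ i).varFinset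
  refine ⟨V.toList.map s, fun t ht n v hv => ?_⟩
  have hidx : ∀ y ∈ V, ∃ j, v j = y.1 := by
    intro y hy
    have : y.1 ∈ t.flatMap a := List.mem_flatMap.2
      ⟨s y, ht (List.mem_map_of_mem (Finset.mem_toList.2 hy)), hs y⟩
    simpa [hv, List.mem_ofFn] using this
  choose f hf using hidx
  refine ⟨fun i => (σ i).restrictVar fun y =>
    f y.1 (Finset.mem_biUnion.2 ⟨i, Finset.mem_univ _, y.2⟩), fun i => ?_⟩
  rw [← hσ i]
  exact Term.realize_restrictVar _ fun y => hf _ _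

end Generated

section QuantifierElimination

variable {L : FirstOrder.Language.{u, u}}

theorem isQF_subst {α β : Type*} {n : ℕ} {φ : L.BoundedFormula α n} (hφ : φ.IsQF)
    (f : α → L.Term β) : (φ.subst f).IsQF := by
  induction hφ with
  | falsum => exact .falsum
  | of_isAtomic h =>
    cases h with
    | equal t₁ t₂ => exact (BoundedFormula.IsAtomic.equal _ _).isQF
    | rel R ts => exact (BoundedFormula.IsAtomic.rel _ _).isQF
  | imp _ _ h₁ h₂ => exact h₁.imp h₂

/-- Every formula has a Skolem term in `M`. The formula has its variables bound de Bruijn style, the last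
one being the variable for which the term is substituted. -/
def HasSkolemTerms (L : FirstOrder.Language.{u, u}) (M : Type u) [L.Structure M] : Prop :=
  ∀ (n : ℕ) (φ : L.BoundedFormula Empty (n + 1)), ∃ σ : L.Term (Fin n),
    ∀ (xs : Fin n → M) (x : M), φ.Realize default (Fin.snoc xs x : _ → M) →
      φ.Realize default (Fin.snoc xs (σ.realize xs) : _ → M)

/-- `N` satisfies every universal sentence which is true in `M`. -/
def InheritsUniversal (L : FirstOrder.Language.{u, u}) (M N : Type u) [L.Structure M]
    [L.Structure N] : Prop :=
  ∀ (n : ℕ) (φ : L.Formula (Fin n)), φ.IsQF → (∀ v : Fin n → M, φ.Realize v) →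
    ∀ v : Fin n → N, φ.Realize v

variable {M : Type u} [L.Structure M]

theorem exists_qf_of_boundedFormula (hM : HasSkolemTerms L M) {n : ℕ}
    (φ : L.BoundedFormula Empty n) : ∃ ψ : L.Formula (Fin n), ψ.IsQF ∧
      ∀ (N : Type u) [L.Structure N], InheritsUniversal L M N → ∀ xs : Fin n → N,
        φ.Realize default xs ↔ ψ.Realize xs := by
  have hE : ∀ {n : ℕ} {N : Type u} [L.Structure N] (t : L.Term (Empty ⊕ Fin n)) (xs : Fin n → N),
      (t.relabel (Sum.elim Empty.elim id : Empty ⊕ Fin n → Fin n)).realize xs =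
        t.realize (Sum.elim default xs) := by
    intro n N _ t xs
    rw [Term.realize_relabel]
    congr 1
    ext (i | i)
    · exact i.elim
    · rfl
  induction φ with
  | falsum => exact ⟨⊥, .falsum, fun N _ _ xs => Iff.rfl⟩
  | equal t₁ t₂ =>
    refine ⟨(t₁.relabel (Sum.elim Empty.elim id)).equal (t₂.relabel (Sum.elim Empty.elim id)),
      (BoundedFormula.IsAtomic.equal _ _).isQF, fun N _ _ xs => ?_⟩
    rw [Formula.realize_equal, hE, hE]
    rfl
  | rel R ts =>
    refine ⟨R.formula fun i => (ts i).relabel (Sum.elim Empty.elim id),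
      (BoundedFormula.IsAtomic.rel _ _).isQF, fun N _ _ xs => ?_⟩
    rw [Formula.realize_rel]
    simp only [hE]
    rfl
  | imp _ _ ih₁ ih₂ =>
    obtain ⟨ψ₁, h₁, h₁'⟩ := ih₁
    obtain ⟨ψ₂, h₂, h₂'⟩ := ih₂
    refine ⟨ψ₁.imp ψ₂, h₁.imp h₂, fun N _ hN xs => ?_⟩
    rw [Formula.realize_imp, ← h₁' N hN, ← h₂' N hN]
    rfl
  | @all n φ ih =>
    obtain ⟨ψ, h, h'⟩ := ih
    obtain ⟨σ, hσ⟩ := hM n φ.not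
    refine ⟨substTerms ψ (Fin.snoc (fun i => .var i) σ : Fin (n + 1) → L.Term (Fin n)), isQF_subst h _,
      fun N _ hN xs => ?_⟩
    have hsubst : ∀ {N : Type u} [L.Structure N] (xs : Fin n → N) (x : N),
        (substTerms ψ (Fin.snoc (fun i => .var i.castSucc) (σ.relabel Fin.castSucc) :
          Fin (n + 1) → L.Term (Fin (n + 1)))).Realize
            (Fin.snoc xs x : _ → N) ↔
          ψ.Realize (Fin.snoc xs (σ.realize xs) : Fin (n + 1) → N) := by
      intro N _ xs x
      rw [realize_substTerms]
      have : ∀ i : Fin (n + 1), Term.realize (Fin.snoc xs x : _ → N)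
          ((Fin.snoc (fun i => .var i.castSucc) (σ.relabel Fin.castSucc) :
            Fin (n + 1) → L.Term (Fin (n + 1))) i) =
          (Fin.snoc xs (σ.realize xs) : Fin (n + 1) → N) i := by
        intro i
        refine Fin.lastCases ?_ (fun j => ?_) i
        · simp only [Fin.snoc_last, Term.realize_relabel]
          congr 1
          ext j
          simp
        · simp
      rw [funext this]
    have hsubst' : (substTerms ψ (Fin.snoc (fun i => .var i) σ :
        Fin (n + 1) → L.Term (Fin n))).Realize xs ↔ ψ.Realize (Fin.snoc xs (σ.realize xs) : Fin (n + 1) → N) := by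
      rw [realize_substTerms]
      have : ∀ i : Fin (n + 1), Term.realize xs
          ((Fin.snoc (fun i => .var i) σ : Fin (n + 1) → L.Term (Fin n)) i) =
          (Fin.snoc xs (σ.realize xs) : Fin (n + 1) → N) i := by
        intro i
        refine Fin.lastCases ?_ (fun j => ?_) i <;> simp
      rw [funext this]
    -- the Skolem term for the negation is a counterexample whenever there is one
    have hax := hN (n + 1) ((substTerms ψ (Fin.snoc (fun i => .var i.castSucc) (σ.relabel Fin.castSucc) :
      Fin (n + 1) → L.Term (Fin (n + 1)))).imp ψ) ((isQF_subst h _).imp h) (by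
        intro y
        rw [← Fin.snoc_init_self y, Formula.realize_imp]
        refine fun h₁ => ?_
        have h₁ := (hsubst _ _).1 h₁
        by_contra h₂
        have hMM : InheritsUniversal L M M := fun _ _ _ h => h
        rw [← h' M hMM] at h₁ h₂
        exact (BoundedFormula.realize_not.1 (hσ _ _ (BoundedFormula.realize_not.2 h₂))) h₁)
    rw [hsubst', BoundedFormula.realize_all]
    constructor
    · intro hall
      exact (h' N hN _).1 (hall _)
    · intro h₁ x
      rw [h' N hN]
      have := hax (Fin.snoc xs x)
      rw [Formula.realize_imp] at this
      exact this ((hsubst _ _).2 h₁)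

/-- Skolem terms eliminate quantifiers, uniformly in all structures which satisfy the universal
sentences true in `M`. -/
theorem exists_qf (hM : HasSkolemTerms L M) {n : ℕ} (φ : L.Formula (Fin n)) :
    ∃ ψ : L.Formula (Fin n), ψ.IsQF ∧ ∀ (N : Type u) [L.Structure N], InheritsUniversal L M N →
      ∀ xs : Fin n → N, φ.Realize xs ↔ ψ.Realize xs := by
  obtain ⟨ψ, h, h'⟩ := exists_qf_of_boundedFormula hM
    (BoundedFormula.relabel (Sum.inr : Fin n → Empty ⊕ Fin n) φ)
  refine ⟨ψ, h, fun N _ hN xs => ?_⟩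
  rw [← h' N hN, Formula.realize_relabel_sumInr]

theorem InheritsUniversal.realize (hM : HasSkolemTerms L M) {N : Type u} [L.Structure N]
    (hN : InheritsUniversal L M N) {n : ℕ} (φ : L.Formula (Fin n))
    (h : ∀ v : Fin n → M, φ.Realize v) (v : Fin n → N) : φ.Realize v := by
  obtain ⟨ψ, hψ, hφψ⟩ := exists_qf hM φ
  rw [hφψ N hN]
  exact hN n ψ hψ (fun v => (hφψ M (fun _ _ _ h => h) v).1 (h v)) v

end QuantifierElimination

end GemModels

/-! ### Templates from the Ramsey property -/

namespace GemModels

open IndexModel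

section Reduct

variable {L L' : FirstOrder.Language.{u, u}}

/-- The restriction of a quantifier-free type along `ι`. -/
def reductQF (ι : L →ᴸ L') (q : QFType L') : QFType L :=
  ⟨q.1, {φ | BoundedFormula.IsQF φ ∧ ι.onFormula φ ∈ q.2}⟩

theorem reductQF_qfType (ι : L →ᴸ L') {N : Type u} [L.Structure N] [L'.Structure N]
    [ι.IsExpansionOn N] (l : List N) : reductQF ι (qfType L' l) = qfType L l := by
  unfold reductQF qfType
  congr 1
  ext φ
  refine and_congr_right fun hφ => ?_
  rw [Set.mem_ofPred_eq, LHom.realize_onFormula]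
  exact and_iff_right (isQF_onBoundedFormula ι hφ)

theorem qfType_map {N N' : Type u} [L.Structure N] [L.Structure N'] (f : N ↪[L] N') (l : List N) :
    qfType L (l.map f) = qfType L l := by
  rw [eq_comm, ← List.ofFn_get l, List.map_ofFn, qfType_ofFn_eq_iff]
  intro φ hφ
  rw [Formula.Realize, Formula.Realize, ← hφ.realize_embedding f, Subsingleton.elim (f ∘ default)]

end Reduct

namespace Template

variable {τ : FirstOrder.Language.{u, u}}

/-- The restriction of a template along `ι`. -/
abbrev restrict (Ψ : Template τ) {L : FirstOrder.Language.{u, u}} (ι : L →ᴸ Ψ.lang) : Template τ :=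
  ⟨L, fun q => reductQF ι (Ψ.tp q)⟩

/-- The substructure generated by the skeleton in the reduct. -/
theorem IsGEM.exists_restrict {Ψ : Template τ} {L : FirstOrder.Language.{u, u}} (ι : L →ᴸ Ψ.lang)
    {I : IndexModel τ} {N : Type u} [Ψ.lang.Structure N] {a : I → List N} (h : Ψ.IsGEM I N a) :
    ∃ (N' : Type u) (_ : (Ψ.restrict ι).lang.Structure N') (a' : I → List N'),
      (Ψ.restrict ι).IsGEM I N' a' := by
  let : L.Structure N := ι.reduct N
  let S : L.Substructure N := Substructure.closure L {x : N | ∃ t, x ∈ a t}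
  have hlift : ∀ t, ∃ l : List S, l.map S.subtype = a t := by
    intro t
    have : ∀ l : List N, (∀ x ∈ l, x ∈ S) → ∃ l' : List S, l'.map S.subtype = l := by
      intro l hl
      induction l with
      | nil => exact ⟨[], rfl⟩
      | cons x l ih =>
        obtain ⟨l', rfl⟩ := ih fun y hy => hl y (List.mem_cons_of_mem _ hy)
        exact ⟨⟨x, hl x List.mem_cons_self⟩ :: l', rfl⟩
    exact this _ fun x hx => Substructure.subset_closure ⟨t, hx⟩
  choose a' ha' using hlift
  refine ⟨S, inferInstanceAs (L.Structure S), a', ?_, fun t => ?_⟩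
  · change Substructure.closure L {x : S | ∃ t, x ∈ a' t} = ⊤
    apply Substructure.map_injective_of_injective (f := S.subtype.toHom) S.subtype.injective
    rw [Substructure.map_closure]
    have h₁ : S.subtype.toHom '' {x : S | ∃ t, x ∈ a' t} = {x : N | ∃ t, x ∈ a t} := by
      ext x
      constructor
      · rintro ⟨y, ⟨t, ht⟩, rfl⟩
        exact ⟨t, by rw [← ha']; exact List.mem_map_of_mem ht⟩
      · rintro ⟨t, ht⟩
        rw [← ha', List.mem_map] at ht
        obtain ⟨y, hy, rfl⟩ := ht
        exact ⟨y, ⟨t, hy⟩, rfl⟩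
    rw [h₁]
    change S = _
    ext x
    constructor
    · intro hx
      exact ⟨⟨x, hx⟩, trivial, rfl⟩
    · rintro ⟨y, -, rfl⟩
      exact y.2
  · change qfType L (t.flatMap a') = reductQF ι (Ψ.tp (I.qftp t))
    rw [← h.qfType_eq, reductQF_qfType, ← qfType_map S.subtype, List.map_flatMap]
    simp only [ha']

theorem Proper.restrict {K : Set (IndexModel τ)} {Ψ : Template τ} (h : Ψ.Proper K)
    {L : FirstOrder.Language.{u, u}} (ι : L →ᴸ Ψ.lang) : (Ψ.restrict ι).Proper K := by
  intro I hI
  obtain ⟨N, _, a, ha⟩ := h I hI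
  exact ha.exists_restrict ι

theorem IsGEM.realize_qf_iff {Φ : Template τ} {I I' : IndexModel τ} {N N' : Type u}
    [Φ.lang.Structure N] [Φ.lang.Structure N'] {a : I → List N} {a' : I' → List N'}
    (h : Φ.IsGEM I N a) (h' : Φ.IsGEM I' N' a') {t : List I} {t' : List I'}
    (ht : I.qftp t = I'.qftp t') {n : ℕ} {v : Fin n → N} {w : Fin n → N'}
    (hv : t.flatMap a = List.ofFn v) (hw : t'.flatMap a' = List.ofFn w)
    {φ : Φ.lang.Formula (Fin n)} (hφ : φ.IsQF) : φ.Realize v ↔ φ.Realize w := by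
  have := (h.qfType_eq t).trans ((congrArg Φ.tp ht).trans (h'.qfType_eq t').symm)
  rw [hv, hw, qfType_ofFn_eq_iff] at this
  exact this φ hφ

theorem IsGEM.length_flatMap {Φ : Template τ} {I I' : IndexModel τ} {N N' : Type u}
    [Φ.lang.Structure N] [Φ.lang.Structure N'] {a : I → List N} {a' : I' → List N'}
    (h : Φ.IsGEM I N a) (h' : Φ.IsGEM I' N' a') {t : List I} {t' : List I'}
    (ht : I.qftp t = I'.qftp t') : (t.flatMap a).length = (t'.flatMap a').length :=
  congrArg Sigma.fst ((h.qfType_eq t).trans ((congrArg Φ.tp ht).trans (h'.qfType_eq t').symm))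

/-- The template `Φ` is modelled on the family `b` in `M`: the models `GEM(I, Φ)` inherit the universal
theory of the Skolemized structure `M`, and what is true in `M` at all sequences of a given
quantifier-free type is true in `GEM(I, Φ)` at the sequences of that type. -/
structure ModelledOn (K : Set (IndexModel τ)) (Φ : Template τ) (J : IndexModel τ) (M : Type u)
    [Φ.lang.Structure M] (b : J → List M) : Prop where
  proper : Φ.Proper K
  skolem : HasSkolemTerms Φ.lang M
  inherits : ∀ I ∈ K, ∀ (N : Type u) [Φ.lang.Structure N] (a : I → List N), Φ.IsGEM I N a →
    InheritsUniversal Φ.lang M N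
  transfer : ∀ I ∈ K, ∀ (N : Type u) [Φ.lang.Structure N] (a : I → List N), Φ.IsGEM I N a →
    ∀ (t : List I) (s : List J), J.qftp s = I.qftp t → ∀ (n : ℕ) (φ : Φ.lang.Formula (Fin n)),
      (∀ s', J.qftp s' = J.qftp s → ∃ v, s'.flatMap b = List.ofFn v ∧ φ.Realize v) →
      ∃ w, t.flatMap a = List.ofFn w ∧ φ.Realize w

variable {K : Set (IndexModel τ)} {lt : τ.Relations 2}

/-- The Ramsey property yields a template in the vocabulary of a given Skolemized structure `M`. The
template which it provides may have a larger vocabulary; its restriction to that of `M` still reflects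
all formulas, as Skolem terms make them equivalent to quantifier-free ones. -/
theorem exists_modelledOn (hK : IsIndexModelClass lt K) {J : IndexModel τ} (hJ : IsSat K J)
    (L : FirstOrder.Language.{u, u}) (M : Type u) [L.Structure M] [Nonempty M] (b : J → List M)
    (hb : ∀ s t : J, J.qftp [s] = J.qftp [t] → (b s).length = (b t).length)
    (hM : HasSkolemTerms L M) :
    ∃ tp : QFType τ → QFType L, ModelledOn K ⟨L, tp⟩ J M b := by
  obtain ⟨Ψ, ι, hΨ, -, hR⟩ := hK.ramsey J hJ L M b hb
  obtain ⟨N₀, _, a₀, h₀⟩ := hΨ J hJ.mem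
  let : L.Structure N₀ := ι.reduct N₀
  obtain ⟨-, hR⟩ := hR N₀ a₀ h₀
  have hprop : (Ψ.restrict ι).Proper K := hΨ.restrict ι
  -- sentences pass from `M` to the reduct of `GEM(J, Ψ)`, as instances of reflection without variables
  have hinh₀ : InheritsUniversal L M N₀ := by
    intro n φ hφ hM v
    let χ : L.Formula (Fin 0) := (φ.relabel (Sum.inr : Fin n → Fin 0 ⊕ Fin n)).iAlls (Fin n)
    have hχ : ∀ {N : Type u} [L.Structure N] (x : Fin 0 → N),
        χ.Realize x ↔ ∀ v : Fin n → N, φ.Realize v := by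
      intro N _ x
      rw [Formula.realize_iAlls]
      refine forall_congr' fun v => ?_
      rw [Formula.realize_relabel]
      rfl
    obtain ⟨w, -, hw⟩ := hR [] 0 0 χ Fin.elim0 (by
      intro t ht
      obtain rfl : t = [] := List.length_eq_zero_iff.1 (length_eq_of_qftp_eq ht)
      exact ⟨Fin.elim0, rfl, (hχ _).2 hM⟩)
    rw [LHom.realize_onFormula] at hw
    exact (hχ _).1 hw v
  -- quantifier-free types agree across all the models of the template
  have hqf : ∀ I : IndexModel τ, ∀ (N : Type u) [L.Structure N] (a : I → List N),
      (Ψ.restrict ι).IsGEM I N a → ∀ (t : List I) (s : List J), J.qftp s = I.qftp t →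
        qfType L (t.flatMap a) = qfType L (s.flatMap a₀) := by
    intro I N _ a ha t s hst
    rw [ha.qfType_eq, ← hst]
    change reductQF ι (Ψ.tp (J.qftp s)) = _
    rw [← h₀.qfType_eq, reductQF_qfType]
  have hinh : ∀ I ∈ K, ∀ (N : Type u) [L.Structure N] (a : I → List N),
      (Ψ.restrict ι).IsGEM I N a → InheritsUniversal L M N := by
    intro I hI N _ a ha n φ hφ hMφ x
    obtain ⟨t, ht⟩ := exists_terms (L := L) a ha.generates x
    obtain ⟨v, hv⟩ := exists_ofFn (l := t.flatMap a) rfl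
    obtain ⟨σ, hσ⟩ := ht t (List.Subset.refl _) _ v hv
    obtain ⟨s, hs⟩ := hK.exists_qftp_eq hI hJ t
    have hq := hqf I N a ha t s hs
    obtain ⟨w, hw⟩ := exists_ofFn (l := s.flatMap a₀) (n := (t.flatMap a).length)
      (congrArg Sigma.fst hq).symm
    rw [hv, hw, qfType_ofFn_eq_iff] at hq
    have h₁ := hq (substTerms φ σ) (isQF_subst hφ σ)
    rw [realize_substTerms, realize_substTerms] at h₁
    rw [← funext hσ]
    exact h₁.2 (hinh₀ n φ hφ hMφ _)
  refine ⟨(Ψ.restrict ι).tp, hprop, hM, hinh, ?_⟩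
  intro I hI N _ a ha t s hst n φ hφ
  obtain ⟨w₀, hw₀, hφw₀⟩ := hR s n n φ Term.var (by simpa using hφ)
  have hq := hqf I N a ha t s hst
  obtain ⟨w, hw⟩ := exists_ofFn (l := t.flatMap a) (n := n)
    ((congrArg Sigma.fst hq).trans (by change (s.flatMap a₀).length = n; rw [hw₀]; simp))
  refine ⟨w, hw, ?_⟩
  obtain ⟨ψ, hψ, hφψ⟩ := exists_qf hM φ
  rw [LHom.realize_onFormula] at hφw₀
  have hφw₁ : φ.Realize w₀ := by simpa using hφw₀
  rw [hw, hw₀, qfType_ofFn_eq_iff] at hq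
  rw [hφψ N (hinh I hI N a ha)]
  rw [hφψ N₀ hinh₀] at hφw₁
  exact (hq ψ hψ).2 hφw₁

end Template

end GemModels

/-! ### Templates modelled on a Skolemized structure belong to `Υ` -/

namespace GemModels

open IndexModel

namespace Template

variable {τ : FirstOrder.Language.{u, u}} {K : Set (IndexModel τ)} {lt : τ.Relations 2}
  {Φ : Template τ} {J : IndexModel τ} {M : Type u} [Φ.lang.Structure M] {b : J → List M}

theorem ModelledOn.realize_iff (h : Φ.ModelledOn K J M b) {I I' : IndexModel τ} (hI : I ∈ K)
    (hI' : I' ∈ K) {N N' : Type u} [Φ.lang.Structure N] [Φ.lang.Structure N'] {a : I → List N}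
    {a' : I' → List N'} (ha : Φ.IsGEM I N a) (ha' : Φ.IsGEM I' N' a') {t : List I} {t' : List I'}
    (ht : I.qftp t = I'.qftp t') {n : ℕ} {v : Fin n → N} {w : Fin n → N'}
    (hv : t.flatMap a = List.ofFn v) (hw : t'.flatMap a' = List.ofFn w)
    (φ : Φ.lang.Formula (Fin n)) : φ.Realize v ↔ φ.Realize w := by
  obtain ⟨ψ, hψ, hφψ⟩ := exists_qf h.skolem φ
  rw [hφψ N (h.inherits I hI N a ha), hφψ N' (h.inherits I' hI' N' a' ha')]
  exact ha.realize_qf_iff ha' ht hv hw hψ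

theorem ModelledOn.length_eq (h : Φ.ModelledOn K J M b)
    (hb : ∀ s t : J, J.qftp [s] = J.qftp [t] → (b s).length = (b t).length)
    {I : IndexModel τ} (hI : I ∈ K) {N : Type u} [Φ.lang.Structure N] {a : I → List N}
    (ha : Φ.IsGEM I N a) {x : I} {p : J} (hp : J.qftp [p] = I.qftp [x]) :
    (a x).length = (b p).length := by
  obtain ⟨w, hw, -⟩ := h.transfer I hI N a ha [x] [p] hp (b p).length ⊤ (by
    intro s' hs'
    obtain ⟨p', rfl⟩ := List.length_eq_one_iff.1 (length_eq_of_qftp_eq hs')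
    obtain ⟨v, hv⟩ := exists_ofFn (hb p' p hs')
    exact ⟨v, by simpa using hv, Formula.realize_top.2 trivial⟩)
  simpa using congrArg List.length hw

/-- The formula `x ≠ y` is reflected, so skeletons are without repetition when `b` is. -/
theorem ModelledOn.injective (h : Φ.ModelledOn K J M b) (hK : IsIndexModelClass lt K)
    (hJ : IsSat K J)
    (hb : ∀ s t : J, J.qftp [s] = J.qftp [t] → (b s).length = (b t).length)
    (hinj : Function.Injective b)
    {I : IndexModel τ} (hI : I ∈ K) {N : Type u} [Φ.lang.Structure N] {a : I → List N}
    (ha : Φ.IsGEM I N a) : Function.Injective a := by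
  intro x y hxy
  by_contra hne
  have : Nonempty I := hK.nonempty I hI
  have : Nonempty J := hK.nonempty J hJ.mem
  obtain ⟨s, hs⟩ := hK.exists_qftp_eq hI hJ [x, y]
  let ℓ := (a x).length
  let φ : Φ.lang.Formula (Fin (ℓ + ℓ)) := (Formula.iInf fun i : Fin ℓ =>
    Term.equal (Term.var (Fin.castAdd ℓ i)) (Term.var (Fin.natAdd ℓ i))).not
  have hφ : ∀ {N' : Type u} [Φ.lang.Structure N'] (v w : Fin ℓ → N'),
      φ.Realize (Fin.append v w) ↔ v ≠ w := by
    intro N' _ v w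
    rw [Formula.realize_not, Formula.realize_iInf, not_iff_not]
    simp only [Formula.realize_equal, Term.realize_var, Fin.append_left, Fin.append_right]
    exact funext_iff.symm
  obtain ⟨w, hw, hφw⟩ := h.transfer I hI N a ha [x, y] s hs (ℓ + ℓ) φ (by
    intro s' hs'
    obtain ⟨p, q, rfl⟩ := List.length_eq_two.1 (length_eq_of_qftp_eq (hs'.trans hs))
    have hpq := hs'.trans hs
    have hp : J.qftp [p] = I.qftp [x] := qftp_append_left (s := [p]) (t := [q]) (s' := [x])
      (t' := [y]) hpq rfl
    have hq : J.qftp [q] = I.qftp [y] := qftp_append_right (s := [p]) (t := [q]) (s' := [x])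
      (t' := [y]) hpq rfl
    obtain ⟨v, hv⟩ := exists_ofFn (h.length_eq hb hI ha hp).symm
    obtain ⟨v', hv'⟩ := exists_ofFn ((h.length_eq hb hI ha hq).symm.trans (congrArg _ hxy.symm))
    refine ⟨Fin.append v v', by simp [hv, hv', List.ofFn_fin_append], (hφ _ _).2 ?_⟩
    rintro rfl
    have : p = q := hinj (hv.trans hv'.symm)
    subst this
    obtain ⟨θ, hθ, -⟩ := exists_map_of_qftp_eq hpq
    simp only [List.map_cons, List.map_nil, List.cons.injEq, and_true] at hθ
    exact hne (hθ.1.symm.trans hθ.2))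
  obtain ⟨v, hv⟩ := exists_ofFn (l := a x) rfl
  have : w = Fin.append v v := by
    apply List.ofFn_injective
    rw [← hw, List.ofFn_fin_append, ← hv]
    simp [← hxy]
  rw [this, hφ] at hφw
  exact hφw rfl

theorem ModelledOn.realize_sentence (h : Φ.ModelledOn K J M b) {φ : Φ.lang.Sentence}
    (hφ : M ⊨ φ) : φ ∈ Φ.theory K := by
  intro I hI N _ a ha
  have hrel : ∀ {N' : Type u} [Φ.lang.Structure N'] (v : Fin 0 → N'),
      (φ.relabel (Empty.elim : Empty → Fin 0) : Φ.lang.Formula (Fin 0)).Realize v ↔ N' ⊨ φ := by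
    intro N' _ v
    rw [Formula.realize_relabel, Sentence.Realize, Subsingleton.elim (v ∘ _)]
  rw [← hrel Fin.elim0]
  exact (h.inherits I hI N a ha).realize h.skolem _ (fun v => (hrel v).2 hφ) _

theorem ModelledOn.hasSkolem (h : Φ.ModelledOn K J M b) {L : FirstOrder.Language.{u, u}}
    (ι : L →ᴸ Φ.lang) : Φ.HasSkolem K ι := by
  intro n φ
  let χ : Φ.lang.Formula (Fin (n + 1)) :=
    (ι.onFormula φ).relabel (Sum.elim Fin.castSucc fun _ => Fin.last n)
  have hχ : ∀ {N : Type u} [Φ.lang.Structure N] (v : Fin n → N) (x : N),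
      χ.Realize (Fin.snoc v x : _ → N) ↔ (ι.onFormula φ).Realize (Sum.elim v fun _ => x) := by
    intro N _ v x
    rw [Formula.realize_relabel]
    congr! 1
    ext (i | i) <;> simp
  obtain ⟨σ, hσ⟩ := h.skolem n (BoundedFormula.relabel (Sum.inr : Fin (n + 1) → Empty ⊕ Fin (n + 1)) χ)
  refine ⟨σ, fun I hI N _ a ha v x hx => ?_⟩
  let ψ : Φ.lang.Formula (Fin (n + 1)) := χ.imp (substTerms χ
    (Fin.snoc (fun i => .var i.castSucc) (σ.relabel Fin.castSucc)))
  have hψ : ∀ {N : Type u} [Φ.lang.Structure N] (v : Fin n → N) (x : N),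
      ψ.Realize (Fin.snoc v x : _ → N) ↔ (χ.Realize (Fin.snoc v x : _ → N) →
        χ.Realize (Fin.snoc v (σ.realize v) : _ → N)) := by
    intro N _ v x
    rw [Formula.realize_imp, realize_substTerms]
    congr! 2
    ext i
    refine Fin.lastCases ?_ (fun j => ?_) i
    · simp only [Fin.snoc_last, Term.realize_relabel]
      congr 1
      ext j
      simp
    · simp
  have := (h.inherits I hI N a ha).realize h.skolem ψ (by
    intro y
    rw [← Fin.snoc_init_self y, hψ]
    have := hσ (Fin.init y) (y (Fin.last n))
    rwa [Formula.realize_relabel_sumInr, Formula.realize_relabel_sumInr] at this) (Fin.snoc v x)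
  rw [hψ, hχ, hχ] at this
  exact this hx

theorem ModelledOn.inUpsilon (h : Φ.ModelledOn K J M b) (hK : IsIndexModelClass lt K)
    (hJ : IsSat K J)
    (hb : ∀ s t : J, J.qftp [s] = J.qftp [t] → (b s).length = (b t).length)
    (hinj : Function.Injective b) (hpos : ∀ t, 1 ≤ (b t).length) : Φ.InUpsilon K := by
  have hnon : ∀ I ∈ K, ∀ (N : Type u) [Φ.lang.Structure N] (a : I → List N), Φ.IsGEM I N a →
      (∀ t, 1 ≤ (a t).length) ∧ Function.Injective a := by
    intro I hI N _ a ha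
    refine ⟨fun x => ?_, h.injective hK hJ hb hinj hI ha⟩
    obtain ⟨s, hs⟩ := hK.exists_qftp_eq hI hJ [x]
    obtain ⟨p, rfl⟩ := List.length_eq_one_iff.1 (length_eq_of_qftp_eq hs)
    rw [h.length_eq hb hI ha hs]
    exact hpos p
  have helem : ∀ I ∈ K, ∀ I' ∈ K, ∀ e : IndexModel.Embedding I I',
      ∀ (N : Type u) [Φ.lang.Structure N] (a : I → List N), Φ.IsGEM I N a →
      ∀ (N' : Type u) [Φ.lang.Structure N'] (a' : I' → List N'), Φ.IsGEM I' N' a' →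
        ∃ g : N ↪ₑ[Φ.lang] N', ∀ t, (a t).map g = a' (e.toFun t) := by
    intro I hI I' hI' e N _ a ha N' _ a' ha'
    have hflat : ∀ t : List I, t.flatMap (fun t => a' (e.toFun t)) = (t.map e.toFun).flatMap a' :=
      fun t => by rw [List.flatMap_map]
    refine exists_elementaryEmbedding_of_skeleton a (fun t => a' (e.toFun t)) ha.generates ?_ ?_
    · intro t
      simpa using ha.length_flatMap ha' (e.qftp_map [t]).symm
    · intro t n v w hv hw φ
      rw [hflat] at hw
      exact h.realize_iff hI hI' ha ha' (e.qftp_map t).symm hv hw φ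
  refine ⟨h.proper, hnon, ⟨?_, fun φ => ?_⟩, ?_, helem, ?_, h.hasSkolem _⟩
  · obtain ⟨N, _, a, ha⟩ := h.proper J hJ.mem
    obtain ⟨y⟩ := hK.nonempty J hJ.mem
    have : Nonempty N := ⟨(a y)[0]'((hnon J hJ.mem N a ha).1 y)⟩
    have : N ⊨ Φ.theory K := (Theory.model_iff _).2 fun φ hφ => hφ J hJ.mem N a ha
    exact Theory.Model.isSatisfiable N
  · by_cases hφ : M ⊨ φ
    · exact Or.inl (Theory.models_sentence_of_mem (h.realize_sentence hφ))
    · exact Or.inr (Theory.models_sentence_of_mem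
        (h.realize_sentence ((Sentence.realize_not M).2 hφ)))
  · intro I hI N _ a ha s t hst
    obtain ⟨v, hv⟩ := exists_ofFn (l := s.flatMap a) rfl
    obtain ⟨w, hw⟩ := exists_ofFn (l := t.flatMap a) (ha.length_flatMap ha hst).symm
    rw [hv, hw, tpOver_empty_ofFn_eq_iff]
    exact fun φ => h.realize_iff hI hI ha ha hst hv hw φ
  · rintro I hI I' hI' ⟨e, he⟩ N _ a ha N' _ a' ha'
    obtain ⟨g, hg⟩ := helem I hI I' hI' e N a ha N' a' ha'
    have hsurj : Function.Surjective g := by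
      intro y
      have hy : y ∈ Substructure.closure Φ.lang {x : N' | ∃ t, x ∈ a' t} := by
        rw [ha'.generates]; trivial
      have hle : Substructure.closure Φ.lang {x : N' | ∃ t, x ∈ a' t} ≤
          Substructure.map g.toHom ⊤ := by
        rw [Substructure.closure_le]
        rintro x ⟨t, ht⟩
        obtain ⟨s, rfl⟩ := he t
        rw [← hg, List.mem_map] at ht
        obtain ⟨z, -, rfl⟩ := ht
        exact ⟨z, trivial, rfl⟩
      obtain ⟨z, -, hz⟩ := hle hy
      exact ⟨z, hz⟩
    exact ⟨⟨Equiv.ofBijective g ⟨g.injective, hsurj⟩, fun f x => g.map_fun f x,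
      fun R x => g.map_rel R x⟩⟩

end Template

end GemModels

/-! ### Larger templates from expansions of elementary extensions -/

namespace GemModels

open IndexModel

namespace Template

variable {τ : FirstOrder.Language.{u, u}} {K : Set (IndexModel τ)} {lt : τ.Relations 2}

theorem nonempty_of_skeleton {I : IndexModel τ} (hI : Nonempty I) {N : Type u} {a : I → List N}
    (hpos : ∀ t, 1 ≤ (a t).length) : Nonempty N :=
  let ⟨y⟩ := hI
  ⟨(a y)[0]'(hpos y)⟩

theorem length_flatMap_eq {J : IndexModel τ} {M : Type u} {b : J → List M}
    (hb : ∀ s t : J, J.qftp [s] = J.qftp [t] → (b s).length = (b t).length) {s t : List J}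
    (h : J.qftp s = J.qftp t) : (s.flatMap b).length = (t.flatMap b).length := by
  induction s generalizing t with
  | nil => obtain rfl : t = [] := List.length_eq_zero_iff.1 (length_eq_of_qftp_eq h).symm; rfl
  | cons x s ih =>
    have : Nonempty J := ⟨x⟩
    cases t with
    | nil => exact absurd (length_eq_of_qftp_eq h) (by simp)
    | cons y t =>
      have h₁ := qftp_append_left (s := [x]) (s' := [y]) (t := s) (t' := t) h rfl
      have h₂ := qftp_append_right (s := [x]) (s' := [y]) (t := s) (t' := t) h rfl
      simp only [List.flatMap_cons, List.length_append, hb x y h₁, ih h₂]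

/-- The Ramsey property, with Skolem functions added. The positions of the entries of a concatenated
sequence serve as variables. -/
theorem exists_inUpsilon (hK : IsIndexModelClass lt K) {J : IndexModel τ} (hJ : IsSat K J)
    (L : FirstOrder.Language.{u, u}) (M : Type u) [L.Structure M] [Nonempty M] (b : J → List M)
    (hb : ∀ s t : J, J.qftp [s] = J.qftp [t] → (b s).length = (b t).length)
    (hinj : Function.Injective b) (hpos : ∀ t, 1 ≤ (b t).length) :
    ∃ (Φ : Template τ) (κ : L →ᴸ Φ.lang), κ.Injective ∧ Φ.lang.card ≤ L.card + ℵ₀ ∧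
      Φ.InUpsilon K ∧
      (∀ (L₀ : FirstOrder.Language.{u, u}) (ι : L₀ →ᴸ Φ.lang), Φ.HasSkolem K ι) ∧
      ∀ I ∈ K, ∀ (N : Type u) [Φ.lang.Structure N] (a : I → List N), Φ.IsGEM I N a →
        ∀ (t : List I) (s : List J), J.qftp s = I.qftp t →
        (t.flatMap a).length = (s.flatMap b).length ∧
        ∀ (α : Type u) (idx : α → ℕ) (φ : L.Formula α),
          (∀ s', J.qftp s' = J.qftp s →
            ∃ v : α → M, (∀ x, (s'.flatMap b)[idx x]? = some (v x)) ∧ φ.Realize v) →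
          ∃ w : α → N, (∀ x, (t.flatMap a)[idx x]? = some (w x)) ∧ (κ.onFormula φ).Realize w := by
  obtain ⟨L', κ, _, hκ, hexp, hcard, hsk⟩ := exists_skolemization L M
  obtain ⟨tp, hΦ⟩ := exists_modelledOn hK hJ L' M b hb hsk
  refine ⟨⟨L', tp⟩, κ, hκ, hcard, hΦ.inUpsilon hK hJ hb hinj hpos, fun _ ι => hΦ.hasSkolem ι, ?_⟩
  intro I hI N _ a ha t s hst
  have htr := hΦ.transfer I hI N a ha t s hst
  constructor
  · obtain ⟨w, hw, -⟩ := htr (s.flatMap b).length ⊤ (fun s' hs' => by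
      obtain ⟨v, hv⟩ := exists_ofFn (length_flatMap_eq hb hs')
      exact ⟨v, hv, Formula.realize_top.2 trivial⟩)
    rw [hw, List.length_ofFn]
  · intro α idx φ h
    have hidx : ∀ x, idx x < (s.flatMap b).length := by
      intro x
      obtain ⟨v, hv, -⟩ := h s rfl
      exact (List.getElem?_eq_some_iff.1 (hv x)).1
    obtain ⟨w, hw, hφw⟩ := htr _ ((κ.onFormula φ).relabel fun x => ⟨idx x, hidx x⟩) (by
      intro s' hs'
      obtain ⟨v, hv, hφv⟩ := h s' hs'
      obtain ⟨v', hv'⟩ := exists_ofFn (length_flatMap_eq hb hs')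
      refine ⟨v', hv', ?_⟩
      rw [Formula.realize_relabel, LHom.realize_onFormula]
      convert hφv using 1
      ext x
      have := hv x
      rw [hv', List.getElem?_ofFn, dif_pos (hidx x)] at this
      exact Option.some_injective _ this)
    rw [Formula.realize_relabel] at hφw
    refine ⟨_, fun x => ?_, hφw⟩
    rw [hw, List.getElem?_ofFn, dif_pos (hidx x)]
    rfl

/-- Full indiscernibility across different index models: both sequences are compared inside
`GEM(J, Φ)` for a saturated `J`. -/
theorem InUpsilon.realize_iff {Φ : Template τ} (h : Φ.InUpsilon K) (hK : IsIndexModelClass lt K)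
    {I J : IndexModel τ} (hI : I ∈ K) (hJ : IsSat K J) {N N' : Type u} [Φ.lang.Structure N]
    [Φ.lang.Structure N'] {a : I → List N} {a' : J → List N'} (ha : Φ.IsGEM I N a)
    (ha' : Φ.IsGEM J N' a') {t : List I} {s : List J} (hts : I.qftp t = J.qftp s) {n : ℕ}
    {v : Fin n → N} {w : Fin n → N'} (hv : t.flatMap a = List.ofFn v)
    (hw : s.flatMap a' = List.ofFn w) (φ : Φ.lang.Formula (Fin n)) :
    φ.Realize v ↔ φ.Realize w := by
  obtain ⟨A, hA, e, r, rfl, hemb⟩ := hK.exists_small hI t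
  obtain ⟨e'⟩ := hemb J hJ
  obtain ⟨N₀, _, a₀, ha₀⟩ := h.proper A hA
  obtain ⟨g, hg⟩ := h.elementary A hA I hI e N₀ a₀ ha₀ N a ha
  obtain ⟨g', hg'⟩ := h.elementary A hA J hJ.mem e' N₀ a₀ ha₀ N' a' ha'
  have h₁ : (r.flatMap a₀).map g = (r.map e.toFun).flatMap a := by
    rw [List.map_flatMap, List.flatMap_map]; simp only [hg]
  have h₂ : (r.flatMap a₀).map g' = (r.map e'.toFun).flatMap a' := by
    rw [List.map_flatMap, List.flatMap_map]; simp only [hg']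
  obtain ⟨u, hu⟩ := exists_ofFn (l := r.flatMap a₀) (n := n) (by
    rw [← List.length_map (f := g), h₁, hv, List.length_ofFn])
  rw [hu, List.map_ofFn] at h₁ h₂
  obtain rfl : g ∘ u = v := List.ofFn_injective (h₁.trans hv)
  have h₃ := h.indiscernible J hJ.mem N' a' ha' (r.map e'.toFun) s
    ((e'.qftp_map r).trans ((e.qftp_map r).symm.trans hts))
  rw [← h₂, hw, tpOver_empty_ofFn_eq_iff] at h₃
  rw [g.map_formula, ← h₃ φ, g'.map_formula]

theorem IsGEM.length_eq {Φ : Template τ} {J : IndexModel τ}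
    {N : Type u} [Φ.lang.Structure N] {a : J → List N} (ha : Φ.IsGEM J N a) (s t : J)
    (hst : J.qftp [s] = J.qftp [t]) : (a s).length = (a t).length := by
  simpa using ha.length_flatMap ha hst

/-- A template obtained from an expansion of an elementary extension of `GEM(J, Φ)`, with the same
skeleton, is larger than `Φ`. -/
theorem InUpsilon.exists_le {Φ : Template τ} (h : Φ.InUpsilon K) (hK : IsIndexModelClass lt K)
    {J : IndexModel τ} (hJ : IsSat K J) {M₀ : Type u} [Φ.lang.Structure M₀] {a₀ : J → List M₀}
    (ha₀ : Φ.IsGEM J M₀ a₀) {M : Type u} [Φ.lang.Structure M] (g₀ : M₀ ↪ₑ[Φ.lang] M)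
    {L : FirstOrder.Language.{u, u}} [L.Structure M] (ν : Φ.lang →ᴸ L) (hν : ν.Injective)
    [ν.IsExpansionOn M] :
    ∃ (Φ' : Template τ) (κ : L →ᴸ Φ'.lang), Φ'.lang.card ≤ L.card + ℵ₀ ∧
      Φ'.InUpsilon K ∧ Φ.Le K Φ' (κ.comp ν) ∧
      (∀ (L₀ : FirstOrder.Language.{u, u}) (ι : L₀ →ᴸ Φ'.lang), Φ'.HasSkolem K ι) ∧
      ∀ I ∈ K, ∀ (N : Type u) [Φ'.lang.Structure N] (a : I → List N), Φ'.IsGEM I N a →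
        ∀ (t : List I) (s : List J), J.qftp s = I.qftp t →
        ∀ (α : Type u) (idx : α → ℕ) (φ : L.Formula α),
          (∀ s', J.qftp s' = J.qftp s →
            ∃ v : α → M, (∀ x, (s'.flatMap fun t => (a₀ t).map g₀)[idx x]? = some (v x)) ∧
              φ.Realize v) →
          ∃ w : α → N, (∀ x, (t.flatMap a)[idx x]? = some (w x)) ∧ (κ.onFormula φ).Realize w := by
  have hpos := (h.nontrivial J hJ.mem M₀ a₀ ha₀).1
  have hinj := (h.nontrivial J hJ.mem M₀ a₀ ha₀).2
  have : Nonempty M₀ := nonempty_of_skeleton (hK.nonempty J hJ.mem) hpos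
  have : Nonempty M := ⟨g₀ (Classical.arbitrary M₀)⟩
  obtain ⟨Φ', κ, hκ, hcard, hΥ, hsk, htr⟩ := exists_inUpsilon hK hJ L M (fun t => (a₀ t).map g₀)
    (fun s t hst => by simpa using ha₀.length_eq s t hst)
    (fun s t hst => hinj (List.map_injective_iff.2 g₀.injective hst)) (fun t => by simpa using hpos t)
  refine ⟨Φ', κ, hcard, hΥ, ⟨⟨?_, ?_⟩, ?_⟩, hsk,
    fun I hI N _ a ha t s hst => (htr I hI N a ha t s hst).2⟩
  · exact fun {n} => hκ.onFunction.comp hν.onFunction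
  · exact fun {n} => hκ.onRelation.comp hν.onRelation
  intro I hI N _ a ha N' _ a' ha'
  let : L.Structure N' := κ.reduct N'
  let : Φ.lang.Structure N' := ν.reduct N'
  have hb : ∀ s : List J, (s.flatMap fun t => (a₀ t).map g₀) = (s.flatMap a₀).map g₀ :=
    fun s => by rw [List.map_flatMap]
  obtain ⟨g, hg⟩ := exists_elementaryEmbedding_of_skeleton (L := Φ.lang) a a' ha.generates
    (by
      intro x
      obtain ⟨s, hs⟩ := hK.exists_qftp_eq hI hJ [x]
      have h₁ := ha.length_flatMap ha₀ hs.symm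
      have h₂ := (htr I hI N' a' ha' [x] s hs).1
      rw [hb, List.length_map, ← h₁] at h₂
      simpa using h₂.symm)
    (by
      intro t n v w hv hw φ
      obtain ⟨s, hs⟩ := hK.exists_qftp_eq hI hJ t
      have key : ∀ φ : Φ.lang.Formula (Fin n), φ.Realize v → φ.Realize w := by
        intro φ hφ
        obtain ⟨w', hw', hφw'⟩ := (htr I hI N' a' ha' t s hs).2 (ULift (Fin n)) (fun x => x.down)
          ((ν.onFormula φ).relabel ULift.up) (by
            intro s' hs'
            have hts' : I.qftp t = J.qftp s' := (hs'.trans hs).symm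
            obtain ⟨v', hv'⟩ := exists_ofFn (l := s'.flatMap a₀) (n := n) (by
              rw [← ha.length_flatMap ha₀ hts', hv, List.length_ofFn])
            refine ⟨fun x => g₀ (v' x.down), fun x => ?_, ?_⟩
            · rw [hb, hv', List.map_ofFn, List.getElem?_ofFn, dif_pos x.down.2]
              rfl
            · rw [Formula.realize_relabel, LHom.realize_onFormula]
              have := (h.realize_iff hK hI hJ ha ha₀ hts' hv hv' φ).1 hφ
              exact (g₀.map_formula φ v').2 this)
        rw [LHom.realize_onFormula, Formula.realize_relabel, LHom.realize_onFormula] at hφw'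
        convert hφw' using 1
        ext i
        have := hw' ⟨i⟩
        rw [hw, List.getElem?_ofFn, dif_pos i.2] at this
        exact Option.some_injective _ this
      refine ⟨key φ, fun hφ => ?_⟩
      by_contra hn
      exact key φ.not hn hφ)
  refine ⟨g, hg, fun n φ v => ?_⟩
  have hexp : (κ.comp ν).IsExpansionOn N' := ⟨fun _ _ => rfl, fun _ _ => rfl⟩
  rw [LHom.realize_onFormula]
  exact g.map_formula φ v

theorem InUpsilonOf.of_le {Φ Φ' : Template τ} {L : FirstOrder.Language.{u, u}} {ι : L →ᴸ Φ.lang}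
    {T : L.Theory} (h : Φ.InUpsilonOf K ι T) {j : Φ.lang →ᴸ Φ'.lang} (hle : Φ.Le K Φ' j)
    (h' : Φ'.InUpsilon K) (hsk : Φ'.HasSkolem K (j.comp ι)) : Φ'.InUpsilonOf K (j.comp ι) T where
  inUpsilon := h'
  injective := ⟨fun {_} => hle.injective.onFunction.comp h.injective.onFunction,
    fun {_} => hle.injective.onRelation.comp h.injective.onRelation⟩
  skolem := hsk
  theory_le := by
    intro φ hφ I hI N' _ a' ha'
    obtain ⟨N, _, a, ha⟩ := h.inUpsilon.proper I hI
    have h₁ : N ⊨ ι.onSentence φ := h.theory_le φ hφ I hI N a ha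
    obtain ⟨g, -, hg⟩ := hle.elementary I hI N a ha N' a' ha'
    let : Φ.lang.Structure N' := j.reduct N'
    have h₂ := hg 0 ((ι.onSentence φ).relabel (Empty.elim : Empty → Fin 0)) Fin.elim0
    have hexp : (j.comp ι).onSentence φ = j.onSentence (ι.onSentence φ) := by
      simp only [LHom.onSentence, LHom.onFormula, LHom.comp_onBoundedFormula, Function.comp_apply]
    rw [hexp, LHom.realize_onSentence]
    rw [LHom.realize_onFormula, Formula.realize_relabel, Formula.realize_relabel] at h₂
    rw [Sentence.Realize, ← Subsingleton.elim ((g ∘ Fin.elim0) ∘ (Empty.elim : Empty → Fin 0)) default, h₂,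
      Subsingleton.elim (Fin.elim0 ∘ (Empty.elim : Empty → Fin 0)) default]
    exact h₁

end Template

end GemModels

/-! ### Shearing, transported to a fixed saturated index model -/

namespace GemModels

open IndexModel

section Lists

theorem flatten_ofFn_ofFn {X : Type*} {k l : ℕ} (v : Fin k → Fin l → X) :
    (List.ofFn fun i => List.ofFn (v i)).flatten =
      List.ofFn fun p : Fin (k * l) => v (finProdFinEquiv.symm p).1 (finProdFinEquiv.symm p).2 := by
  rw [List.ofFn_mul]
  congr 2
  funext i
  congr 1
  funext j
  have : (⟨i * l + j, by
      calc (i : ℕ) * l + j < (i + 1) * l := by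
            rw [Nat.add_mul, Nat.one_mul]; exact Nat.add_lt_add_left j.2 _
        _ ≤ k * l := Nat.mul_le_mul_right _ i.2⟩ : Fin (k * l)) = finProdFinEquiv (i, j) := by
    ext; simp [finProdFinEquiv, add_comm, mul_comm]
  rw [this, Equiv.symm_apply_apply]

theorem eq_of_flatten_ofFn_eq {X : Type*} {k : ℕ} {r r' : Fin k → List X}
    (h : (List.ofFn r).flatten = (List.ofFn r').flatten)
    (hlen : ∀ i, (r i).length = (r' i).length) : r = r' := by
  apply List.ofFn_injective
  apply List.eq_iff_flatten_eq.2 ⟨h, ?_⟩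
  rw [List.map_ofFn, List.map_ofFn]
  congr 1
  exact funext hlen

end Lists

section Reindex

variable {τ : FirstOrder.Language.{u, u}} {I J : IndexModel τ}

open Classical in
/-- If `S` enumerates a set containing the entries of `t`, and `r` is a sequence of the length of `S`,
then `reindex S t r` is the sequence obtained from `t` by replacing each entry of `S` by the
corresponding entry of `r`. (Shearing refers to arbitrary enumerations of the two finite sets; this
translates them into the given ones.) -/
noncomputable def reindex [Nonempty J] (S t : List I) (r : List J) : List J :=
  t.map fun x => r.getD (S.idxOf x) (Classical.arbitrary J)

theorem length_reindex [Nonempty J] (S t : List I) (r : List J) :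
    (reindex S t r).length = t.length := by simp [reindex]

theorem reindex_map [Nonempty J] {S t : List I} (h : t ⊆ S) (θ : I → J) :
    reindex S t (S.map θ) = t.map θ := by
  classical
  refine List.map_congr_left fun x hx => ?_
  have hlt : S.idxOf x < S.length := List.idxOf_lt_length_of_mem (h hx)
  rw [List.getD_eq_getElem _ _ (by simpa using hlt), List.getElem_map, List.getElem_idxOf]

theorem map_reindex [Nonempty J] {S t : List I} (h : t ⊆ S) {J' : IndexModel τ} [Nonempty J']
    (r : List J) (hr : r.length = S.length) (θ : J → J') :
    (reindex S t r).map θ = reindex S t (r.map θ) := by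
  classical
  unfold reindex
  rw [List.map_map]
  refine List.map_congr_left fun x hx => ?_
  have hlt : S.idxOf x < r.length := hr ▸ List.idxOf_lt_length_of_mem (h hx)
  rw [Function.comp_apply, List.getD_eq_getElem _ _ hlt,
    List.getD_eq_getElem _ _ (by simpa using hlt), List.getElem_map]

theorem reindex_subset [Nonempty J] {S t : List I} (h : t ⊆ S) (r : List J)
    (hr : r.length = S.length) : reindex S t r ⊆ r := by
  classical
  intro y hy
  obtain ⟨x, hx, rfl⟩ := List.mem_map.1 hy
  have hlt : S.idxOf x < r.length := hr ▸ List.idxOf_lt_length_of_mem (h hx)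
  rw [List.getD_eq_getElem _ _ hlt]
  exact List.getElem_mem _

/-- Reindexing respects equality of quantifier-free types over a fixed sequence. -/
theorem sameQF_reindex [Nonempty J] {S₀ s : List J} (hs : s ⊆ S₀) {S t : List I} (ht : t ⊆ S) {k : ℕ}
    {r r' : Fin k → List J} (hr : ∀ i, (r i).length = S.length) (hr' : ∀ i, (r' i).length = S.length)
    (h : J.qftp (S₀ ++ (List.ofFn r).flatten) = J.qftp (S₀ ++ (List.ofFn r').flatten)) :
    J.SameQF s (List.ofFn fun i => reindex S t (r i)).flatten
      (List.ofFn fun i => reindex S t (r' i)).flatten := by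
  obtain ⟨θ, hθ, hθ'⟩ := exists_map_of_qftp_eq h
  rw [List.map_append] at hθ
  obtain ⟨h₁, h₂⟩ := List.append_inj hθ (by simp)
  rw [List.map_flatten, List.map_ofFn] at h₂
  have h₃ := eq_of_flatten_ofFn_eq h₂ (fun i => by simp [hr, hr'])
  have hfix : s.map θ = s := by
    have : ∀ x ∈ S₀, θ x = x := fun x hx => by
      have := List.map_inj_left.1 (h₁.trans (List.map_id S₀).symm) x hx
      exact this
    conv_rhs => rw [← List.map_id s]
    exact List.map_congr_left fun x hx => this x (hs hx)
  have h₄ : (List.ofFn fun i => reindex S t (r i)).flatten.map θ =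
      (List.ofFn fun i => reindex S t (r' i)).flatten := by
    rw [List.map_flatten, List.map_ofFn]
    congr 2
    funext i
    rw [Function.comp_apply, map_reindex ht _ (hr i), ← congrFun h₃ i]
    rfl
  rw [SameQF, ← h₄]
  conv_rhs => rw [← hfix, ← List.map_append]
  refine (hθ' _ fun x hx => ?_).symm
  rw [List.mem_append] at hx ⊢
  refine hx.imp (fun h => hs h) fun h => ?_
  rw [List.mem_flatten] at h ⊢
  obtain ⟨l, hl, hx⟩ := h
  rw [List.mem_ofFn] at hl
  obtain ⟨i, rfl⟩ := hl
  exact ⟨r i, by simp, reindex_subset ht _ (hr i) hx⟩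

end Reindex

end GemModels


/-! ### Finite configurations witnessing shearing -/

namespace GemModels

open IndexModel

section Inconsistent

variable {L : FirstOrder.Language.{u, u}}

/-- The formula saying that the instances `φ(x, y_i)` have no common solution `x`. -/
noncomputable def inconsistentFormula {m l : ℕ} (φ : L.Formula (Fin m ⊕ Fin l)) (k : ℕ) :
    L.Formula (Fin k × Fin l) :=
  (Formula.iExs (Fin m) (Formula.iInf fun i : Fin k =>
    φ.relabel (Sum.elim Sum.inr fun j => Sum.inl (i, j)))).not

theorem realize_inconsistentFormula {m l : ℕ} (φ : L.Formula (Fin m ⊕ Fin l)) (k : ℕ) {N : Type u}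
    [L.Structure N] (y : Fin k × Fin l → N) : (inconsistentFormula φ k).Realize y ↔
      ¬ ∃ x : Fin m → N, ∀ i, φ.Realize (Sum.elim x fun j => y (i, j)) := by
  rw [inconsistentFormula, Formula.realize_not, Formula.realize_iExs, not_iff_not]
  refine exists_congr fun x => ?_
  rw [Formula.realize_iInf]
  refine forall_congr' fun i => ?_
  rw [Formula.realize_relabel]
  congr! 1
  ext (j | j) <;> rfl

end Inconsistent

/-- A shearing formula has, in any `ℵ₀`-saturated index model, a finite configuration `W` of sequences
of the type of `S₁` over `S₀` which is contradictory in the following sense: for every finite set of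
sequences of this type over some `t` of the type of `S₀` there are parameters, of the same type over
`A` as the given ones, for which all copies of the configuration are inconsistent. -/
theorem Shears.exists_configuration.{w} {c : Context.{u}} {L : FirstOrder.Language.{u, u}} {M : Type u}
    [L.Structure M] {A : Set M} {m : ℕ} {f : ParamFormula L m M} {I₀ I₁ : Set c.I}
    (h : Shears c A f I₀ I₁) {S₀ S₁ : List c.I} (hS₀ : {x | x ∈ S₀} = I₀) (hS₁ : {x | x ∈ S₁} = I₁)
    {J : IndexModel c.τ} (hJ : IsSat c.K J) (e : IndexModel.Embedding c.I J) :
    ∃ (k : ℕ) (W : Fin k → List J),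
      (∀ i, J.qftp (S₀.map e.toFun ++ W i) = J.qftp (S₀.map e.toFun ++ S₁.map e.toFun)) ∧
      ∀ (t : List J) (R : List (List J)), J.qftp t = J.qftp (S₀.map e.toFun) →
        (∀ r ∈ R, J.qftp (t ++ r) = J.qftp (S₀.map e.toFun ++ S₁.map e.toFun)) →
        ∃ (N : Type u) (_ : L.Structure N) (g : M ↪ₑ[L] N) (b : List J → Fin f.len → N),
          (∀ r ∈ R, ∀ (β : Type w) (φ : L.Formula (Fin f.len ⊕ β)) (d : β → M), (∀ x, d x ∈ A) →
            (φ.Realize (Sum.elim (b r) (g ∘ d)) ↔ φ.Realize (Sum.elim f.param d))) ∧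
          ∀ q : Fin k → List J, (∀ i, q i ∈ R) →
            J.qftp (t ++ (List.ofFn q).flatten) =
              J.qftp (S₀.map e.toFun ++ (List.ofFn W).flatten) →
            (inconsistentFormula f.formula k).Realize fun p => b (q p.1) p.2 := by
  classical
  obtain ⟨hI, -, N, _, g, s, t₁, J₁, e₁, b, hs, ht₁, hJ₁, hind, hbt, hincon⟩ := h
  have hK := c.isIndexModelClass
  have : Nonempty J := hK.nonempty J hJ.mem
  have : Nonempty J₁ := hK.nonempty J₁ hJ₁.mem
  have hsS : s ⊆ S₀ := fun x hx => by
    have : x ∈ {x | x ∈ S₀} := by rw [hS₀, ← hs]; exact hx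
    exact this
  have hSs : S₀ ⊆ s := fun x hx => by
    have : x ∈ {x | x ∈ s} := by rw [hs, ← hS₀]; exact hx
    exact this
  have htS : t₁ ⊆ S₁ := fun x hx => by
    have : x ∈ {x | x ∈ S₁} := by rw [hS₁, ← ht₁]; exact hx
    exact this
  have hSt : S₁ ⊆ t₁ := fun x hx => by
    have : x ∈ {x | x ∈ t₁} := by rw [ht₁, ← hS₁]; exact hx
    exact this
  -- a finite inconsistent family of instances
  obtain ⟨k, t', d', ht', hd', hno⟩ : ∃ (k : ℕ) (t' : Fin k → List J₁) (d' : Fin k → Fin f.len → N),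
      (∀ i, J₁.SameQF (s.map e₁.toFun) (t' i) (t₁.map e₁.toFun)) ∧
      (∀ i, b (t' i) = List.ofFn (d' i)) ∧
      ¬ ∃ x : Fin m → N, ∀ i, f.formula.Realize (Sum.elim x (d' i)) := by
    unfold Consistent at hincon
    push Not at hincon
    obtain ⟨p₀, hp₀, hfin, hno⟩ := hincon
    have := hfin.fintype
    choose t' d' h₁ h₂ h₃ using fun h : p₀ => hp₀ h.2
    let en := Fintype.equivFin p₀
    refine ⟨Fintype.card p₀, fun i => t' (en.symm i), fun i => d' (en.symm i), fun i => h₁ _,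
      fun i => h₂ _, ?_⟩
    rintro ⟨x, hx⟩
    obtain ⟨h, hh, hn⟩ := hno x
    apply hn
    have := hx (en ⟨h, hh⟩)
    simp only [Equiv.symm_apply_apply] at this
    have h₄ := h₃ ⟨h, hh⟩
    dsimp only at h₄
    rw [h₄]
    exact this
  -- the configuration in the index model of the shearing, as sequences indexed by `S₁`
  choose θ hθ hθ' using fun i => exists_map_of_qftp_eq (ht' i).symm
  have hθs : ∀ i, ∀ x ∈ s, θ i (e₁.toFun x) = e₁.toFun x := by
    intro i x hx
    have h₁ := hθ i
    rw [List.map_append] at h₁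
    obtain ⟨h₂, -⟩ := List.append_inj h₁ (by simp)
    rw [List.map_map] at h₂
    exact List.map_inj_left.1 h₂ x hx
  have hθt : ∀ i, (t₁.map e₁.toFun).map (θ i) = t' i := by
    intro i
    have h₁ := hθ i
    rw [List.map_append] at h₁
    exact (List.append_inj h₁ (by simp)).2
  let W₁ : Fin k → List J₁ := fun i => S₁.map fun x => θ i (e₁.toFun x)
  have hW₁len : ∀ i, (W₁ i).length = S₁.length := fun i => by simp [W₁]
  have hW₁t : ∀ i, reindex S₁ t₁ (W₁ i) = t' i := by
    intro i
    rw [reindex_map htS, ← hθt, List.map_map]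
    rfl
  have hW₁q : ∀ i, J₁.qftp (S₀.map e₁.toFun ++ W₁ i) =
      J₁.qftp (S₀.map e₁.toFun ++ S₁.map e₁.toFun) := by
    intro i
    have h₁ : S₀.map e₁.toFun ++ W₁ i = (S₀.map e₁.toFun ++ S₁.map e₁.toFun).map (θ i) := by
      rw [List.map_append, List.map_map, List.map_map]
      congr 1
      exact List.map_congr_left fun x hx => (hθs i x (hSs hx)).symm
    rw [h₁]
    refine hθ' i _ fun x hx => ?_
    rw [List.mem_append] at hx ⊢
    exact hx.imp (fun h => List.map_subset _ hSs h) fun h => List.map_subset _ hSt h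
  -- transport it to `J`
  have hS₀q : J₁.qftp (S₀.map e₁.toFun) = J.qftp (S₀.map e.toFun) :=
    (e₁.qftp_map _).trans (e.qftp_map _).symm
  have hS₁q : J₁.qftp (S₀.map e₁.toFun ++ S₁.map e₁.toFun) =
      J.qftp (S₀.map e.toFun ++ S₁.map e.toFun) := by
    rw [← List.map_append, ← List.map_append]
    exact (e₁.qftp_map _).trans (e.qftp_map _).symm
  obtain ⟨w, hw⟩ := hK.exists_append_eq hJ₁.mem hJ hS₀q (List.ofFn W₁).flatten
  obtain ⟨η, hη, hη'⟩ := exists_map_of_qftp_eq hw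
  rw [List.map_append] at hη
  obtain ⟨hη₀, hη₁⟩ := List.append_inj hη (by simp)
  rw [List.map_flatten, List.map_ofFn] at hη₁
  refine ⟨k, fun i => (W₁ i).map η, fun i => ?_, fun t R ht hR => ?_⟩
  · rw [← hη₀, ← List.map_append, hη', hW₁q i, hη₀, ← hS₁q]
    intro x hx
    rw [List.mem_append] at hx ⊢
    refine hx.imp_right fun h => List.mem_flatten.2 ⟨W₁ i, by simp, h⟩
  have hWq : J.qftp (S₀.map e.toFun ++ (List.ofFn fun i => (W₁ i).map η).flatten) =
      J₁.qftp (S₀.map e₁.toFun ++ (List.ofFn W₁).flatten) := by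
    rw [hw, ← hη₁]; rfl
  obtain ⟨r₁, hr₁⟩ := hK.exists_append_eq hJ.mem hJ₁ (ht.trans hS₀q.symm) R.flatten
  obtain ⟨ζ, hζ, hζ'⟩ := exists_map_of_qftp_eq hr₁
  rw [List.map_append] at hζ
  obtain ⟨hζ₀, -⟩ := List.append_inj hζ (by simpa using length_eq_of_qftp_eq ht)
  have hζR : ∀ r : List J, (∀ x ∈ r, ∃ q ∈ R, x ∈ q) →
      J₁.qftp (S₀.map e₁.toFun ++ r.map ζ) = J.qftp (t ++ r) := by
    intro r hr
    rw [← hζ₀, ← List.map_append]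
    refine hζ' _ fun x hx => ?_
    rw [List.mem_append] at hx ⊢
    refine hx.imp_right fun h => ?_
    obtain ⟨q, hq, hx⟩ := hr x h
    exact List.mem_flatten.2 ⟨q, hq, hx⟩
  have hlen : ∀ r ∈ R, (r.map ζ).length = S₁.length := by
    intro r hr
    have h₁ := length_eq_of_qftp_eq (hR r hr)
    have h₂ := length_eq_of_qftp_eq ht
    simp only [List.length_append, List.length_map] at h₁ h₂ ⊢
    omega
  have hsub : s.map e₁.toFun ⊆ S₀.map e₁.toFun := List.map_subset _ hsS
  -- all the new parameters have the type of the given ones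
  have htp : ∀ r ∈ R, tpOver L (g '' A) (b (reindex S₁ t₁ (r.map ζ))) =
      tpOver L (g '' A) (List.ofFn (g ∘ f.param)) := by
    intro r hr
    have h₁ := sameQF_reindex hsub htS (k := 1) (r := fun _ => r.map ζ)
      (r' := fun _ => S₁.map e₁.toFun) (fun _ => hlen r hr) (fun _ => by simp) (by
        simp only [List.ofFn_succ, List.ofFn_zero, List.flatten_cons, List.flatten_nil,
          List.append_nil]
        rw [hζR r fun x hx => ⟨r, hr, hx⟩, hR r hr, hS₁q])
    simp only [List.ofFn_succ, List.ofFn_zero, List.flatten_cons, List.flatten_nil, List.append_nil,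
      reindex_map htS] at h₁
    have h₂ := hind [reindex S₁ t₁ (r.map ζ)] [t₁.map e₁.toFun] (by simp [length_reindex])
      (by simpa using h₁)
    simpa [hbt] using h₂
  have hex : ∀ r, ∃ v : Fin f.len → N, r ∈ R → b (reindex S₁ t₁ (r.map ζ)) = List.ofFn v := by
    intro r
    by_cases hr : r ∈ R
    · have := congrArg Sigma.fst (htp r hr)
      obtain ⟨v, hv⟩ := exists_ofFn (this.trans List.length_ofFn)
      exact ⟨v, fun _ => hv⟩
    · exact ⟨g ∘ f.param, fun h => absurd h hr⟩
  choose v hv using hex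
  refine ⟨N, inferInstance, g, v, fun r hr β φ d hd => ?_, fun q hq hqW => ?_⟩
  · have h₁ := htp r hr
    rw [hv r hr] at h₁
    rw [realize_iff_of_tpOver_eq h₁ φ (g ∘ d) fun x => ⟨d x, hd x, rfl⟩, ← Sum.comp_elim,
      g.map_formula]
  · have h₁ := sameQF_reindex hsub htS (r := fun i => (q i).map ζ) (r' := W₁)
      (fun i => hlen _ (hq i)) hW₁len (by
        have h₂ := hζR (List.ofFn q).flatten (by
          intro x hx
          obtain ⟨l, hl, hx⟩ := List.mem_flatten.1 hx
          rw [List.mem_ofFn] at hl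
          obtain ⟨i, rfl⟩ := hl
          exact ⟨q i, hq i, hx⟩)
        rw [List.map_flatten, List.map_ofFn] at h₂
        exact h₂.trans (hqW.trans hWq))
    simp only [hW₁t] at h₁
    have h₂ := hind _ _ (by
      rw [List.map_ofFn, List.map_ofFn]
      congr 1
      funext i
      simp only [Function.comp_apply, length_reindex]
      rw [← hW₁t i, length_reindex]) h₁
    have h₃ : ∀ (x : Fin k → List J₁) (y : Fin k → Fin f.len → N), (∀ i, b (x i) = List.ofFn (y i)) →
        (List.ofFn x).flatMap b = List.ofFn fun p : Fin (k * f.len) =>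
          y (finProdFinEquiv.symm p).1 (finProdFinEquiv.symm p).2 := by
      intro x y hxy
      rw [← flatten_ofFn_ofFn, List.flatMap_def, List.map_ofFn]
      congr 2
      exact funext hxy
    rw [h₃ _ _ fun i => hv _ (hq i), h₃ _ _ hd'] at h₂
    have h₄ := realize_iff_of_tpOver_eq h₂ (β := PEmpty.{u + 1})
      ((inconsistentFormula f.formula k).relabel fun p => Sum.inl (finProdFinEquiv p))
      PEmpty.elim (fun x => x.elim)
    rw [Formula.realize_relabel, Formula.realize_relabel] at h₄
    simp only [Function.comp_def, Sum.elim_inl, Equiv.symm_apply_apply] at h₄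
    rw [h₄, realize_inconsistentFormula]
    exact hno

end GemModels

/-! ### Trees of parameters -/

namespace GemModels

open IndexModel

section Prefix

variable {τ : FirstOrder.Language.{u, u}} {J : IndexModel τ} [Nonempty J] {S S' : List J}

theorem take_eq_of_qftp_append (hS : S <+: S') {t r : List J} (ht : t.length = S.length)
    (h : J.qftp (t ++ r) = J.qftp (S ++ S')) : r.take S.length = t := by
  obtain ⟨θ, hθ, -⟩ := exists_map_of_qftp_eq h.symm
  rw [List.map_append] at hθ
  obtain ⟨h₁, h₂⟩ := List.append_inj hθ (by simpa using ht.symm)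
  rw [← h₂, ← List.map_take, ← List.prefix_iff_eq_take.1 hS, h₁]

theorem qftp_take_append (hS : S <+: S') {r : List J} (h : J.qftp r = J.qftp S') :
    J.qftp (r.take S.length ++ r) = J.qftp (S ++ S') := by
  obtain ⟨θ, hθ, hθ'⟩ := exists_map_of_qftp_eq h.symm
  rw [← hθ, ← List.map_take, ← List.prefix_iff_eq_take.1 hS, ← List.map_append]
  refine hθ' _ fun x hx => ?_
  rw [List.mem_append] at hx
  exact hx.elim (fun h => hS.subset h) id

end Prefix

/-- The data extracted from a witness of unsuperstability: an increasing sequence of finite sequences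
`S n` of a saturated index model, formulas `f n` whose parameters are listed by `par (n, ·)` (among
further parameters), and for each `n` a configuration `W n` of sequences of the type of `S (n + 1)` over
`S n` along which `f n` is contradictory, over the parameters of the previous levels. -/
structure ShearingSequence {τ : FirstOrder.Language.{u, u}} (J : IndexModel τ)
    (L : FirstOrder.Language.{u, u}) (M : Type u) [L.Structure M] (m : ℕ) where
  S : ℕ → List J
  isPrefix : ∀ n, S n <+: S (n + 1)
  f : ℕ → ParamFormula L m M
  par : ℕ × ℕ → M
  par_eq : ∀ n (j : Fin (f n).len), par (n, j) = (f n).param j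
  k : ℕ → ℕ
  W : ∀ n, Fin (k n) → List J
  W_qftp : ∀ n i, J.qftp (S n ++ W n i) = J.qftp (S n ++ S (n + 1))
  configuration : ∀ (n : ℕ) (t : List J) (R : List (List J)), J.qftp t = J.qftp (S n) →
    (∀ r ∈ R, J.qftp (t ++ r) = J.qftp (S n ++ S (n + 1))) →
    ∃ (N : Type u) (_ : L.Structure N) (g : M ↪ₑ[L] N) (b : List J → Fin (f n).len → N),
      (∀ r ∈ R, ∀ φ : L.Formula (Fin (f n).len ⊕ {p : ℕ × ℕ // p.1 < n}),
        φ.Realize (Sum.elim (b r) fun p => g (par p)) ↔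
          φ.Realize (Sum.elim (f n).param fun p => par p)) ∧
      ∀ q : Fin (k n) → List J, (∀ i, q i ∈ R) →
        J.qftp (t ++ (List.ofFn q).flatten) = J.qftp (S n ++ (List.ofFn (W n)).flatten) →
        (inconsistentFormula (f n).formula (k n)).Realize fun p => b (q p.1) p.2

namespace ShearingSequence

variable {τ : FirstOrder.Language.{u, u}} {J : IndexModel τ} {L : FirstOrder.Language.{u, u}}
  {M : Type u} [L.Structure M] {m : ℕ} (D : ShearingSequence J L M m)

/-- Variables for the parameters: `(t, n, j)` stands for the copy of `par (n, j)` attached to the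
sequence `t`, which should have the type of `S (n + 1)`. -/
abbrev Var (J : IndexModel τ) : Type u := List J × ℕ × ℕ

/-- The variable for the copy of the parameter `p` along the branch `t`. -/
def branch (t : List J) (p : ℕ × ℕ) : Var J := (t.take (D.S (p.1 + 1)).length, p)

/-- The sequences in `q` form, over `t`, a copy of the configuration of level `n`. -/
structure IsCopy (n : ℕ) (t : List J) (q : Fin (D.k n) → List J) : Prop where
  base : J.qftp t = J.qftp (D.S n)
  child : ∀ i, J.qftp (t ++ q i) = J.qftp (D.S n ++ D.S (n + 1))
  all : J.qftp (t ++ (List.ofFn q).flatten) = J.qftp (D.S n ++ (List.ofFn (D.W n)).flatten)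

variable {L₁ : FirstOrder.Language.{u, u}} (ι : L →ᴸ L₁)

/-- Along every branch of length `n` the parameters of levels below `n` have the type of the given ones.
(One implication suffices, by passing to negations.) -/
def TypesUpTo {N : Type u} [L₁.Structure N] (F : Var J → N) (n : ℕ) : Prop :=
  ∀ t, J.qftp t = J.qftp (D.S n) → ∀ ψ : L.Formula {p : ℕ × ℕ // p.1 < n},
    (ψ.Realize fun p => D.par p) → (ι.onFormula ψ).Realize fun p => F (D.branch t p)

/-- Over every node of level `n`, each copy of the configuration makes `f n` inconsistent. -/
def Inconsistent {N : Type u} [L₁.Structure N] (F : Var J → N) (n : ℕ) : Prop :=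
  ∀ t q, D.IsCopy n t q →
    (ι.onFormula (inconsistentFormula (D.f n).formula (D.k n))).Realize fun p => F (q p.1, n, p.2)

/-- The variable standing for a parameter of level at most `n` over a child `r` of a node of level
`n`. -/
def split (n : ℕ) (r : List J) (p : {p : ℕ × ℕ // p.1 < n + 1}) :
    {p : ℕ × ℕ // p.1 < n} ⊕ Var J :=
  if h : p.1.1 < n then .inl ⟨p.1, h⟩ else .inr (r, p.1)

/-- The requirements on the parameters attached to the children in `R` of the node `t` of level `n`,
relative to the parameters along `t`. -/
def nodeFormulas (n : ℕ) (t : List J) (R : Set (List J)) :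
    Set (L.Formula ({p : ℕ × ℕ // p.1 < n} ⊕ Var J)) :=
  {φ | (∃ r ∈ R, J.qftp (t ++ r) = J.qftp (D.S n ++ D.S (n + 1)) ∧
      ∃ ψ : L.Formula {p : ℕ × ℕ // p.1 < n + 1}, (ψ.Realize fun p => D.par p) ∧
        φ = ψ.relabel (split n r)) ∨
    ∃ q, (∀ i, q i ∈ R) ∧ D.IsCopy n t q ∧ φ = (inconsistentFormula (D.f n).formula (D.k n)).relabel
      fun p => Sum.inr (q p.1, n, (p.2 : ℕ))}

theorem realize_split {n : ℕ} {r : List J} {N : Type u} [L.Structure N]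
    (ψ : L.Formula {p : ℕ × ℕ // p.1 < n + 1}) (u : {p : ℕ × ℕ // p.1 < n} → N) (w : Var J → N) :
    (ψ.relabel (split n r)).Realize (Sum.elim u w) ↔
      ψ.Realize fun p => if h : p.1.1 < n then u ⟨p.1, h⟩ else w (r, p.1) := by
  rw [Formula.realize_relabel]
  congr! 1
  ext p
  simp only [split, Function.comp_apply]
  split_ifs <;> rfl

/-- Finitely many requirements at one node can be met over an elementary copy of the given parameters,
namely in the structure given by the configuration. Parameters of level `n` other than those of
`f n` do not occur there; those needed are found because the type is the right one. -/
theorem exists_realize_node {n : ℕ} {t : List J} (ht : J.qftp t = J.qftp (D.S n))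
    (R : List (List J)) (hR : ∀ r ∈ R, J.qftp (t ++ r) = J.qftp (D.S n ++ D.S (n + 1)))
    {D₀ : Set (L.Formula ({p : ℕ × ℕ // p.1 < n} ⊕ Var J))}
    (hD₀ : D₀ ⊆ D.nodeFormulas n t {r | r ∈ R}) (hfin : D₀.Finite) :
    ∃ (N : Type u) (_ : L.Structure N) (g : M ↪ₑ[L] N) (w : Var J → N),
      ∀ φ ∈ D₀, φ.Realize (Sum.elim (fun p => g (D.par p)) w) := by
  classical
  obtain ⟨N, _, g, b, hb, hinc⟩ := D.configuration n t R ht hR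
  have hN : Nonempty N := ⟨g (D.par (0, 0))⟩
  have := hfin.to_subtype
  have hcase : ∀ φ : D₀, ∃ o : Option (List J × L.Formula {p : ℕ × ℕ // p.1 < n + 1}),
      (∀ x, o = some x → x.1 ∈ R ∧ (x.2.Realize fun p => D.par p) ∧ φ.1 = x.2.relabel (split n x.1)) ∧
      (o = none → ∃ q, (∀ i, q i ∈ R) ∧ D.IsCopy n t q ∧
        φ.1 = (inconsistentFormula (D.f n).formula (D.k n)).relabel
          fun p => Sum.inr (q p.1, n, (p.2 : ℕ))) := by
    rintro ⟨φ, hφ⟩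
    rcases hD₀ hφ with ⟨r, hr, -, ψ, hψ, h⟩ | h
    · refine ⟨some (r, ψ), ?_, by simp⟩
      rintro x hx
      obtain rfl := Option.some_injective _ hx
      exact ⟨hr, hψ, h⟩
    · exact ⟨none, by simp, fun _ => h⟩
  choose o ho₁ ho₂ using hcase
  -- the remaining parameters of each child
  have hext : ∀ r, ∃ e : ℕ → N, r ∈ R → (∀ j : Fin (D.f n).len, e j = b r j) ∧
      ∀ φ ψ, o φ = some (r, ψ) →
        ψ.Realize fun p => if p.1.1 < n then g (D.par p.1) else e p.1.2 := by
    intro r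
    by_cases hr : r ∈ R
    swap
    · exact ⟨fun _ => Classical.arbitrary N, fun h => absurd h hr⟩
    let ρ : {p : ℕ × ℕ // p.1 < n + 1} → (Fin (D.f n).len ⊕ {p : ℕ × ℕ // p.1 < n}) ⊕ ℕ := fun p =>
      if h : p.1.1 < n then .inl (.inr ⟨p.1, h⟩)
      else if h : p.1.2 < (D.f n).len then .inl (.inl ⟨p.1.2, h⟩) else .inr p.1.2
    let E : Set (L.Formula ((Fin (D.f n).len ⊕ {p : ℕ × ℕ // p.1 < n}) ⊕ ℕ)) :=
      {χ | ∃ φ ψ, o φ = some (r, ψ) ∧ χ = ψ.relabel ρ}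
    have hE : E.Finite := by
      refine (Set.finite_range fun φ : D₀ => ((o φ).map fun x => x.2.relabel ρ).getD ⊥).subset ?_
      rintro χ ⟨φ, ψ, h, rfl⟩
      exact ⟨φ, by simp [h]⟩
    have hreal : ∀ χ ∈ E,
        χ.Realize (Sum.elim (Sum.elim (D.f n).param fun p => D.par p) fun j => D.par (n, j)) := by
      rintro χ ⟨φ, ψ, h, rfl⟩
      rw [Formula.realize_relabel]
      convert (ho₁ φ _ h).2.1 using 1
      ext ⟨⟨i, j⟩, hij⟩
      simp only [ρ, Function.comp_apply]
      split_ifs with h₁ h₂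
      · rfl
      · obtain rfl : i = n := by simp only at hij h₁; omega
        exact (D.par_eq _ ⟨j, h₂⟩).symm
      · obtain rfl : i = n := by simp only at hij h₁; omega
        rfl
    obtain ⟨e, he⟩ := exists_extension_of_finite (N₁ := M) (N₂ := N)
      (u := Sum.elim (D.f n).param fun p : {p : ℕ × ℕ // p.1 < n} => D.par p)
      (u' := Sum.elim (b r) fun p => g (D.par p)) (fun φ h => (hb r hr φ).2 h) hE hreal
    refine ⟨fun j => if h : j < (D.f n).len then b r ⟨j, h⟩ else e j, fun _ => ⟨fun j => by simp, ?_⟩⟩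
    intro φ ψ h
    have := he _ ⟨φ, ψ, h, rfl⟩
    rw [Formula.realize_relabel] at this
    convert this using 1
    ext ⟨⟨i, j⟩, hij⟩
    simp only [ρ, Function.comp_apply]
    split_ifs with h₁ h₂ <;> rfl
  choose e he using hext
  refine ⟨N, inferInstance, g, fun v => e v.1 v.2.2, fun φ hφ => ?_⟩
  rcases ho : o ⟨φ, hφ⟩ with _ | ⟨r, ψ⟩
  · obtain ⟨q, hq, hcopy, h⟩ := ho₂ _ ho
    rw [show φ = _ from h, Formula.realize_relabel]
    convert hinc q hq hcopy.all using 1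
    ext p
    exact (he _ (hq _)).1 _
  · obtain ⟨hr, -, h⟩ := ho₁ _ _ ho
    rw [show φ = _ from h, realize_split]
    exact (he r hr).2 _ ψ ho

theorem nodeFormulas_mono {n : ℕ} {t : List J} {R R' : Set (List J)} (h : R ⊆ R') :
    D.nodeFormulas n t R ⊆ D.nodeFormulas n t R' := by
  rintro φ (⟨r, hr, h'⟩ | ⟨q, hq, h'⟩)
  · exact Or.inl ⟨r, h hr, h'⟩
  · exact Or.inr ⟨q, fun i => h (hq i), h'⟩

/-- Finitely many requirements at a node concern finitely many of its children. -/
theorem exists_finite_children {n : ℕ} {t : List J}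
    {D₀ : Set (L.Formula ({p : ℕ × ℕ // p.1 < n} ⊕ Var J))}
    (hD₀ : D₀ ⊆ D.nodeFormulas n t Set.univ) (hfin : D₀.Finite) :
    ∃ R : List (List J), (∀ r ∈ R, J.qftp (t ++ r) = J.qftp (D.S n ++ D.S (n + 1))) ∧
      D₀ ⊆ D.nodeFormulas n t {r | r ∈ R} := by
  induction D₀, hfin using Set.Finite.induction_on with
  | empty => exact ⟨[], by simp, Set.empty_subset _⟩
  | @insert φ D₀ _ _ ih =>
    obtain ⟨R, hR, hsub⟩ := ih ((Set.subset_insert _ _).trans hD₀)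
    obtain ⟨R', hR', hφ⟩ : ∃ R' : List (List J),
        (∀ r ∈ R', J.qftp (t ++ r) = J.qftp (D.S n ++ D.S (n + 1))) ∧
          φ ∈ D.nodeFormulas n t {r | r ∈ R'} := by
      rcases hD₀ (Set.mem_insert _ _) with ⟨r, -, hr, h⟩ | ⟨q, -, hq, h⟩
      · exact ⟨[r], by simpa using hr, Or.inl ⟨r, by simp, hr, h⟩⟩
      · exact ⟨List.ofFn q, by simpa [List.mem_ofFn] using hq.child,
          Or.inr ⟨q, fun i => by simp, hq, h⟩⟩
    refine ⟨R' ++ R, fun r hr => ?_, Set.insert_subset ?_ ?_⟩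
    · exact (List.mem_append.1 hr).elim (hR' r) (hR r)
    · exact D.nodeFormulas_mono (fun r hr => List.mem_append_left _ hr) hφ
    · exact hsub.trans (D.nodeFormulas_mono fun r hr => List.mem_append_right _ hr)

variable {D ι}

theorem TypesUpTo.map {N N' : Type u} [L₁.Structure N] [L₁.Structure N'] {F : Var J → N} {n : ℕ}
    (h : D.TypesUpTo ι F n) (g : N ↪ₑ[L₁] N') {F' : Var J → N'}
    (hF' : ∀ v : Var J, v.2.1 < n → F' v = g (F v)) : D.TypesUpTo ι F' n := by
  intro t ht ψ hψ
  have := (g.map_formula _ _).2 (h t ht ψ hψ)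
  convert this using 1
  ext p
  exact hF' _ p.2

theorem Inconsistent.map {N N' : Type u} [L₁.Structure N] [L₁.Structure N'] {F : Var J → N} {n : ℕ}
    (h : D.Inconsistent ι F n) (g : N ↪ₑ[L₁] N') {F' : Var J → N'}
    (hF' : ∀ v : Var J, v.2.1 = n → F' v = g (F v)) : D.Inconsistent ι F' n := by
  intro t q hq
  have := (g.map_formula _ _).2 (h t q hq)
  convert this using 1
  ext p
  exact hF' _ rfl

/-- The parameters of level `n` can be added in an elementary extension. The variables are tagged by
the node `t` to which they belong, so that the requirements at distinct nodes are independent. -/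
theorem exists_step [Nonempty J] {N : Type u} [L₁.Structure N] {F : Var J → N} {n : ℕ}
    (h : D.TypesUpTo ι F n) :
    ∃ (N' : Type u) (_ : L₁.Structure N') (g : N ↪ₑ[L₁] N') (F' : Var J → N'),
      (∀ v : Var J, v.2.1 < n → F' v = g (F v)) ∧ D.TypesUpTo ι F' (n + 1) ∧
        D.Inconsistent ι F' n := by
  have hN : Nonempty N := ⟨F ([], 0, 0)⟩
  let tag : ∀ t : List J, ({p : ℕ × ℕ // p.1 < n} ⊕ Var J) → (N ⊕ (List J × Var J)) := fun t =>
    Sum.map (fun p => F (D.branch t p)) fun v => (t, v)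
  let Γ : Set (L₁.Formula (N ⊕ (List J × Var J))) :=
    {χ | ∃ t, J.qftp t = J.qftp (D.S n) ∧ ∃ φ ∈ D.nodeFormulas n t Set.univ,
      χ = (ι.onFormula φ).relabel (tag t)}
  have htag : ∀ {N' : Type u} [L₁.Structure N'] (g : N → N') (w : List J × Var J → N') (t : List J)
      (φ : L.Formula ({p : ℕ × ℕ // p.1 < n} ⊕ Var J)),
      ((ι.onFormula φ).relabel (tag t)).Realize (Sum.elim g w) ↔ (ι.onFormula φ).Realize
        (Sum.elim (fun p => g (F (D.branch t p))) fun v => w (t, v)) := by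
    intro N' _ g w t φ
    rw [Formula.realize_relabel]
    congr! 1
    ext (p | v) <;> rfl
  obtain ⟨N', _, g, w, hw⟩ := exists_elementary_realization N Γ (by
    intro S₀ hS₀ hfin
    have := hfin.to_subtype
    choose t ht φ hφ hχ using fun χ : S₀ => hS₀ χ.2
    have hnode : ∀ t', ∃ w : Var J → N, ∀ χ, t χ = t' →
        (ι.onFormula (φ χ)).Realize (Sum.elim (fun p => F (D.branch t' p)) w) := by
      intro t'
      by_cases ht' : J.qftp t' = J.qftp (D.S n)
      swap
      · exact ⟨fun _ => Classical.arbitrary N, fun χ h => absurd (h ▸ ht χ) ht'⟩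
      have hfin' : (φ '' {χ | t χ = t'}).Finite := Set.toFinite _
      obtain ⟨R, hR, hsub⟩ := D.exists_finite_children (t := t') (by
        rintro _ ⟨χ, rfl, rfl⟩
        exact hφ χ) hfin'
      obtain ⟨N₁, _, g, w₁, hw₁⟩ := D.exists_realize_node ht' R hR hsub hfin'
      let := ι.reduct N
      obtain ⟨w, hw⟩ := exists_extension_of_finite (N₂ := N) (u := fun p => g (D.par p.1))
        (u' := fun p => F (D.branch t' p.1)) (fun ψ hψ => by
          have := h t' ht' ψ ((g.map_formula ψ _).1 hψ)
          rwa [LHom.realize_onFormula] at this) hfin' hw₁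
      refine ⟨w, fun χ hχ => ?_⟩
      rw [LHom.realize_onFormula]
      exact hw _ ⟨χ, hχ, rfl⟩
    choose w hw using hnode
    refine ⟨N, inferInstance, ElementaryEmbedding.refl L₁ N, fun v => w v.1 v.2, fun χ hχ' => ?_⟩
    rw [show χ = _ from hχ ⟨χ, hχ'⟩, htag]
    exact hw _ ⟨χ, hχ'⟩ rfl)
  refine ⟨N', inferInstance, g, fun v => if v.2.1 < n then g (F v) else
    w (v.1.take (D.S n).length, v), fun v hv => if_pos hv, ?_, ?_⟩
  · intro r hr ψ hψ
    have ht := qftp_take_append (D.isPrefix n) hr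
    have hlt : (r.take (D.S n).length).length = (D.S n).length := by
      have := length_eq_of_qftp_eq ht
      have := length_eq_of_qftp_eq hr
      simp only [List.length_append] at *
      omega
    have ht' := qftp_append_left ht hlt
    have hmem := hw _ ⟨_, ht', _, Or.inl ⟨r, trivial, ht, ψ, hψ, rfl⟩, rfl⟩
    rw [htag] at hmem
    let := ι.reduct N'
    rw [LHom.realize_onFormula, realize_split] at hmem
    rw [LHom.realize_onFormula]
    convert hmem using 1
    ext ⟨⟨i, j⟩, hij⟩
    have hrS : r.length = (D.S (n + 1)).length := length_eq_of_qftp_eq hr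
    by_cases h₁ : i < n
    · simp only [branch, h₁, if_true, dif_pos]
      rw [List.take_take, min_eq_left]
      exact (monotone_nat_of_le_succ (f := fun n => (D.S n).length)
        fun n => (D.isPrefix n).length_le) h₁
    · obtain rfl : i = n := by simp only at hij; omega
      simp only [branch, lt_irrefl, if_false, dif_neg, not_false_eq_true]
      rw [← hrS, List.take_length]
  · intro t q hq
    have hmem := hw _ ⟨t, hq.base, _, Or.inr ⟨q, fun _ => trivial, hq, rfl⟩, rfl⟩
    rw [htag] at hmem
    let := ι.reduct N'
    rw [LHom.realize_onFormula, Formula.realize_relabel] at hmem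
    rw [LHom.realize_onFormula]
    convert hmem using 1
    ext ⟨i, j⟩
    simp only [lt_irrefl, if_false, Function.comp_apply, Sum.elim_inr]
    rw [take_eq_of_qftp_append (D.isPrefix n) (length_eq_of_qftp_eq hq.base) (hq.child i)]

/-- The requirement of level `0` concerns only the theory. -/
theorem typesUpTo_zero {N : Type u} [L₁.Structure N] (F : Var J → N)
    (h : ∀ φ : L.Sentence, M ⊨ φ → N ⊨ ι.onSentence φ) : D.TypesUpTo ι F 0 := by
  intro t _ ψ hψ
  have key := h (ψ.relabel fun p => absurd p.2 (Nat.not_lt_zero _)) (by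
    rw [Sentence.Realize, Formula.realize_relabel]
    convert hψ using 1
    ext p
    exact absurd p.2 (Nat.not_lt_zero _))
  let := ι.reduct N
  rw [LHom.realize_onSentence, Sentence.Realize, Formula.realize_relabel] at key
  rw [LHom.realize_onFormula]
  convert key using 1
  ext p
  exact absurd p.2 (Nat.not_lt_zero _)

theorem exists_upTo [Nonempty J] {N : Type u} [L₁.Structure N] [Nonempty N]
    (h : ∀ φ : L.Sentence, M ⊨ φ → N ⊨ ι.onSentence φ) (n : ℕ) :
    ∃ (N' : Type u) (_ : L₁.Structure N') (_ : N ↪ₑ[L₁] N') (F : Var J → N'),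
      (∀ i ≤ n, D.TypesUpTo ι F i) ∧ ∀ i < n, D.Inconsistent ι F i := by
  induction n with
  | zero =>
    refine ⟨N, inferInstance, ElementaryEmbedding.refl L₁ N, fun _ => Classical.arbitrary N, ?_, ?_⟩
    · intro i hi
      obtain rfl := Nat.le_zero.1 hi
      exact typesUpTo_zero _ h
    · exact fun i hi => absurd hi (Nat.not_lt_zero _)
  | succ n ih =>
    obtain ⟨N₁, _, g₁, F₁, h₁, h₁'⟩ := ih
    obtain ⟨N₂, _, g₂, F₂, hF, h₂, h₂'⟩ := exists_step (h₁ n le_rfl)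
    refine ⟨N₂, inferInstance, g₂.comp g₁, F₂, fun i hi => ?_, fun i hi => ?_⟩
    · rcases Nat.le_succ_iff.1 hi with hi | rfl
      · exact (h₁ i hi).map g₂ fun v hv => hF v (hv.trans_le hi)
      · exact h₂
    · rcases Nat.lt_succ_iff_lt_or_eq.1 hi with hi | rfl
      · exact (h₁' i hi).map g₂ fun v hv => hF v (hv.trans_lt hi)
      · exact h₂'

/-- A tree of parameters, in an elementary extension of a model of the theory of `M`: along each branch
they have the type of the given ones, and the copies of each configuration are inconsistent. -/
theorem exists_tree [Nonempty J] {N : Type u} [L₁.Structure N] [Nonempty N]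
    (h : ∀ φ : L.Sentence, M ⊨ φ → N ⊨ ι.onSentence φ) :
    ∃ (N' : Type u) (_ : L₁.Structure N') (_ : N ↪ₑ[L₁] N') (F : Var J → N'),
      (∀ n, D.TypesUpTo ι F n) ∧ ∀ n, D.Inconsistent ι F n := by
  let Γ : ℕ → Set (L₁.Formula (N ⊕ Var J)) := fun n =>
    {χ | (∃ t, J.qftp t = J.qftp (D.S n) ∧ ∃ ψ : L.Formula {p : ℕ × ℕ // p.1 < n},
      (ψ.Realize fun p => D.par p) ∧
        χ = (ι.onFormula ψ).relabel fun p => Sum.inr (D.branch t p.1)) ∨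
      ∃ t q, D.IsCopy n t q ∧
        χ = (ι.onFormula (inconsistentFormula (D.f n).formula (D.k n))).relabel
          fun p => Sum.inr (q p.1, n, (p.2 : ℕ))}
  obtain ⟨N', _, g, F, hF⟩ := exists_elementary_realization N (⋃ n, Γ n) (by
    intro S₀ hS₀ hfin
    have := hfin.to_subtype
    choose i hi using fun χ : S₀ => Set.mem_iUnion.1 (hS₀ χ.2)
    obtain ⟨b, hb⟩ := (Set.finite_range i).bddAbove
    obtain ⟨N', _, g, F, h₁, h₂⟩ := exists_upTo (D := D) h (b + 1)
    refine ⟨N', inferInstance, g, F, fun χ hχ => ?_⟩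
    have hle : i ⟨χ, hχ⟩ ≤ b := hb ⟨_, rfl⟩
    rcases hi ⟨χ, hχ⟩ with ⟨t, ht, ψ, hψ, h⟩ | ⟨t, q, hq, h⟩
    · rw [show χ = _ from h, Formula.realize_relabel]
      exact h₁ _ (hle.trans b.le_succ) t ht ψ hψ
    · rw [show χ = _ from h, Formula.realize_relabel]
      exact h₂ _ (Nat.lt_succ_of_le hle) t q hq)
  refine ⟨N', inferInstance, g, F, fun n t ht ψ hψ => ?_, fun n t q hq => ?_⟩
  · have := hF _ (Set.mem_iUnion.2 ⟨n, Or.inl ⟨t, ht, ψ, hψ, rfl⟩⟩)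
    rwa [Formula.realize_relabel] at this
  · have := hF _ (Set.mem_iUnion.2 ⟨n, Or.inr ⟨t, q, hq, rfl⟩⟩)
    rwa [Formula.realize_relabel] at this

end ShearingSequence

end GemModels

/-! ### The shearing sequence of a witness of unsuperstability -/

namespace GemModels

open IndexModel

variable {L : FirstOrder.Language.{u, u}} {M : Type u}

/-- One sequence lists all parameters of finitely many formulas, starting with those of `f`. -/
theorem exists_list_params {m : ℕ} {C : Set M} (hC : C.Nonempty) {f : ParamFormula L m M}
    (hf : f.Over C) {p₀ : Set (ParamFormula L m M)} (hfin : p₀.Finite) (hp₀ : ∀ h ∈ p₀, h.Over C) :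
    ∃ l : ℕ → M, (∀ j, l j ∈ C) ∧ (∀ j : Fin f.len, l j = f.param j) ∧
      ∀ h ∈ p₀, ∃ w : Fin h.len → ℕ, h.param = l ∘ w := by
  obtain ⟨y, hy⟩ := hC
  let l₁ : List M := hfin.toFinset.toList.flatMap fun h => List.ofFn h.param
  have hl₁ : ∀ x ∈ l₁, x ∈ C := by
    intro x hx
    obtain ⟨h, hh, hx⟩ := List.mem_flatMap.1 hx
    obtain ⟨i, rfl⟩ := (List.mem_ofFn' _ _).1 hx
    exact hp₀ h (by simpa using hh) i
  refine ⟨fun j => (List.ofFn f.param ++ l₁).getD j y, fun j => ?_, fun j => ?_, fun h hh => ?_⟩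
  · dsimp only
    rcases lt_or_ge j (List.ofFn f.param ++ l₁).length with hj | hj
    · rw [List.getD_eq_getElem _ _ hj]
      rcases List.mem_append.1 (List.getElem_mem hj) with h | h
      · obtain ⟨i, hi⟩ := (List.mem_ofFn' _ _).1 h
        rw [← hi]
        exact hf i
      · exact hl₁ _ h
    · rwa [List.getD_eq_default _ _ hj]
  · dsimp only
    rw [List.getD_eq_getElem _ _ (by simp only [List.length_append, List.length_ofFn]; omega),
      List.getElem_append_left (by simp), List.getElem_ofFn]
  · have : ∀ i, ∃ j, h.param i = (List.ofFn f.param ++ l₁).getD j y := by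
      intro i
      have hmem : h.param i ∈ List.ofFn f.param ++ l₁ :=
        List.mem_append_right _ (List.mem_flatMap.2 ⟨h, by simpa using hh, by simp⟩)
      obtain ⟨j, hj, h⟩ := List.getElem_of_mem hmem
      exact ⟨j, by rw [List.getD_eq_getElem _ _ hj, h]⟩
    choose w hw using this
    exact ⟨w, funext hw⟩

theorem WitnessesUnsuperstable.exists_shearingSequence {c : Context.{u}} [L.Structure M] {m : ℕ}
    {p : Set (ParamFormula L m M)} (h : WitnessesUnsuperstable c M p) {J : IndexModel c.τ}
    (hJ : IsSat c.K J) (e : IndexModel.Embedding c.I J) :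
    ∃ (s : ℕ → List c.I) (D : ShearingSequence J L M m), (∀ n, D.S n = (s n).map e.toFun) ∧
      (∀ t : List c.I, ∃ n, t ⊆ s n) ∧ Consistent p ∧
      ∀ n, ∃ p₀ ⊆ p, p₀.Finite ∧
        (∀ h ∈ p₀, ∃ w : Fin h.len → ℕ, h.param = D.par ∘ fun i => (n, w i)) ∧
        ∀ x, (∀ h ∈ p₀, h.Sat x) → (D.f n).Sat x := by
  obtain ⟨In, s, B, -, hmono, hunion, hs, hpre, hB, hBmono, hp, hT⟩ := h
  choose f hf hp₀ hsh using hT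
  choose p₀ hp₀ hfin himp using hp₀
  choose l hl hlf hlp using fun n => exists_list_params (p₀ := p₀ n) (hB (n + 1)) (hf n) (hfin n)
    fun h hh => (hp₀ n hh).2
  choose k W hW hconf using fun n => (hsh n).exists_configuration (hs n) (hs (n + 1)) hJ e
  refine ⟨s, ⟨fun n => (s n).map e.toFun, fun n => (hpre n).map _, f, fun q => l q.1 q.2,
    fun n j => hlf n j, k, W, hW, fun n t R ht hR => ?_⟩, fun _ => rfl, fun t => ?_, hp.2,
    fun n => ⟨p₀ n, fun h hh => (hp₀ n hh).1, hfin n, fun h hh => hlp n h hh, himp n⟩⟩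
  · obtain ⟨N, _, g, b, hb, hinc⟩ := hconf n t R ht hR
    refine ⟨N, inferInstance, g, b, fun r hr φ => hb r hr _ φ _ fun q => ?_, hinc⟩
    exact hBmono q.2 (hl _ _)
  · have hmem : ∀ x, ∃ n, x ∈ s n := by
      intro x
      have : x ∈ ⋃ n, In n := by rw [hunion]; trivial
      obtain ⟨n, hn⟩ := Set.mem_iUnion.1 this
      rw [← hs n] at hn
      exact ⟨n, hn⟩
    induction t with
    | nil => exact ⟨0, List.nil_subset _⟩
    | cons x t ih =>
      obtain ⟨n, hn⟩ := ih
      obtain ⟨n', hn'⟩ := hmem x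
      have hsub : ∀ {i j}, i ≤ j → s i ⊆ s j := fun {i j} hij y hy => by
        have : y ∈ {y | y ∈ s i} := hy
        rw [hs] at this
        have := hmono hij this
        rwa [← hs] at this
      exact ⟨max n n', List.cons_subset.2
        ⟨hsub (le_max_right _ _) hn', fun y hy => hsub (le_max_left _ _) (hn hy)⟩⟩

end GemModels

/-! ### Functions that send skeletons to parameters -/

namespace GemModels

open IndexModel

section Positions

/-- The entries of `r.flatMap a`, for `r` a sequence of entries of `s`, occur in `s.flatMap a` at
positions which depend only on `s`, `r` and the lengths of the sequences `a x`. -/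
theorem exists_positions {X : Type*} {s r : List X} (hr : r ⊆ s) (len : X → ℕ) :
    ∃ pos : ℕ → ℕ, ∀ {N : Type u} (a : X → List N), (∀ x ∈ s, (a x).length = len x) →
      ∀ i < (r.flatMap a).length, pos i < (s.flatMap a).length ∧
        (r.flatMap a)[i]? = (s.flatMap a)[pos i]? := by
  induction r with
  | nil => exact ⟨id, by simp⟩
  | cons x r ih =>
    obtain ⟨hx, hr⟩ := List.cons_subset.1 hr
    obtain ⟨pos, hpos⟩ := ih hr
    obtain ⟨s₁, s₂, rfl⟩ := List.append_of_mem hx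
    refine ⟨fun i => if i < len x then (s₁.map len).sum + i else pos (i - len x), ?_⟩
    intro N a ha i hi
    have hs₁ : (s₁.flatMap a).length = (s₁.map len).sum := by
      rw [List.length_flatMap]
      congr 1
      exact List.map_congr_left fun y hy => ha y (by simp [hy])
    have hax := ha x hx
    rw [List.flatMap_cons, List.length_append] at hi
    dsimp only
    split_ifs with h
    · constructor
      · simp only [List.flatMap_append, List.flatMap_cons, List.length_append]
        omega
      · rw [List.flatMap_cons, List.getElem?_append_left (by omega), List.flatMap_append,
          List.getElem?_append_right (by omega), List.flatMap_cons,
          List.getElem?_append_left (by omega), hs₁, Nat.add_sub_cancel_left]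
    · obtain ⟨h₁, h₂⟩ := hpos a ha (i - len x) (by omega)
      refine ⟨h₁, ?_⟩
      rw [List.flatMap_cons, List.getElem?_append_right (by omega), hax, h₂]

end Positions

section Value

variable {P : Type} {l : P → ℕ} {L : FirstOrder.Language.{u, u}} {X Y : Type u}

/-- The value of the function symbol `G p` at the skeleton of the sequence `r`. (It is meant for
sequences whose skeleton has length `l p`.) -/
noncomputable def value (G : ∀ p, L.Functions (l p)) {N : Type u} [L.Structure N] [Nonempty N]
    (a : X → List N) (r : List X) (p : P) : N :=
  Structure.funMap (G p) fun i => (r.flatMap a).getD i (Classical.arbitrary N)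

theorem value_eq (G : ∀ p, L.Functions (l p)) {N : Type u} [L.Structure N] [Nonempty N]
    {a : X → List N} {r : List X} {p : P} {v : Fin (l p) → N} (h : r.flatMap a = List.ofFn v) :
    value G a r p = Structure.funMap (G p) v := by
  rw [value, h]
  congr 1
  ext i
  simp

theorem map_value {L' : FirstOrder.Language.{u, u}} (ι : L →ᴸ L') (G : ∀ p, L.Functions (l p))
    {N N' : Type u} [L.Structure N] [L'.Structure N'] [Nonempty N] [Nonempty N'] {g : N → N'}
    (hg : ∀ (n : ℕ) (φ : L.Formula (Fin n)) (v : Fin n → N),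
      (ι.onFormula φ).Realize (g ∘ v) ↔ φ.Realize v)
    {a : X → List N} {a' : Y → List N'} {r : List X} {r' : List Y}
    (h : (r.flatMap a).map g = r'.flatMap a') {p : P} (hp : (r.flatMap a).length = l p) :
    g (value G a r p) = value (fun p => ι.onFunction (G p)) a' r' p := by
  obtain ⟨v, hv⟩ := exists_ofFn hp
  rw [hv, List.map_ofFn] at h
  rw [value_eq G hv, value_eq _ h.symm]
  let := ι.reduct N'
  have := (hg (l p + 1) (((Term.func (G p) fun i => Term.var (Fin.castSucc i)).equal
    (Term.var (Fin.last _)))) (Fin.snoc v (Structure.funMap (G p) v))).2 (by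
      rw [Formula.realize_equal]
      simp)
  rw [LHom.realize_onFormula, Formula.realize_equal] at this
  simp only [Term.realize_func, Term.realize_var, Function.comp_apply, Fin.snoc_castSucc,
    Fin.snoc_last] at this
  exact this.symm

end Value

/-- Statements about the values of function symbols at the skeletons of subsequences of `s` pass from
`M` to `N` when statements about the skeleton of `s` do. -/
theorem realize_value_of_transfer {τ : FirstOrder.Language.{u, u}} {I J : IndexModel τ} [Nonempty J]
    {P : Type} {l : P → ℕ} {L L' : FirstOrder.Language.{u, u}} (κ : L →ᴸ L')
    (G : ∀ p, L.Functions (l p)) {M N : Type u} [L.Structure M] [L'.Structure N] [Nonempty M]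
    [Nonempty N] {b : J → List M} {a : I → List N}
    (hb : ∀ x y : J, J.qftp [x] = J.qftp [y] → (b x).length = (b y).length)
    {s : List J} {θ : J → I} (hlen : ∀ x ∈ s, (a (θ x)).length = (b x).length)
    (htr : ∀ (α : Type u) (idx : α → ℕ) (φ : L.Formula α),
      (∀ s', J.qftp s' = J.qftp s →
        ∃ v : α → M, (∀ x, (s'.flatMap b)[idx x]? = some (v x)) ∧ φ.Realize v) →
      ∃ w : α → N, (∀ x, ((s.map θ).flatMap a)[idx x]? = some (w x)) ∧ (κ.onFormula φ).Realize w)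
    {β : Type*} (φ : L.Formula β) (r : β → List J) (p : β → P) (hr : ∀ x, r x ⊆ s)
    (hl : ∀ x, ((r x).flatMap b).length = l (p x))
    (h : ∀ θ' : J → J, (∀ r ⊆ s, J.qftp (r.map θ') = J.qftp r) →
      φ.Realize fun x => value G b ((r x).map θ') (p x)) :
    (κ.onFormula φ).Realize fun x =>
      value (fun p => κ.onFunction (G p)) a ((r x).map θ) (p x) := by
  choose pos hpos using fun x => exists_positions (hr x) fun y => (b y).length
  have hlt : ∀ x (i : Fin (l (p x))), pos x i < (s.flatMap b).length := fun x i =>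
    (hpos x b (fun _ _ => rfl) i (by rw [hl]; exact i.2)).1
  have hval : ∀ {I' : IndexModel τ} {N' : Type u} (η : J → I') (a' : I' → List N')
      (_ : ∀ x ∈ s, (a' (η x)).length = (b x).length) (v : Fin (s.flatMap b).length → N'),
      (∀ i : Fin (s.flatMap b).length, ((s.map η).flatMap a')[(i : ℕ)]? = some (v i)) →
      ∀ x, ((r x).map η).flatMap a' = List.ofFn fun i : Fin (l (p x)) => v ⟨_, hlt x i⟩ := by
    intro I' N' η a' ha' v hv x
    have hlen' : (((r x).map η).flatMap a').length = l (p x) := by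
      rw [← hl, List.flatMap_map, List.length_flatMap, List.length_flatMap]
      congr 1
      exact List.map_congr_left fun y hy => ha' y (hr x hy)
    apply List.ext_getElem?
    intro i
    rw [List.getElem?_ofFn]
    split_ifs with hi
    · rw [← hv ⟨_, hlt x ⟨i, hi⟩⟩, List.flatMap_map, List.flatMap_map]
      exact (hpos x (fun y => a' (η y)) ha' i (by rwa [← List.flatMap_map, hlen'])).2
    · rw [List.getElem?_eq_none (by omega)]
  let φ' : L.Formula (ULift.{u} (Fin (s.flatMap b).length)) :=
    φ.subst fun x => Term.func (G (p x)) fun i => Term.var ⟨⟨_, hlt x i⟩⟩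
  obtain ⟨w, hw, hφ⟩ := htr _ (fun x => x.down) φ' (by
    intro s' hs'
    obtain ⟨θ', rfl, hθ'⟩ := exists_map_of_qftp_eq hs'.symm
    have hb' : ∀ x ∈ s, (b (θ' x)).length = (b x).length := fun x hx =>
      hb _ _ (hθ' [x] (by simpa using hx))
    have hlen' : ((s.map θ').flatMap b).length = (s.flatMap b).length := by
      rw [List.flatMap_map, List.length_flatMap, List.length_flatMap]
      congr 1
      exact List.map_congr_left hb'
    refine ⟨fun x => ((s.map θ').flatMap b)[(x.down : ℕ)]'(by rw [hlen']; exact x.down.2),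
      fun x => List.getElem?_eq_getElem _, ?_⟩
    refine (BoundedFormula.realize_subst).2 ?_
    have hφ := h θ' fun r hr => hθ' r hr
    rw [funext fun x => value_eq G (hval θ' b hb'
      (fun i => ((s.map θ').flatMap b)[(i : ℕ)]'(by rw [hlen']; exact i.2))
      (fun i => List.getElem?_eq_getElem _) x)] at hφ
    exact hφ)
  let := κ.reduct N
  rw [LHom.realize_onFormula] at hφ ⊢
  have hφ := (BoundedFormula.realize_subst).1 hφ
  rw [funext fun x => value_eq (fun p => κ.onFunction (G p))
    (hval θ a hlen (fun i => w ⟨i⟩) (fun i => hw ⟨i⟩) x)]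
  exact hφ

/-- The language with a function symbol of arity `l p` for each `p`. -/
abbrev paramLanguage (l : ℕ × ℕ → ℕ) : FirstOrder.Language.{u, u} where
  Functions n := ULift {p : ℕ × ℕ // l p = n}
  Relations _ := PEmpty

theorem card_paramLanguage_le (l : ℕ × ℕ → ℕ) : (paramLanguage.{u} l).card ≤ ℵ₀ := by
  rw [Language.card]
  have : Countable (paramLanguage.{u} l).Symbols := by
    unfold Language.Symbols paramLanguage
    infer_instance
  exact Cardinal.mk_le_aleph0

section Tree

variable {τ : FirstOrder.Language.{u, u}} {J : IndexModel τ} {L : FirstOrder.Language.{u, u}}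
  {M : Type u} [L.Structure M] {m : ℕ} (D : ShearingSequence J L M m)

namespace ShearingSequence

theorem isPrefix_of_le {i j : ℕ} (h : i ≤ j) : D.S i <+: D.S j := by
  induction h with
  | refl => exact List.prefix_rfl
  | step _ ih => exact ih.trans (D.isPrefix _)

open Classical in
/-- The function symbol for `p` sends the skeleton of a sequence `t` of the type of `S (p.1 + 1)` to the
parameter `F (t, p)` of the tree (and has a constant value elsewhere). -/
noncomputable abbrev treeStructure {N : Type u} (b : J → List N) (F : Var J → N) (l : ℕ × ℕ → ℕ) :
    (paramLanguage.{u} l).Structure N where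
  funMap f y :=
    if h : ∃ t, J.qftp t = J.qftp (D.S (f.down.1.1 + 1)) ∧ t.flatMap b = List.ofFn y then
      F (h.choose, f.down.1)
    else F ([], 0, 0)
  RelMap r := r.elim

variable {D}

theorem eq_of_flatMap_eq {N : Type u} {b : J → List N}
    (hb : ∀ x y : J, J.qftp [x] = J.qftp [y] → (b x).length = (b y).length)
    (hinj : Function.Injective b) {s t : List J} (hst : J.qftp s = J.qftp t)
    (h : s.flatMap b = t.flatMap b) : s = t := by
  induction s generalizing t with
  | nil => exact (List.length_eq_zero_iff.1 (length_eq_of_qftp_eq hst).symm).symm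
  | cons x s ih =>
    have : Nonempty J := ⟨x⟩
    cases t with
    | nil => exact absurd (length_eq_of_qftp_eq hst) (by simp)
    | cons y t =>
      have h₁ := qftp_append_left (s := [x]) (s' := [y]) (t := s) (t' := t) hst rfl
      have h₂ := qftp_append_right (s := [x]) (s' := [y]) (t := s) (t' := t) hst rfl
      rw [List.flatMap_cons, List.flatMap_cons] at h
      obtain ⟨h₃, h₄⟩ := List.append_inj h (hb x y h₁)
      rw [hinj h₃, ih h₂ h₄]

theorem funMap_treeStructure {N : Type u} {b : J → List N} {F : Var J → N} {l : ℕ × ℕ → ℕ}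
    (hb : ∀ x y : J, J.qftp [x] = J.qftp [y] → (b x).length = (b y).length)
    (hinj : Function.Injective b) {t : List J} {p : ℕ × ℕ} (ht : J.qftp t = J.qftp (D.S (p.1 + 1)))
    {v : Fin (l p) → N} (hv : t.flatMap b = List.ofFn v) :
    (D.treeStructure b F l).funMap (⟨⟨p, rfl⟩⟩ : (paramLanguage.{u} l).Functions (l p)) v =
      F (t, p) := by
  have h : ∃ t, J.qftp t = J.qftp (D.S (p.1 + 1)) ∧ t.flatMap b = List.ofFn v := ⟨t, ht, hv⟩
  refine (dif_pos h).trans ?_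
  congr 2
  exact eq_of_flatMap_eq hb hinj (h.choose_spec.1.trans ht.symm) (h.choose_spec.2.trans hv.symm)

end ShearingSequence

end Tree

end GemModels

/-! ### Templates that carry a tree of parameters -/

namespace GemModels

open IndexModel Template

theorem onFormula_comp {L L' L'' : FirstOrder.Language.{u, u}} (κ : L' →ᴸ L'') (ι : L →ᴸ L')
    {α : Type*} (φ : L.Formula α) : (κ.comp ι).onFormula φ = κ.onFormula (ι.onFormula φ) := by
  simp only [LHom.onFormula, LHom.comp_onBoundedFormula, Function.comp_apply]

variable {τ : FirstOrder.Language.{u, u}} {J : IndexModel τ} {L : FirstOrder.Language.{u, u}}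
  {M : Type u} [L.Structure M] {m : ℕ}

/-- The function symbols `G` of the template `Φ` define, from the skeleton, parameters that behave as
those of a tree for `D`: along a branch they have the type of the given ones, and for the
configuration of each level they make the formula of this level inconsistent. -/
structure ShearingSequence.Carried (D : ShearingSequence J L M m) (K : Set (IndexModel τ))
    (Φ : Template τ) (ι : L →ᴸ Φ.lang) {l : ℕ × ℕ → ℕ} (G : ∀ p, Φ.lang.Functions (l p)) : Prop where
  length_eq : ∀ I ∈ K, ∀ (N : Type u) [Φ.lang.Structure N] (a : I → List N), Φ.IsGEM I N a →
    ∀ (t : List I) (p : ℕ × ℕ), I.qftp t = J.qftp (D.S (p.1 + 1)) → (t.flatMap a).length = l p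
  realize : ∀ I ∈ K, ∀ (N : Type u) [Φ.lang.Structure N] [Nonempty N] (a : I → List N),
    Φ.IsGEM I N a → ∀ (n : ℕ) (θ : J → I), I.qftp ((D.S n).map θ) = J.qftp (D.S n) →
      ∀ ψ : L.Formula {p : ℕ × ℕ // p.1 < n}, (ψ.Realize fun p => D.par p) →
        (ι.onFormula ψ).Realize fun p => value G a ((D.S (p.1.1 + 1)).map θ) p
  inconsistent : ∀ (N : Type u) [Φ.lang.Structure N] [Nonempty N] (a : J → List N),
    Φ.IsGEM J N a → ∀ n,
      (ι.onFormula (inconsistentFormula (D.f n).formula (D.k n))).Realize fun q =>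
        value G a (D.W n q.1) (n, (q.2 : ℕ))

namespace ShearingSequence

variable {D : ShearingSequence J L M m} {K : Set (IndexModel τ)} {lt : τ.Relations 2}

theorem qftp_of_map [Nonempty J] {I : IndexModel τ} {s r : List J} {θ : J → I}
    (h : I.qftp (s.map θ) = J.qftp s) (hr : r ⊆ s) : I.qftp (r.map θ) = J.qftp r := by
  by_cases hI : Nonempty I
  · obtain ⟨η, hη, hη'⟩ := exists_map_of_qftp_eq h.symm
    rw [← hη' r hr]
    congr 1
    exact List.map_congr_left fun x hx => (List.map_inj_left.1 hη x (hr hx)).symm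
  · exact absurd ⟨θ (Classical.arbitrary J)⟩ hI

/-- If `Φ ≤ Ψ`, then `GEM(I, Φ)` embeds in `GEM(I, Ψ)`, elementarily for formulas in any variables. -/
theorem exists_map_of_le {Φ Ψ : Template τ} (hΦ : Φ.InUpsilon K) (hK : IsIndexModelClass lt K)
    {k : Φ.lang →ᴸ Ψ.lang} (hle : Φ.Le K Ψ k) {I : IndexModel τ} (hI : I ∈ K) {N' : Type u}
    [Ψ.lang.Structure N'] {a' : I → List N'} (ha' : Ψ.IsGEM I N' a') :
    ∃ (N : Type u) (_ : Φ.lang.Structure N) (_ : Nonempty N) (a : I → List N) (g : N → N'),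
      Φ.IsGEM I N a ∧ (∀ t : List I, (t.flatMap a).map g = t.flatMap a') ∧
        ∀ (α : Type) (φ : Φ.lang.Formula α) (v : α → N),
          (k.onFormula φ).Realize (g ∘ v) ↔ φ.Realize v := by
  obtain ⟨N, _, a, ha⟩ := hΦ.proper I hI
  obtain ⟨g, hg, hg'⟩ := hle.elementary I hI N a ha N' a' ha'
  refine ⟨N, inferInstance, nonempty_of_skeleton (hK.nonempty I hI) (hΦ.nontrivial I hI N a ha).1,
    a, g, ha, fun t => ?_, fun α φ v => ?_⟩
  · rw [List.map_flatMap]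
    simp only [hg]
  · let := k.reduct N'
    let g' : N ↪ₑ[Φ.lang] N' := ⟨g, fun n φ v => by rw [← hg' n φ v, LHom.realize_onFormula]⟩
    rw [LHom.realize_onFormula]
    exact g'.map_formula φ v

theorem Carried.of_le {Φ Ψ : Template τ} {ι : L →ᴸ Φ.lang} {l : ℕ × ℕ → ℕ}
    {G : ∀ p, Φ.lang.Functions (l p)} (h : D.Carried K Φ ι G) (hJ : IsSat K J)
    (hΦ : Φ.InUpsilon K) (hK : IsIndexModelClass lt K) {k : Φ.lang →ᴸ Ψ.lang} (hle : Φ.Le K Ψ k) :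
    D.Carried K Ψ (k.comp ι) fun p => k.onFunction (G p) := by
  have : Nonempty J := hK.nonempty J hJ.mem
  refine ⟨fun I hI N' _ a' ha' t p ht => ?_, fun I hI N' _ _ a' ha' n θ hθ ψ hψ => ?_,
    fun N' _ _ a' ha' n => ?_⟩
  · obtain ⟨N, _, _, a, g, ha, hg, -⟩ := exists_map_of_le hΦ hK hle hI ha'
    rw [← h.length_eq I hI N a ha t p ht, ← hg, List.length_map]
  · obtain ⟨N, _, _, a, g, ha, hg, hg'⟩ := exists_map_of_le hΦ hK hle hI ha'
    have := (hg' _ _ _).2 (h.realize I hI N a ha n θ hθ ψ hψ)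
    rw [onFormula_comp]
    convert this using 1
    ext p
    refine (map_value k G (fun n => hg' _) (hg _) (h.length_eq I hI N a ha _ _ ?_)).symm
    exact qftp_of_map hθ (D.isPrefix_of_le p.2).subset
  · obtain ⟨N, _, _, a, g, ha, hg, hg'⟩ := exists_map_of_le hΦ hK hle hJ.mem ha'
    have := (hg' _ _ _).2 (h.inconsistent N a ha n)
    rw [onFormula_comp]
    convert this using 1
    ext q
    refine (map_value k G (fun n => hg' _) (hg _) (h.length_eq J hJ.mem N a ha _ _ ?_)).symm
    exact qftp_append_right (D.W_qftp n q.1) rfl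

/-- Some template above a given one carries a tree of parameters: it comes from the expansion of an
elementary extension of `GEM(J, Φ)` by functions sending skeletons to the parameters of a tree. -/
theorem exists_carried (hK : IsIndexModelClass lt K) (hJ : IsSat K J) {Φ : Template τ} {ι : L →ᴸ Φ.lang}
    {T : L.Theory} (hΦ : Φ.InUpsilonOf K ι T) (hT : T.IsComplete) [Nonempty M] [M ⊨ T] :
    ∃ (Φ' : Template τ) (j : Φ.lang →ᴸ Φ'.lang) (l : ℕ × ℕ → ℕ) (G : ∀ p, Φ'.lang.Functions (l p)),
      Φ'.InUpsilonOf K (j.comp ι) T ∧ Φ.Le K Φ' j ∧ Φ'.lang.card ≤ Φ.lang.card + ℵ₀ ∧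
        D.Carried K Φ' (j.comp ι) G := by
  have hJ₀ : Nonempty J := hK.nonempty J hJ.mem
  obtain ⟨M₀, _, a₀, ha₀⟩ := hΦ.inUpsilon.proper J hJ.mem
  have hnt := hΦ.inUpsilon.nontrivial J hJ.mem M₀ a₀ ha₀
  have : Nonempty M₀ := nonempty_of_skeleton hJ₀ hnt.1
  have hTM : ∀ φ : L.Sentence, M ⊨ φ → M₀ ⊨ ι.onSentence φ := by
    intro φ hφ
    let := ι.reduct M₀
    have : M₀ ⊨ T := ⟨fun ψ hψ => by
      rw [← LHom.realize_onSentence M₀ ι]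
      exact hΦ.theory_le ψ hψ J hJ.mem M₀ a₀ ha₀⟩
    rw [LHom.realize_onSentence, hT.realize_sentence_iff φ M₀, ← hT.realize_sentence_iff φ M]
    exact hφ
  obtain ⟨N₁, _, g₀, F, hF, hF'⟩ := D.exists_tree hTM
  have : Nonempty N₁ := ⟨g₀ (Classical.arbitrary M₀)⟩
  let b : J → List N₁ := fun t => (a₀ t).map g₀
  have hblen : ∀ x y : J, J.qftp [x] = J.qftp [y] → (b x).length = (b y).length := fun x y h => by
    simpa [b] using ha₀.length_eq x y h
  have hbinj : Function.Injective b := (List.map_injective_iff.2 g₀.injective).comp hnt.2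
  let l : ℕ × ℕ → ℕ := fun p => ((D.S (p.1 + 1)).flatMap b).length
  let := D.treeStructure b F l
  let ν : Φ.lang →ᴸ Φ.lang.sum (paramLanguage.{u} l) := LHom.sumInl
  obtain ⟨Φ', κ, hcard, hΥ, hle, hsk, htr⟩ :=
    hΦ.inUpsilon.exists_le hK hJ ha₀ g₀ ν LHom.sumInl_injective
  let G₁ : ∀ p, (Φ.lang.sum (paramLanguage.{u} l)).Functions (l p) := fun p => Sum.inr ⟨⟨p, rfl⟩⟩
  have hG₁ : ∀ (t : List J) (p : ℕ × ℕ), J.qftp t = J.qftp (D.S (p.1 + 1)) →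
      value G₁ b t p = F (t, p) := by
    intro t p ht
    obtain ⟨v, hv⟩ := exists_ofFn (n := l p) (length_flatMap_eq hblen ht)
    rw [value_eq G₁ hv]
    exact funMap_treeStructure hblen hbinj ht hv
  have hlen : ∀ I ∈ K, ∀ (N : Type u) [Φ'.lang.Structure N] (a : I → List N), Φ'.IsGEM I N a →
      ∀ (t : List I) (s : List J), I.qftp t = J.qftp s →
        (t.flatMap a).length = (s.flatMap b).length := by
    intro I hI N _ a ha t s hts
    obtain ⟨N₀, _, _, a₁, g, ha₁, hg, -⟩ := exists_map_of_le hΦ.inUpsilon hK hle hI ha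
    rw [← hg, List.length_map, ha₁.length_flatMap ha₀ hts, List.length_flatMap, List.length_flatMap]
    simp [b]
  -- statements about values of the new functions pass to the new template
  have key : ∀ I ∈ K, ∀ (N : Type u) [Φ'.lang.Structure N] [Nonempty N] (a : I → List N),
      Φ'.IsGEM I N a → ∀ (s : List J) (θ : J → I), I.qftp (s.map θ) = J.qftp s →
      ∀ {β : Type} (φ : L.Formula β) (r : β → List J) (p : β → ℕ × ℕ), (∀ x, r x ⊆ s) →
        (∀ x, J.qftp (r x) = J.qftp (D.S ((p x).1 + 1))) →
        (∀ θ' : J → J, (∀ r ⊆ s, J.qftp (r.map θ') = J.qftp r) →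
          (ι.onFormula φ).Realize fun x => F ((r x).map θ', p x)) →
        (((κ.comp ν).comp ι).onFormula φ).Realize
          fun x => value (fun p => κ.onFunction (G₁ p)) a ((r x).map θ) (p x) := by
    intro I hI N _ _ a ha s θ hθ β φ r p hr hrp h
    rw [onFormula_comp, onFormula_comp]
    refine realize_value_of_transfer κ G₁ hblen (s := s) (fun x hx => ?_)
      (fun α idx φ => htr I hI N a ha (s.map θ) s hθ.symm α idx φ) _ r p hr
      (fun x => length_flatMap_eq hblen (hrp x)) fun θ' hθ' => ?_
    · simpa using hlen I hI N a ha [θ x] [x] (qftp_of_map hθ (r := [x]) (by simpa using hx))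
    · rw [LHom.realize_onFormula]
      convert h θ' hθ' using 1
      ext x
      exact hG₁ _ _ ((hθ' _ (hr x)).trans (hrp x))
  refine ⟨Φ', κ.comp ν, l, fun p => κ.onFunction (G₁ p), hΦ.of_le hle hΥ (hsk _ _), hle, ?_,
    fun I hI N _ a ha t p ht => hlen I hI N a ha t _ ht, ?_, ?_⟩
  · refine hcard.trans ?_
    rw [Language.card_sum, Cardinal.lift_id, Cardinal.lift_id, add_assoc]
    gcongr
    calc (paramLanguage.{u} l).card + ℵ₀ ≤ ℵ₀ + ℵ₀ := by gcongr; exact card_paramLanguage_le l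
      _ = ℵ₀ := Cardinal.aleph0_add_aleph0
  · intro I hI N _ _ a ha n θ hθ ψ hψ
    refine key I hI N a ha (D.S n) θ hθ ψ (fun p => D.S (p.1.1 + 1)) (fun p => p.1)
      (fun p => (D.isPrefix_of_le p.2).subset) (fun _ => rfl) fun θ' hθ' => ?_
    convert hF n ((D.S n).map θ') (hθ' _ (List.Subset.refl _)) ψ hψ using 1
    ext p
    rw [branch, ← List.map_take, ← List.prefix_iff_eq_take.1 (D.isPrefix_of_le p.2)]
  · intro N _ _ a ha n
    have hsub : ∀ i, D.W n i ⊆ D.S n ++ (List.ofFn (D.W n)).flatten := fun i x hx =>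
      List.mem_append_right _ (List.mem_flatten.2 ⟨_, List.mem_ofFn.2 ⟨i, rfl⟩, hx⟩)
    have := key J hJ.mem N a ha (D.S n ++ (List.ofFn (D.W n)).flatten) id (by rw [List.map_id])
      (inconsistentFormula (D.f n).formula (D.k n)) (fun q => D.W n q.1) (fun q => (n, (q.2 : ℕ)))
      (fun q => hsub _) (fun q => qftp_append_right (D.W_qftp n q.1) rfl) fun θ' hθ' => by
        refine hF' n ((D.S n).map θ') (fun i => (D.W n i).map θ') ⟨hθ' _ ?_, fun i => ?_, ?_⟩
        · exact List.subset_append_left _ _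
        · rw [← List.map_append, hθ', D.W_qftp]
          exact List.append_subset.2 ⟨List.subset_append_left _ _, hsub i⟩
        · rw [← hθ' _ (List.Subset.refl _), List.map_append, List.map_flatten, List.map_ofFn]
          rfl
    simpa only [List.map_id] using this

end ShearingSequence

end GemModels

/-! ### The omitted type -/

namespace GemModels

open IndexModel Template

/-- A formula mentions parameters of boundedly many levels, so types can be compared level by level. -/
theorem realize_iff_of_realize_bounded {L : FirstOrder.Language.{u, u}} {M N : Type u} [L.Structure M]
    [L.Structure N] {u : ℕ × ℕ → M} {u' : ℕ × ℕ → N}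
    (h : ∀ n, ∀ ψ : L.Formula {p : ℕ × ℕ // p.1 < n}, (ψ.Realize fun p => u p) →
      ψ.Realize fun p => u' p) (ψ : L.Formula (ℕ × ℕ)) : ψ.Realize u ↔ ψ.Realize u' := by
  have key : ∀ ψ : L.Formula (ℕ × ℕ), ψ.Realize u → ψ.Realize u' := by
    intro ψ hψ
    obtain ⟨k, f, χ, -, hχ⟩ := exists_finite_support
      (ψ.relabel (Sum.inr : ℕ × ℕ → Empty ⊕ (ℕ × ℕ)))
    obtain ⟨b, hb⟩ := (Set.finite_range fun i => (f i).1).bddAbove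
    have hfb : ∀ i, (f i).1 < b + 1 := fun i => Nat.lt_succ_of_le (hb ⟨i, rfl⟩)
    have h₁ := h (b + 1) (χ.relabel (Sum.elim Empty.elim fun i => ⟨f i, hfb i⟩))
    have h₂ : ∀ {X : Type u} (v : ℕ × ℕ → X), ((fun p : {p : ℕ × ℕ // p.1 < b + 1} => v p) ∘
        (Sum.elim Empty.elim fun i => ⟨f i, hfb i⟩ : Empty ⊕ Fin k → _)) =
          Sum.elim Empty.elim (v ∘ f) := by
      intro X v
      ext (x | x)
      · exact x.elim
      · rfl
    rw [Formula.realize_relabel, Formula.realize_relabel, h₂, h₂, hχ, hχ, Formula.realize_relabel,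
      Formula.realize_relabel, Sum.elim_comp_inr, Sum.elim_comp_inr] at h₁
    exact h₁ hψ
  refine ⟨key ψ, fun hψ => ?_⟩
  by_contra hn
  exact key ψ.not hn hψ

variable {τ : FirstOrder.Language.{u, u}} {I J : IndexModel τ} {L : FirstOrder.Language.{u, u}}
  {M : Type u} [L.Structure M] {m : ℕ} {D : ShearingSequence J L M m} {K : Set (IndexModel τ)}
  {lt : τ.Relations 2}

/-- In `GEM(I, Ψ)`, with skeleton `a`, no tuple satisfies the formulas of all levels: a solution is a
tuple of terms in the skeleton of some `S n`, and in `GEM(J, Ψ)` the same terms give, by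
indiscernibility over the skeleton of `S n`, a solution of all formulas in the inconsistent
configuration of level `n`. -/
theorem ShearingSequence.Carried.exists_not_realize {Ψ : Template τ} {ι : L →ᴸ Ψ.lang}
    {l : ℕ × ℕ → ℕ} {G : ∀ p, Ψ.lang.Functions (l p)} (h : D.Carried K Ψ ι G)
    (hK : IsIndexModelClass lt K) (hJ : IsSat K J) (hΨ : Ψ.InUpsilon K) (hI : I ∈ K)
    (e : IndexModel.Embedding I J) {s : ℕ → List I} (hs : ∀ n, D.S n = (s n).map e.toFun)
    (hcover : ∀ t : List I, ∃ n, t ⊆ s n) {N : Type u} [Ψ.lang.Structure N] [Nonempty N]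
    {a : I → List N} (ha : Ψ.IsGEM I N a) (x : Fin m → N) :
    ∃ n, ¬ (ι.onFormula (D.f n).formula).Realize
      (Sum.elim x fun j => value G a (s (n + 1)) (n, (j : ℕ))) := by
  have hJ₀ : Nonempty J := hK.nonempty J hJ.mem
  obtain ⟨t₀, ht₀⟩ := exists_terms a ha.generates x
  obtain ⟨n, hn⟩ := hcover t₀
  refine ⟨n, fun hx => ?_⟩
  obtain ⟨len₀, hlen₀⟩ : ∃ k, ((s n).flatMap a).length = k := ⟨_, rfl⟩
  obtain ⟨v, hv⟩ := exists_ofFn hlen₀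
  obtain ⟨σ, hσ⟩ := ht₀ _ hn _ v hv
  obtain ⟨N', _, a', ha'⟩ := hΨ.proper J hJ.mem
  have : Nonempty N' := nonempty_of_skeleton hJ₀ (hΨ.nontrivial J hJ.mem N' a' ha').1
  obtain ⟨g, hg⟩ := hΨ.elementary I hI J hJ.mem e N a ha N' a' ha'
  have hgt : ∀ t : List I, (t.flatMap a).map g = (t.map e.toFun).flatMap a' := fun t => by
    rw [List.map_flatMap, List.flatMap_map]
    simp only [hg]
  have hlenS : ∀ (t : List J) (j : ℕ), J.qftp t = J.qftp (D.S (n + 1)) →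
      (t.flatMap a').length = l (n, j) := fun t j ht => h.length_eq J hJ.mem N' a' ha' t (n, j) ht
  have hv' : (D.S n).flatMap a' = List.ofFn (g ∘ v) := by
    rw [hs, ← hgt, hv, List.map_ofFn]
  -- the common solution
  have hsol : ∀ r : List J, J.qftp (D.S n ++ r) = J.qftp (D.S n ++ D.S (n + 1)) →
      (ι.onFormula (D.f n).formula).Realize
        (Sum.elim (g ∘ x) fun j => value G a' r (n, (j : ℕ))) := by
    have hg' := (g.map_formula _ _).2 hx
    have hbase : (ι.onFormula (D.f n).formula).Realize
        (Sum.elim (g ∘ x) fun j => value G a' (D.S (n + 1)) (n, (j : ℕ))) := by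
      convert hg' using 1
      rw [Sum.comp_elim]
      congr 1
      ext j
      have := map_value (LHom.id Ψ.lang) G (g := g) (fun n φ v => by
        rw [LHom.realize_onFormula]
        exact g.map_formula φ v) (hgt (s (n + 1))) (p := (n, (j : ℕ))) (by
          rw [← List.length_map (f := g), hgt, ← hs]
          exact hlenS _ _ rfl)
      rw [hs]
      exact this.symm
    intro r hr
    let len := (D.S (n + 1)).flatMap a' |>.length
    have hlen : ∀ j, l (n, j) = len := fun j => (hlenS _ j rfl).symm
    obtain ⟨y, hy⟩ := exists_ofFn (l := (D.S (n + 1)).flatMap a') (n := len) rfl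
    obtain ⟨z, hz⟩ := exists_ofFn (l := r.flatMap a') (n := len)
      ((hlenS r 0 (qftp_append_right hr rfl)).trans (hlen 0))
    have hind := hΨ.indiscernible J hJ.mem N' a' ha' _ _ hr
    rw [List.flatMap_append, List.flatMap_append, hv', hy, hz, ← List.ofFn_fin_append,
      ← List.ofFn_fin_append, tpOver_empty_ofFn_eq_iff] at hind
    have key := hind ((ι.onFormula (D.f n).formula).subst (Sum.elim
      (fun i => (σ i).relabel (Fin.castAdd len))
      fun j => Term.func (G (n, (j : ℕ))) fun i => Term.var (Fin.natAdd _ (Fin.cast (hlen j) i))))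
    have hval : ∀ (t : List J) (w : Fin len → N'), t.flatMap a' = List.ofFn w →
        (Formula.Realize ((ι.onFormula (D.f n).formula).subst (Sum.elim
          (fun i => (σ i).relabel (Fin.castAdd len))
          fun j => Term.func (G (n, (j : ℕ)))
            fun i => Term.var (Fin.natAdd _ (Fin.cast (hlen j) i))))
              (Fin.append (g ∘ v) w) ↔ (ι.onFormula (D.f n).formula).Realize
                (Sum.elim (g ∘ x) fun j => value G a' t (n, (j : ℕ)))) := by
      intro t w hw
      refine (BoundedFormula.realize_subst).trans ?_
      refine Eq.to_iff ?_
      change (ι.onFormula (D.f n).formula).Realize _ = _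
      congr 1
      ext (i | j)
      · simp only [Sum.elim_inl, Term.realize_relabel, Function.comp_apply, ← hσ]
        rw [← HomClass.realize_term]
        congr 1
        ext i
        simp
      · simp only [Sum.elim_inr, Term.realize_func, Term.realize_var, Fin.append_right]
        refine (value_eq G (v := w ∘ Fin.cast (hlen j)) ?_).symm
        rw [hw]
        exact List.ofFn_congr (hlen j).symm w
    rw [hval _ _ hz, hval _ _ hy] at key
    exact key.2 hbase
  have hinc := h.inconsistent N' a' ha' n
  let := ι.reduct N'
  rw [LHom.realize_onFormula, realize_inconsistentFormula] at hinc
  exact hinc ⟨g ∘ x, fun i => by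
    have := hsol _ (D.W_qftp n i)
    rwa [LHom.realize_onFormula] at this⟩

/-- The copy of `p` over the parameters of the tree along `I` is a type which is omitted: it implies the
formulas of all levels. -/
theorem ShearingSequence.Carried.exists_omitted {Ψ : Template τ} {ι : L →ᴸ Ψ.lang}
    {l : ℕ × ℕ → ℕ} {G : ∀ p, Ψ.lang.Functions (l p)} (h : D.Carried K Ψ ι G)
    (hK : IsIndexModelClass lt K) (hJ : IsSat K J) (hΨ : Ψ.InUpsilon K) (hI : I ∈ K)
    (e : IndexModel.Embedding I J) {s : ℕ → List I} (hs : ∀ n, D.S n = (s n).map e.toFun)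
    (hcover : ∀ t : List I, ∃ n, t ⊆ s n) {p : Set (ParamFormula L m M)} (hp : Consistent p)
    (himp : ∀ n, ∃ p₀ ⊆ p, p₀.Finite ∧
      (∀ h ∈ p₀, ∃ w : Fin h.len → ℕ, h.param = D.par ∘ fun i => (n, w i)) ∧
        ∀ x, (∀ h ∈ p₀, h.Sat x) → (D.f n).Sat x)
    {N : Type u} [Ψ.lang.Structure N] {a : I → List N} (ha : Ψ.IsGEM I N a) :
    letI : L.Structure N := ι.reduct N
    ∃ A : Set N, A.Countable ∧ ∃ q : Set (ParamFormula L m N), IsPartialType A q ∧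
      (∀ f ∈ q, ∃ h ∈ p, (⟨m, f.len, f.formula⟩ : Σ m k : ℕ, L.Formula (Fin m ⊕ Fin k)) =
        ⟨m, h.len, h.formula⟩) ∧ ¬ Realized q := by
  have hI₀ : Nonempty I := hK.nonempty I hI
  have hN : Nonempty N := nonempty_of_skeleton hI₀ (hΨ.nontrivial I hI N a ha).1
  have hM : Nonempty M := ⟨D.par (0, 0)⟩
  let : L.Structure N := ι.reduct N
  let u : ℕ × ℕ → N := fun q => value G a (s (q.1 + 1)) q
  have hθ : ∀ n, (D.S n).map (Function.invFun e.toFun) = s n := by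
    intro n
    rw [hs, List.map_map, Function.invFun_comp e.injective, List.map_id]
  have hu : ∀ ψ : L.Formula (ℕ × ℕ), ψ.Realize D.par ↔ ψ.Realize u := by
    refine realize_iff_of_realize_bounded fun n ψ hψ => ?_
    have := h.realize I hI N a ha n (Function.invFun e.toFun)
      (by rw [hθ, hs]; exact (e.qftp_map _).symm) ψ hψ
    rw [LHom.realize_onFormula] at this
    simpa only [hθ] using this
  -- formulas with parameters among `par`, or the corresponding values of `u`
  let ρ : ∀ (h : ParamFormula L m M) (w : Fin h.len → ℕ × ℕ), L.Formula ((ℕ × ℕ) ⊕ Fin m) :=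
    fun h w => h.formula.relabel (Sum.elim Sum.inr fun i => Sum.inl (w i))
  have hρ : ∀ {X : Type u} [L.Structure X] (h : ParamFormula L m M) (w : Fin h.len → ℕ × ℕ)
      (y : ℕ × ℕ → X) (x : Fin m → X), (ρ h w).Realize (Sum.elim y x) ↔
        h.formula.Realize (Sum.elim x (y ∘ w)) := by
    intro X _ h w y x
    rw [Formula.realize_relabel]
    congr! 1
    ext (i | i) <;> rfl
  refine ⟨Set.range u, Set.countable_range u, {f | ∃ h ∈ p, ∃ w : Fin h.len → ℕ × ℕ,
    h.param = D.par ∘ w ∧ f = ⟨h.len, h.formula, u ∘ w⟩}, ⟨?_, ?_⟩, ?_, ?_⟩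
  · rintro _ ⟨h, -, w, -, rfl⟩ i
    exact ⟨w i, rfl⟩
  · intro q₀ hq₀ hfin
    have := hfin.to_subtype
    choose h hh w hw hf using fun f : q₀ => hq₀ f.2
    obtain ⟨x, hx⟩ := hp (Set.range h) (by rintro _ ⟨f, rfl⟩; exact hh f) (Set.finite_range h)
    obtain ⟨x', hx'⟩ := exists_extension_of_finite (fun φ => (hu φ).1)
      (Set.finite_range fun f => ρ (h f) (w f)) (w := x) (by
        rintro _ ⟨f, rfl⟩
        rw [hρ, ← hw]
        exact hx _ ⟨f, rfl⟩)
    refine ⟨x', fun f hf' => ?_⟩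
    have := hx' _ ⟨⟨f, hf'⟩, rfl⟩
    rw [hρ] at this
    rw [show f = _ from hf ⟨f, hf'⟩]
    exact this
  · rintro _ ⟨h, hh, w, -, rfl⟩
    exact ⟨h, hh, rfl⟩
  · rintro ⟨x, hx⟩
    obtain ⟨n, hn⟩ := h.exists_not_realize hK hJ hΨ hI e hs hcover ha x
    obtain ⟨p₀, hp₀, hfin, hw, himp⟩ := himp n
    rw [LHom.realize_onFormula] at hn
    choose w hw using hw
    have := hfin.to_subtype
    let χ : L.Formula ((ℕ × ℕ) ⊕ Fin m) := (ρ (D.f n) fun j => (n, (j : ℕ))).not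
    obtain ⟨x', hx'⟩ := exists_extension_of_finite (fun φ => (hu φ).2)
      ((Set.finite_range fun f : p₀ => ρ f fun i => (n, w f f.2 i)).insert χ) (w := x) (by
        rintro _ (rfl | ⟨⟨f, hf⟩, rfl⟩)
        · rw [Formula.realize_not, hρ]
          exact hn
        · rw [hρ]
          exact hx ⟨f.len, f.formula, u ∘ fun i => (n, w f hf i)⟩ ⟨f, hp₀ hf, _, hw f hf, rfl⟩)
    have h₁ := hx' χ (Set.mem_insert _ _)
    rw [Formula.realize_not, hρ] at h₁
    apply h₁
    have h₂ := himp x' fun f hf => by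
      have := hx' _ (Set.mem_insert_of_mem _ ⟨⟨f, hf⟩, rfl⟩)
      rw [hρ, ← hw f hf] at this
      exact this
    rw [show (D.par ∘ fun j : Fin (D.f n).len => (n, (j : ℕ))) = (D.f n).param from
      funext (D.par_eq n)]
    exact h₂

/-- A witness of unsuperstability yields a larger template, above which all models `GEM(I, Ψ)` omit a
copy of the witnessing type over a countable set. -/
theorem exists_template_omitting (c : Context.{u}) {T : L.Theory} (hT : T.IsComplete)
    {Φ : Template c.τ} {ι : L →ᴸ Φ.lang} (hΦ : Φ.InUpsilonOf c.K ι T) [Nonempty M] [M ⊨ T]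
    {p : Set (ParamFormula L m M)} (hp : WitnessesUnsuperstable c M p) :
    ∃ (Φ' : Template c.τ) (j : Φ.lang →ᴸ Φ'.lang),
      Φ'.InUpsilonOf c.K (j.comp ι) T ∧ Φ.Le c.K Φ' j ∧
      Φ'.lang.card ≤ #T + Φ.lang.card + ℵ₀ ∧
      ∀ (Ψ : Template c.τ) (k : Φ'.lang →ᴸ Ψ.lang),
        Ψ.InUpsilon c.K → Φ'.Le c.K Ψ k →
        ∀ (N : Type u) [Ψ.lang.Structure N] (a : c.I → List N), Ψ.IsGEM c.I N a →
          letI : L.Structure N := (k.comp (j.comp ι)).reduct N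
          ¬ IsSaturated L N (ℵ_ 1) ∧
            ∀ Δ : FormulaSet L, IsDeltaType Δ p → OmitsDeltaType L N Δ := by
  have hK := c.isIndexModelClass
  obtain ⟨J, hJ, ⟨e⟩⟩ := hK.exists_sat c.I c.mem
  obtain ⟨s, D, hs, hcover, hcons, himp⟩ := hp.exists_shearingSequence hJ e
  obtain ⟨Φ', j, l, G, hΦ', hle, hcard, hD⟩ :=
    ShearingSequence.exists_carried (D := D) hK hJ hΦ hT
  refine ⟨Φ', j, hΦ', hle, hcard.trans ?_, fun Ψ k hΨ hle' N _ a ha => ?_⟩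
  · rw [add_assoc]
    exact self_le_add_left _ _
  obtain ⟨A, hA, q, hq, hqp, hom⟩ := (hD.of_le hJ hΦ'.inUpsilon hK hle').exists_omitted hK hJ hΨ
    c.mem e hs hcover hcons himp ha
  refine ⟨fun hsat => hom (hsat A ?_ m q hq), fun Δ hΔ => ⟨A, hA, m, q, hq, fun f hf => ?_, hom⟩⟩
  · exact hA.le_aleph0.trans_lt aleph0_lt_aleph_one
  · obtain ⟨h, hh, heq⟩ := hqp f hf
    rw [heq]
    exact hΔ h hh

end GemModels

theorem theoremt (c : GemModels.Context.{u}) (hc : Countable c.I)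
    {L : FirstOrder.Language.{u, u}} (T : L.Theory) (hT : T.IsComplete)
    (Φ : GemModels.Template c.τ) (ι : L →ᴸ Φ.lang) (hΦ : Φ.InUpsilonOf c.K ι T) :
    (GemModels.Unsuperstable c T →
      ∃ (Φ' : GemModels.Template c.τ) (j : Φ.lang →ᴸ Φ'.lang),
        Φ'.InUpsilonOf c.K (j.comp ι) T ∧ Φ.Le c.K Φ' j ∧
        Φ'.lang.card ≤ #T + Φ.lang.card + ℵ₀ ∧
        ∀ (Ψ : GemModels.Template c.τ) (k : Φ'.lang →ᴸ Ψ.lang),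
          Ψ.InUpsilon c.K → Φ'.Le c.K Ψ k →
          ∀ (N : Type u) [Ψ.lang.Structure N] (a : c.I → List N), Ψ.IsGEM c.I N a →
            letI : L.Structure N := (k.comp (j.comp ι)).reduct N
            ¬ GemModels.IsSaturated L N (ℵ_ 1)) ∧
    (∀ Δ : GemModels.FormulaSet L, GemModels.UnsuperstableFor c T Δ →
      ∃ (Φ' : GemModels.Template c.τ) (j : Φ.lang →ᴸ Φ'.lang),
        Φ'.InUpsilonOf c.K (j.comp ι) T ∧ Φ.Le c.K Φ' j ∧
        Φ'.lang.card ≤ #T + Φ.lang.card + ℵ₀ ∧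
        ∀ (Ψ : GemModels.Template c.τ) (k : Φ'.lang →ᴸ Ψ.lang),
          Ψ.InUpsilon c.K → Φ'.Le c.K Ψ k →
          ∀ (N : Type u) [Ψ.lang.Structure N] (a : c.I → List N), Ψ.IsGEM c.I N a →
            letI : L.Structure N := (k.comp (j.comp ι)).reduct N
            ¬ GemModels.IsSaturated L N (ℵ_ 1) ∧ GemModels.OmitsDeltaType L N Δ) := by
  constructor
  · rintro ⟨M, m, p, hp⟩
    obtain ⟨Φ', j, h₁, h₂, h₃, h₄⟩ := GemModels.exists_template_omitting c hT hΦ hp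
    exact ⟨Φ', j, h₁, h₂, h₃, fun Ψ k hΨ hle N _ a ha => (h₄ Ψ k hΨ hle N a ha).1⟩
  · rintro Δ ⟨M, m, p, hΔ, hp⟩
    obtain ⟨Φ', j, h₁, h₂, h₃, h₄⟩ := GemModels.exists_template_omitting c hT hΦ hp
    exact ⟨Φ', j, h₁, h₂, h₃, fun Ψ k hΨ hle N _ a ha =>
      ⟨(h₄ Ψ k hΨ hle N a ha).1, (h₄ Ψ k hΨ hle N a ha).2 Δ hΔ⟩⟩
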